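/- **Setting.** Let $\mathcal X$ be a convex subset of a real Hilbert space $\mathcal X_0$ with inner product $\langle\cdot,\cdot\rangle$. Let $n\ge 1$, let $f_1,\dots,f_n:\mathcal X_0\to\mathbb R$ be differentiable at every point of $\mathcal X$, put $f=\frac1n\sum_{i=1}^n f_i$, let $\psi$ be a (measurable) convex function on $\mathcal X$, and $F=f+\psi$. Let $x^*$ be a minimizer of $F$ over $\mathcal X$. Let $w$ be a real function that is convex on $\mathcal X$ and differentiable at every point of $\mathcal X$. Write $D_h(x,y)=h(x)-h(y)-\langle\nabla h(y),x-y\rangle$ for the Bregman divergence and $G^*(z)=\sup_{y\in\mathcal X_0}\langle z,y\rangle-G(y)$ for the convex conjugate. A function $G:\mathcal X_0\to[0,\infty)$ is a *CHEF* with parameters $(g,C_G)$, where $C_G>0$ and $g:[0,\infty)\to[0,\infty)$ is increasing with $\lim_{\lambda\to0}g^{-1}(\lambda)=0$ (with $g^{-1}(\lambda)=\inf\{t\ge 0: g(t)\ge\lambda\}$), if (C1) $G(0)=0$, $G$ is convex and $G(-v)=G(v)$; (C2) $G(\lambda v)\ge\lambda g(\lambda)G(v)$ for all $v\in\mathcal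 X_0$ and $\lambda>0$; (C3) for all independent, integrable, mean-zero $\mathcal X_0$-valued random vectors $Z_1,\dots,Z_k$, $\mathbb E\,G^*(\sum_j Z_j)\le C_G\sum_j\mathbb E\,G^*(Z_j)$. **Assumptions.** For a CHEF $G$ with parameters $(g,C_G)$, and for some $L>0$ and $\mu\ge0$: * (B1) $D_w(x,y)\ge G(x-y)$ for all $x,y\in\mathcal X$; * (B2) $0\le D_{f_i}(x,y)\le L\,G(x-y)$ for all $i$, all $x\in\mathcal X_0$ and all $y\in\mathcal X$ (so that each $f_i$ is convex on $\mathcal X$); * (B3) $F(x)-F(x^*)\ge\mu D_w(x^*,x)$ for all $x\in\mathcal X$. **Algorithm (Mirror-Proximal SCSG).** Start from a random $\tilde x_0\in\mathcal X$. In epoch $j=1,\dots,T$: sample uniformly $\mathcal I_j\subset\{1,\dots,n\}$ with $|\mathcal I_j|=B_j$; put $x^{(j)}_0=\tilde x_{j-1}$; sample $N_j$ with $P(N_j=k)=(1-\gamma_j)\gamma_j^k$, $k=0,1,\dots$, where $\gamma_j=\frac{m_j}{m_j+b_j}$; for $k=1,\dots,N_j$ sample uniformly $\tilde{\mathcal I}^{(j)}_{k-1}\subset\{1,\dots,n\}$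 with $|\tilde{\mathcal I}^{(j)}_{k-1}|=b_j$, put $$\nu^{(j)}_{k-1}=\nabla f_{\tilde{\mathcal I}^{(j)}_{k-1}}(x^{(j)}_{k-1})-\nabla f_{\tilde{\mathcal I}^{(j)}_{k-1}}(x^{(j)}_0)+\nabla f_{\mathcal I_j}(\tilde x_{j-1}),\qquad \nabla f_{\mathcal I}=\frac1{|\mathcal I|}\sum_{i\in\mathcal I}\nabla f_i,$$ and let $x^{(j)}_k$ be a minimizer over $y\in\mathcal X$ of $\langle\nu^{(j)}_{k-1},y\rangle+\psi(y)+\frac1{\eta_j}D_w(y,x^{(j)}_{k-1})$ (assumed to exist, and chosen measurably from the past); finally $\tilde x_j=x^{(j)}_{N_j}$. The initial point and all samples are independent. **Theorem.** Fix $\alpha>1$, $m_0>0$ and $\xi\in(0,1)$, a stepsize $\eta>0$ and an integer mini-batch size $b$. For real $t\ge0$ put $m_t=m_0\alpha^t$ and $$\beta(t)=\frac{5\alpha^{1/\xi}}2\,g\!\left(\frac1{12C_G\alpha^{1/\xi}}\right)\frac{m_t}{g(1/m_t)},$$ and run the algorithm with $\eta_j\equiv\eta$, $b_j\equiv b$,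 $m_j=m_0\alpha^j$ and $B_j=\lceil\beta(j)\wedge n\rceil$. Assume $$m_0\ge4\alpha^{1/\xi}\max\{b,4C_G\},\qquad 6\eta L\le\min\left\{1,\;g\!\left(\frac1{12C_G\alpha^{1/\xi}}\right)b\right\}.$$ Then, under (B1)–(B3), for every $T\ge0$, $$\mathbb E\big(F(\tilde x_T)-F(x^*)\big)\le\Lambda_T^{-1}\left(D_F+\frac{D_x}{3\eta L}\right)+\tilde\Lambda_T^{-1}\,\frac{D_H}6\,(T\wedge T_n^*),$$ where $$D_x=L\,\mathbb E D_w(x^*,\tilde x_0),\quad D_F=\mathbb E[F(\tilde x_0)-F(x^*)],\quad D_H=\frac Ln\sum_{i=1}^nG^*\!\left(\frac{\nabla f_i(x^*)-\nabla f(x^*)}L\right)$$ (all in $[0,\infty]$, with $0\cdot\infty=0$), $\Lambda_T=\prod_{j=1}^T\lambda_j$, $\tilde\Lambda_T=\prod_{j=1}^T\tilde\lambda_j$, $$\lambda_j=\begin{cases}\alpha&(j\le T_\kappa^*)\\ \alpha^{1/\xi}&(j>T_\kappa^*)\end{cases},\qquad\tilde\lambda_j=\begin{cases}\alpha&(j\le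 T_n^*\vee T_\kappa^*)\\ \alpha^{1/\xi}&(j>T_n^*\vee T_\kappa^*)\end{cases},$$ $T_\kappa^*$ is defined by $\alpha^{T_\kappa^*}=\frac1{\eta\mu}$ ($T_\kappa^*=\infty$ if $\mu=0$), and $T_n^*=\inf\{t\ge0:\beta(t)\ge n\}$. -/

import Mathlib

open MeasureTheory ProbabilityTheory Filter Topology
open scoped NNReal ENNReal

namespace SCSG

noncomputable section

variable {E : Type*} [NormedAddCommGroup E] [InnerProductSpace ℝ E] [CompleteSpace E]

/-- The Bregman divergence `D_w(x, y) = w(x) - w(y) - ⟨∇w(y), x - y⟩`. -/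
def bregman (w : E → ℝ) (x y : E) : ℝ :=
  w x - w y - inner ℝ (gradient w y) (x - y)

/-- The convex conjugate `G*(z) = sup_y ⟨z, y⟩ - G(y)`, with values in `[-∞, ∞]`. -/
def convexConj (G : E → ℝ) (z : E) : EReal :=
  ⨆ y : E, ((inner ℝ z y - G y : ℝ) : EReal)

/-- The (generalized) inverse `g⁻¹(l) = inf {t ≥ 0 : g(t) ≥ l}` of an increasing function. It is the
usual inverse on the range of `g` when `g` is injective, and `∞` above the range. -/
def genInv (g : ℝ≥0 → ℝ≥0) (l : ℝ≥0) : ℝ≥0∞ :=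
  ⨅ (t : ℝ≥0) (_ : l ≤ g t), (t : ℝ≥0∞)

/-- `G` is a convex sup-homogeneous envelope function (CHEF) with parameters `(g, C)`.
As `G 0 = 0`, the conjugate is nonnegative, so that its expectations make sense in `[0, ∞]`. -/
structure IsCHEF [MeasurableSpace E] (G : E → ℝ) (g : ℝ≥0 → ℝ≥0) (C : ℝ) : Prop where
  g_mono : Monotone g
  g_inv : Tendsto (genInv g) (𝓝 0) (𝓝 0)
  C_pos : 0 < C
  nonneg : ∀ v, 0 ≤ G v
  map_zero : G 0 = 0
  convex : ConvexOn ℝ Set.univ G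
  symm : ∀ v, G (-v) = G v
  sup_hom : ∀ (v : E) (l : ℝ≥0), 0 < l → (l : ℝ) * (g l : ℝ) * G v ≤ G ((l : ℝ) • v)
  /-- The generalized Nemirovsky inequality. -/
  nemirovsky : ∀ (Ω' : Type) [MeasurableSpace Ω'] (P : Measure Ω') [IsProbabilityMeasure P]
    (k : ℕ) (Z : Fin k → Ω' → E), (∀ i, Integrable (Z i) P) → (∀ i, ∫ ω, Z i ω ∂P = 0) →
    iIndepFun Z P →
    ∫⁻ ω, (convexConj G (∑ i, Z i ω)).toENNReal ∂P ≤
      ENNReal.ofReal C * ∑ i, ∫⁻ ω, (convexConj G (Z i ω)).toENNReal ∂P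

/-- The finite-sum loss `f = (1/n) ∑ f_i`. -/
def avgLoss {n : ℕ} (f : Fin n → E → ℝ) (x : E) : ℝ := (1 / (n : ℝ)) * ∑ i, f i x

/-- The composite objective `F = f + ψ`. -/
def objective {n : ℕ} (f : Fin n → E → ℝ) (ψ : E → ℝ) (x : E) : ℝ := avgLoss f x + ψ x

/-- The batch gradient `∇f_s(x) = (1/|s|) ∑_{i ∈ s} ∇f_i(x)`. -/
def batchGrad {n : ℕ} (f : Fin n → E → ℝ) (s : Finset (Fin n)) (x : E) : E :=
  (1 / (s.card : ℝ)) • ∑ i ∈ s, gradient (f i) x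

/-- `z` is a minimizer over `X` of `y ↦ ⟨ν, y⟩ + ψ(y) + (1/η) D_w(y, x)`. -/
def IsMirrorProxStep (X : Set E) (w ψ : E → ℝ) (η : ℝ) (x ν z : E) : Prop :=
  z ∈ X ∧ IsMinOn (fun y => inner ℝ ν y + ψ y + (1 / η) * bregman w y x) X z

/-- The independent sources of randomness of the algorithm: the initial point, the batch of epoch
`j`, the number of inner steps of epoch `j`, and the mini-batch of inner step `k` of epoch `j`. -/
inductive Source : Type
  | init : Source
  | outer (j : ℕ) : Source
  | len (j : ℕ) : Source
  | inner (j k : ℕ) : Source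

/-- The random quantities of a run, epochs being numbered from `1`: `outer j` is the batch `I_j`,
`len j` is `N_j`, `inner j k` is the mini-batch drawn to pass from `x_k` to `x_{k+1}` in epoch `j`,
`x j k` is the inner iterate `x_k` of epoch `j`, and `xt j` is the output of epoch `j`
(`xt 0` being the initial point). The inner iterates are recorded for every `k`; only those with
`k ≤ N_j` enter the output. -/
structure Trajectory (Ω : Type*) (E : Type*) (n : ℕ) where
  outer : ℕ → Ω → Finset (Fin n)
  len : ℕ → Ω → ℕ
  inner : ℕ → ℕ → Ω → Finset (Fin n)
  x : ℕ → ℕ → Ω → E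
  xt : ℕ → Ω → E

/-- The σ-algebra generated by one source of randomness. -/
@[reducible] def Trajectory.sigma {Ω : Type*} {n : ℕ} [MeasurableSpace E] (R : Trajectory Ω E n) :
    Source → MeasurableSpace Ω
  | .init => MeasurableSpace.comap (R.xt 0) inferInstance
  | .outer j => MeasurableSpace.comap (R.outer j) ⊤
  | .len j => MeasurableSpace.comap (R.len j) ⊤
  | .inner j k => MeasurableSpace.comap (R.inner j k) ⊤

/-- The sources that have been used when `x_k` of epoch `j` is computed. -/
def usedBefore (j k : ℕ) : Source → Prop
  | .init => True
  | .outer i => i ≤ j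
  | .len i => i < j
  | .inner i l => i < j ∨ (i = j ∧ l < k)

/-- The σ-algebra generated by the sources that have been used when `x_k` of epoch `j` is
computed. -/
@[reducible] def Trajectory.past {Ω : Type*} {n : ℕ} [MeasurableSpace E] (R : Trajectory Ω E n) (j k : ℕ) :
    MeasurableSpace Ω :=
  ⨆ s ∈ {s | usedBefore j k s}, R.sigma s

/-- `S` is a uniformly random subset of `{1, …, n}` of size `k`. -/
def IsUniformSubset {Ω : Type*} [MeasurableSpace Ω] {n : ℕ} (P : Measure Ω)
    (S : Ω → Finset (Fin n)) (k : ℕ) : Prop :=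
  ∀ s : Finset (Fin n),
    P {ω | S ω = s} = if s.card = k then ((n.choose k : ℕ) : ℝ≥0∞)⁻¹ else 0

/-- `N ∼ Geom(γ)`, that is, `P(N = k) = (1 - γ) γ ^ k` for `k = 0, 1, …`. -/
def IsGeom {Ω : Type*} [MeasurableSpace Ω] (P : Measure Ω) (N : Ω → ℕ) (γ : ℝ) : Prop :=
  ∀ k : ℕ, P {ω | N ω = k} = ENNReal.ofReal ((1 - γ) * γ ^ k)

/-- `R` is a run of `T` epochs of Mirror-Proximal SCSG on `X` for the losses `f i` with regularizer
`ψ` and distance-generating function `w`, with stepsizes `η j`, batch sizes `B j`, inner loop sizes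
`m j` and mini-batch sizes `b j`. Where the minimizer of the mirror-proximal step is not unique, any
choice that depends (measurably) on the past only is allowed. -/
structure IsRun {Ω : Type*} [MeasurableSpace Ω] [MeasurableSpace E] {n : ℕ} (P : Measure Ω)
    (X : Set E) (f : Fin n → E → ℝ) (ψ w : E → ℝ) (T : ℕ)
    (η : ℕ → ℝ) (B : ℕ → ℕ) (m : ℕ → ℝ) (b : ℕ → ℕ) (R : Trajectory Ω E n) : Prop where
  measurable : ∀ s, R.sigma s ≤ ‹MeasurableSpace Ω›
  indep : iIndep R.sigma P
  init_meas : StronglyMeasurable (R.xt 0)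
  init_mem : ∀ ω, R.xt 0 ω ∈ X
  outer_law : ∀ j, 1 ≤ j → j ≤ T → IsUniformSubset P (R.outer j) (B j)
  len_law : ∀ j, 1 ≤ j → j ≤ T → IsGeom P (R.len j) (m j / (m j + b j))
  inner_law : ∀ j k, 1 ≤ j → j ≤ T → IsUniformSubset P (R.inner j k) (b j)
  adapted : ∀ j k, 1 ≤ j → j ≤ T → StronglyMeasurable[R.past j k] (R.x j k)
  start : ∀ j ω, 1 ≤ j → j ≤ T → R.x j 0 ω = R.xt (j - 1) ω
  step : ∀ j k ω, 1 ≤ j → j ≤ T →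
    IsMirrorProxStep X w ψ (η j) (R.x j k ω)
      (batchGrad f (R.inner j k ω) (R.x j k ω) - batchGrad f (R.inner j k ω) (R.x j 0 ω)
        + batchGrad f (R.outer j ω) (R.xt (j - 1) ω))
      (R.x j (k + 1) ω)
  final : ∀ j ω, 1 ≤ j → j ≤ T → R.xt j ω = R.x j (R.len j ω) ω

section Parameters

/-- The inner loop size `m_t = m₀ α ^ t`, for a real index `t`. -/
def innerSize (m₀ α t : ℝ) : ℝ := m₀ * α ^ t

/-- The batch size before rounding and truncation at `n`, for a real index `t`:
`(5 α^{1/ξ} / 2) g(1 / (12 C α^{1/ξ})) m_t / g(1 / m_t)`. -/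
def batchReal (g : ℝ≥0 → ℝ≥0) (C α m₀ ξ t : ℝ) : ℝ :=
  5 * α ^ (1 / ξ) / 2 * (g (Real.toNNReal (1 / (12 * C * α ^ (1 / ξ)))) : ℝ) *
    (innerSize m₀ α t / (g (Real.toNNReal (1 / innerSize m₀ α t)) : ℝ))

/-- The batch size of epoch `j`. -/
def batchSize (g : ℝ≥0 → ℝ≥0) (n : ℕ) (C α m₀ ξ : ℝ) (j : ℕ) : ℕ :=
  ⌈min (batchReal g C α m₀ ξ j) n⌉₊

/-- `T_n*`: the first time `t ≥ 0` at which the batch size (before rounding) reaches `n`. If `g` is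
continuous and the batch size at time `0` is at most `n`, it is the solution of
`batchReal g C α m₀ ξ t = n`. -/
def Tn (g : ℝ≥0 → ℝ≥0) (n : ℕ) (C α m₀ ξ : ℝ) : ℝ :=
  sInf {t : ℝ | 0 ≤ t ∧ (n : ℝ) ≤ batchReal g C α m₀ ξ t}

/-- `T_κ*`: the solution of `α ^ t = 1 / (η μ)`, which is `∞` if `μ = 0`. -/
def Tκ (α η μ : ℝ) : EReal :=
  if μ = 0 then ⊤ else ((Real.logb α (1 / (η * μ)) : ℝ) : EReal)

open Classical in
/-- `∏_{1 ≤ j ≤ T} r_j`, where `r_j = α` if `j ≤ S` and `r_j = α ^ {1/ξ}` otherwise. -/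
def rateProd (α ξ : ℝ) (S : EReal) (T : ℕ) : ℝ :=
  ∏ j ∈ Finset.Icc 1 T, if (((j : ℝ)) : EReal) ≤ S then α else α ^ (1 / ξ)

end Parameters

/-- `D_x = L E D_w(x*, x̃₀)`. -/
def Dx {Ω : Type*} [MeasurableSpace Ω] (P : Measure Ω) (w : E → ℝ) (L : ℝ) (xs : E)
    (x₀ : Ω → E) : ℝ≥0∞ :=
  ENNReal.ofReal L * ∫⁻ ω, ENNReal.ofReal (bregman w xs (x₀ ω)) ∂P

/-- `D_F = E (F(x̃₀) - F(x*))`. -/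
def DF {Ω : Type*} [MeasurableSpace Ω] {n : ℕ} (P : Measure Ω) (f : Fin n → E → ℝ) (ψ : E → ℝ)
    (xs : E) (x₀ : Ω → E) : ℝ≥0∞ :=
  ∫⁻ ω, ENNReal.ofReal (objective f ψ (x₀ ω) - objective f ψ xs) ∂P

/-- `D_H = (L/n) ∑ G*((∇f_i(x*) - ∇f(x*)) / L)`. -/
def DH {n : ℕ} (f : Fin n → E → ℝ) (G : E → ℝ) (L : ℝ) (xs : E) : ℝ≥0∞ :=
  ENNReal.ofReal (L / n) *
    ∑ i, (convexConj G ((1 / L) • (gradient (f i) xs - gradient (avgLoss f) xs))).toENNReal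

end

end SCSG

/-! Noise is measured by the conjugate of `c G`, with the weight `c` left free. Young's inequality
`⟨z, v⟩ ≤ (cG)*(z) + c G(v)` then splits any pairing into a variance term and a multiple of `G`,
which (B1) charges to a Bregman distance of `w`. Assumption (B2) bounds the conjugate at a gradient
difference by a Bregman divergence of `f_i`; averaged over `i` and compared with the optimum, this
is at most the optimality gap (`IsProblem.sum_pconj_gradient_sub_le`). Hoeffding's comparison with
sampling with replacement, (C3) and (C2) yield the factor `C l` for a mean of `b` samples, provided
the weight is large enough relative to `b g(l)` (`IsCHEF.sum_powersetCard_pconj_le`).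

Within an epoch the mini-batch noise is centred given the past, but the batch noise is frozen and
hence correlated with the later iterates. The cure is to compare every step with both `x*` (weight
`p`) and the epoch's starting point `x₀` (weight `q = 1 - p`). The batch noise is then paired with
`(z - x₀) + p (x₀ - x*)`: the second part has mean zero, and the first is absorbed by Young's
inequality into a fraction `1 - γ` of `(q/η) D_w(x₀, z)`. What remains of `D_w(x₀, ·)` decays by
exactly the factor `γ` per step, so it telescopes under the geometric weights
(`IsProblem.inner_step_le`, `geometric_average_le`). The result is one inequality per epoch between
expected gaps and expected distances to `x*` (`IsEpoch.expected_epoch_le`).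

Over the epochs the Lyapunov function is gap plus `s_j/(1 - 1/(6A))` times distance, where `A =
α^{1/ξ}` and `s_j` is proportional to `1/m_j`. Since `s_j` shrinks by `α` per epoch, contraction by
`1/α` costs nothing for the distance. Once `j > T_κ*`, (B3) makes the distance term small against
the gap, and the rate becomes `1/A`. Noise of size `α^{-j} D_H/6` enters only while the batch is not
full, hence only for `j ≤ T_n*` (`lyapunov_le`). -/

namespace SCSG

/-! ### Weighted convex conjugates and first-order optimality. -/

section ConvexAnalysis

variable {E : Type*} [NormedAddCommGroup E] [InnerProductSpace ℝ E]

/-- The convex conjugate of `c G`, as a function with values in `[0, ∞]`. -/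
noncomputable def pconj (G : E → ℝ) (c : ℝ) (z : E) : ℝ≥0∞ :=
  ⨆ v : E, ENNReal.ofReal (inner ℝ z v - c * G v)

lemma ofReal_le_pconj (G : E → ℝ) (c : ℝ) (z v : E) :
    ENNReal.ofReal (inner ℝ z v - c * G v) ≤ pconj G c z :=
  le_iSup (fun v => ENNReal.ofReal (inner ℝ z v - c * G v)) v

lemma inner_le_pconj {G : E → ℝ} {c : ℝ} {z : E} (h : pconj G c z ≠ ⊤) (v : E) :
    inner ℝ z v ≤ (pconj G c z).toReal + c * G v := by
  have h1 := ENNReal.toReal_mono h (ofReal_le_pconj G c z v)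
  have h2 := Real.le_coe_toNNReal (inner ℝ z v - c * G v)
  have h3 : (ENNReal.ofReal (inner ℝ z v - c * G v)).toReal
      = ((Real.toNNReal (inner ℝ z v - c * G v) : ℝ≥0) : ℝ) := rfl
  linarith

/-- The weights add along with the vectors, with no convexity of `G` needed. This is why deviations
made of four or three pieces of weight `L` are later measured with weight `4 * L` or `3 * L`. -/
lemma pconj_add (G : E → ℝ) (c d : ℝ) (z w : E) :
    pconj G (c + d) (z + w) ≤ pconj G c z + pconj G d w := by
  refine iSup_le fun v => ?_
  calc ENNReal.ofReal (inner ℝ (z + w) v - (c + d) * G v)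
      = ENNReal.ofReal ((inner ℝ z v - c * G v) + (inner ℝ w v - d * G v)) := by
        rw [inner_add_left]; ring_nf
    _ ≤ _ := ENNReal.ofReal_add_le.trans
        (add_le_add (ofReal_le_pconj G c z v) (ofReal_le_pconj G d w v))

lemma pconj_anti {G : E → ℝ} (hG : ∀ v, 0 ≤ G v) {c d : ℝ} (hcd : c ≤ d) (z : E) :
    pconj G d z ≤ pconj G c z := by
  refine iSup_mono fun v => ENNReal.ofReal_le_ofReal ?_
  have := mul_le_mul_of_nonneg_right hcd (hG v)
  linarith

lemma pconj_neg {G : E → ℝ} (hG : ∀ v, G (-v) = G v) (c : ℝ) (z : E) :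
    pconj G c (-z) = pconj G c z := by
  refine le_antisymm (iSup_le fun v => ?_) (iSup_le fun v => ?_)
  · rw [inner_neg_left, ← inner_neg_right, ← hG v]; exact ofReal_le_pconj G c z (-v)
  · have := ofReal_le_pconj G c (-z) (-v)
    rwa [inner_neg_neg, hG v] at this

lemma pconj_zero {G : E → ℝ} (hG : ∀ v, 0 ≤ G v) {c : ℝ} (hc : 0 ≤ c) : pconj G c 0 = 0 := by
  refine le_antisymm (iSup_le fun v => ?_) bot_le
  rw [inner_zero_left, zero_sub, ENNReal.ofReal_of_nonpos]
  have := mul_nonneg hc (hG v)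
  linarith

lemma pconj_smul_le (G : E → ℝ) {t : ℝ} (ht : 0 < t) (c : ℝ) (z : E) :
    pconj G (t * c) (t • z) ≤ ENNReal.ofReal t * pconj G c z := by
  refine iSup_le fun v => ?_
  calc ENNReal.ofReal (inner ℝ (t • z) v - t * c * G v)
      = ENNReal.ofReal t * ENNReal.ofReal (inner ℝ z v - c * G v) := by
        rw [← ENNReal.ofReal_mul ht.le, real_inner_smul_left]; ring_nf
    _ ≤ _ := by gcongr; exact ofReal_le_pconj G c z v

lemma pconj_sum_le {ι : Type*} (G : E → ℝ) (c : ℝ) (s : Finset ι) (a : ι → ℝ) (z : ι → E)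
    (ha : ∀ i ∈ s, 0 ≤ a i) (hs : ∑ i ∈ s, a i = 1) :
    pconj G c (∑ i ∈ s, a i • z i) ≤ ∑ i ∈ s, ENNReal.ofReal (a i) * pconj G c (z i) := by
  refine iSup_le fun v => ?_
  have h : inner ℝ (∑ i ∈ s, a i • z i) v - c * G v
      = ∑ i ∈ s, a i * (inner ℝ (z i) v - c * G v) := by
    simp only [mul_sub, Finset.sum_sub_distrib, ← Finset.sum_mul, hs, one_mul, sum_inner,
      real_inner_smul_left]
  rw [h]
  refine (ENNReal.ofReal_le_ofReal (Finset.sum_le_sum fun i hi =>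
    mul_le_mul_of_nonneg_left (Real.le_coe_toNNReal _) (ha i hi))).trans ?_
  rw [ENNReal.ofReal_sum_of_nonneg fun i hi => mul_nonneg (ha i hi) NNReal.zero_le_coe]
  refine Finset.sum_le_sum fun i hi => ?_
  rw [ENNReal.ofReal_mul (ha i hi), ENNReal.ofReal_coe_nnreal]
  gcongr
  exact ofReal_le_pconj G c (z i) v

lemma pconj_avg_le {ι : Type*} (G : E → ℝ) (c : ℝ) {s : Finset ι} (hs : s.Nonempty) (z : ι → E) :
    pconj G c ((1 / (s.card : ℝ)) • ∑ i ∈ s, z i)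
      ≤ ENNReal.ofReal (1 / s.card) * ∑ i ∈ s, pconj G c (z i) := by
  have h0 : (s.card : ℝ) ≠ 0 := by exact_mod_cast hs.card_pos.ne'
  have := pconj_sum_le G c s (fun _ => 1 / (s.card : ℝ)) z (fun _ _ => by positivity)
    (by simp [h0])
  rwa [← Finset.smul_sum, ← Finset.mul_sum] at this

/-- The conjugate form of (C2), by the substitution `v = l u` in the supremum: a larger weight `c`
may be traded for a small prefactor `l`. -/
lemma pconj_le_of_sup_hom {G : E → ℝ} {c r : ℝ} {l : ℝ} (hc : 0 ≤ c) (hl : 0 < l)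
    (h : ∀ v, l * r * G v ≤ G (l • v)) (z : E) :
    pconj G c z ≤ ENNReal.ofReal l * pconj G (c * r) z := by
  refine iSup_le fun v => ?_
  refine le_trans (ENNReal.ofReal_le_ofReal ?_)
    ((ENNReal.ofReal_mul hl.le).trans_le
      (mul_le_mul_right (ofReal_le_pconj G (c * r) z (l⁻¹ • v)) (ENNReal.ofReal l)))
  have h1 := mul_le_mul_of_nonneg_left (h (l⁻¹ • v)) hc
  rw [smul_inv_smul₀ hl.ne'] at h1
  rw [real_inner_smul_right, mul_sub, mul_inv_cancel_left₀ hl.ne']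
  linarith

lemma pconj_one_eq (G : E → ℝ) (z : E) :
    pconj G 1 z = (convexConj G z).toENNReal := by
  refine le_antisymm (iSup_le fun v => ?_) ?_
  · rw [one_mul, ← EReal.real_coe_toENNReal]
    exact EReal.toENNReal_le_toENNReal
      (le_iSup (fun y : E => ((inner ℝ z y - G y : ℝ) : EReal)) v)
  · have h : convexConj G z ≤ (pconj G 1 z : EReal) := by
      refine iSup_le fun v => ?_
      have := ofReal_le_pconj G 1 z v
      rw [one_mul] at this
      refine le_trans ?_ (EReal.coe_ennreal_le_coe_ennreal_iff.2 this)
      rw [EReal.coe_ennreal_ofReal]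
      exact_mod_cast le_max_left _ _
    simpa using EReal.toENNReal_le_toENNReal h

/-- The first-order optimality condition for a composite objective. -/
lemma inner_add_sub_nonneg_of_isMinOn [CompleteSpace E] {X : Set E} {h ψ : E → ℝ} {h' z y : E}
    (hψ : ConvexOn ℝ X ψ) (hz : z ∈ X) (hy : y ∈ X) (hh : HasGradientAt h h' z)
    (hmin : IsMinOn (fun x => h x + ψ x) X z) :
    0 ≤ inner ℝ h' (y - z) + ψ y - ψ z := by
  have hd : HasDerivAt (fun t : ℝ => h (z + t • (y - z))) (inner ℝ h' (y - z)) 0 := by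
    have h1 : HasDerivAt (fun t : ℝ => z + t • (y - z)) (y - z) 0 := by
      simpa using ((hasDerivAt_id (0 : ℝ)).smul_const (y - z)).const_add z
    -- The one-sided derivative along the segment from `z` to `y` suffices: only `h` is
    -- differentiated, while `ψ` is handled by its chord.
    have h2 : HasFDerivAt h (InnerProductSpace.toDual ℝ E h') (z + (0 : ℝ) • (y - z)) := by
      simpa using hh.hasFDerivAt
    have h3 := h2.comp_hasDerivAt (0 : ℝ) h1
    exact h3
  have hs := hd.tendsto_slope_zero_right
  have h3 : ∀ᶠ t in 𝓝[>] (0 : ℝ), ψ z - ψ y ≤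
      t⁻¹ • (h (z + (0 + t) • (y - z)) - h (z + (0 : ℝ) • (y - z))) := by
    filter_upwards [Ioo_mem_nhdsGT (zero_lt_one (α := ℝ))] with t ht
    have hzt : z + t • (y - z) = (1 - t) • z + t • y := by module
    have hm : z + t • (y - z) ∈ X := by
      rw [hzt]; exact hψ.1 hz hy (by linarith [ht.2]) ht.1.le (by ring)
    have h4 : h z + ψ z ≤ h (z + t • (y - z)) + ψ (z + t • (y - z)) := hmin hm
    have h5 : ψ (z + t • (y - z)) ≤ (1 - t) • ψ z + t • ψ y := by
      rw [hzt]; exact hψ.2 hz hy (by linarith [ht.2]) ht.1.le (by ring)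
    simp only [smul_eq_mul] at h5
    rw [zero_add, zero_smul, add_zero, smul_eq_mul, inv_mul_eq_div, le_div_iff₀ ht.1]
    linarith
  have := ge_of_tendsto hs h3
  linarith

end ConvexAnalysis

/-! ### Deterministic consequences of the assumptions, up to the mirror-proximal step. -/

section Problem

variable {E : Type*} [NormedAddCommGroup E] [InnerProductSpace ℝ E] [CompleteSpace E]

lemma bregman_self (w : E → ℝ) (x : E) : bregman w x x = 0 := by simp [bregman]

/-- The deterministic assumptions on the composite problem and on its distance-generating
function. -/
structure IsProblem {n : ℕ} (X : Set E) (f : Fin n → E → ℝ) (ψ w : E → ℝ) (xs : E) (G : E → ℝ)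
    (L : ℝ) : Prop where
  n_pos : 0 < n
  diff_f : ∀ i, ∀ x ∈ X, DifferentiableAt ℝ (f i) x
  conv_ψ : ConvexOn ℝ X ψ
  diff_w : ∀ x ∈ X, DifferentiableAt ℝ w x
  mem : xs ∈ X
  min : IsMinOn (objective f ψ) X xs
  G_nonneg : ∀ v, 0 ≤ G v
  G_symm : ∀ v, G (-v) = G v
  le_bregman_w : ∀ x ∈ X, ∀ y ∈ X, G (x - y) ≤ bregman w x y
  L_pos : 0 < L
  bregman_f : ∀ i, ∀ x, ∀ y ∈ X,
    0 ≤ bregman (f i) x y ∧ bregman (f i) x y ≤ L * G (x - y)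

namespace IsProblem

variable {n : ℕ} {X : Set E} {f : Fin n → E → ℝ} {ψ w : E → ℝ} {xs : E} {G : E → ℝ} {L : ℝ}

lemma bregman_w_nonneg (h : IsProblem X f ψ w xs G L) {x y : E} (hx : x ∈ X) (hy : y ∈ X) :
    0 ≤ bregman w x y :=
  (h.G_nonneg _).trans (h.le_bregman_w x hx y hy)

lemma hasGradientAt_avgLoss (h : IsProblem X f ψ w xs G L) {x : E} (hx : x ∈ X) :
    HasGradientAt (avgLoss f) (batchGrad f Finset.univ x) x := by
  have h1 : HasFDerivAt (fun y => ∑ i, f i y) (∑ i, fderiv ℝ (f i) x) x :=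
    HasFDerivAt.fun_sum fun i _ => (h.diff_f i x hx).hasFDerivAt
  have h2 := h1.const_mul (1 / (n : ℝ))
  rw [hasGradientAt_iff_hasFDerivAt]
  refine h2.congr_fderiv ?_
  ext v
  simp [batchGrad]

lemma gradient_avgLoss (h : IsProblem X f ψ w xs G L) {x : E} (hx : x ∈ X) :
    gradient (avgLoss f) x = batchGrad f Finset.univ x :=
  (h.hasGradientAt_avgLoss hx).gradient

lemma bregman_avgLoss (h : IsProblem X f ψ w xs G L) (x : E) {y : E} (hy : y ∈ X) :
    bregman (avgLoss f) x y = (1 / (n : ℝ)) * ∑ i, bregman (f i) x y := by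
  simp only [bregman, h.gradient_avgLoss hy, batchGrad, avgLoss, Finset.sum_sub_distrib,
    real_inner_smul_left, sum_inner, Finset.card_univ, Fintype.card_fin]
  ring

lemma bregman_avgLoss_le (h : IsProblem X f ψ w xs G L) (x : E) {y : E} (hy : y ∈ X) :
    0 ≤ bregman (avgLoss f) x y ∧ bregman (avgLoss f) x y ≤ L * G (x - y) := by
  have hn : (0 : ℝ) < n := by exact_mod_cast h.n_pos
  rw [h.bregman_avgLoss x hy]
  refine ⟨mul_nonneg (by positivity) (Finset.sum_nonneg fun i _ => (h.bregman_f i x y hy).1), ?_⟩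
  calc (1 / (n : ℝ)) * ∑ i, bregman (f i) x y
      ≤ (1 / (n : ℝ)) * ∑ _i : Fin n, L * G (x - y) := by
        gcongr with i; exact (h.bregman_f i x y hy).2
    _ = L * G (x - y) := by
        rw [Finset.sum_const, Finset.card_univ, Fintype.card_fin, nsmul_eq_mul]; field_simp

/-- The value `f_i(x - v)` is bounded above by smoothness at `x` and below by the tangent at `y`;
comparing the two bounds gives co-coercivity. The point `x - v` may leave `X`, so (B2) is needed on
the whole space in its first argument. -/
lemma pconj_gradient_sub_le (h : IsProblem X f ψ w xs G L) (i : Fin n) {x y : E} (hx : x ∈ X)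
    (hy : y ∈ X) :
    pconj G L (gradient (f i) x - gradient (f i) y) ≤ ENNReal.ofReal (bregman (f i) x y) := by
  refine iSup_le fun v => ENNReal.ofReal_le_ofReal ?_
  have h1 := (h.bregman_f i (x - v) x hx).2
  have h2 := (h.bregman_f i (x - v) y hy).1
  have e1 : x - v - x = -v := by abel
  have e2 : x - v - y = (x - y) - v := by abel
  simp only [bregman, e1, e2, h.G_symm, inner_neg_right, inner_sub_right, inner_sub_left]
    at h1 h2 ⊢
  linarith

/-- Optimality of `xs` says that `-∇f(xs)` acts as a subgradient of `ψ` over `X`, so the linear part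
of the divergence is at most `ψ x - ψ xs`. -/
lemma bregman_avgLoss_xs_le (h : IsProblem X f ψ w xs G L) {x : E} (hx : x ∈ X) :
    bregman (avgLoss f) x xs ≤ objective f ψ x - objective f ψ xs := by
  have := inner_add_sub_nonneg_of_isMinOn (h := avgLoss f) h.conv_ψ h.mem hx
    (h.hasGradientAt_avgLoss h.mem) h.min
  simp only [bregman, h.gradient_avgLoss h.mem, objective]
  linarith

lemma objective_sub_nonneg (h : IsProblem X f ψ w xs G L) {x : E} (hx : x ∈ X) :
    0 ≤ objective f ψ x - objective f ψ xs :=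
  sub_nonneg.2 (h.min hx)

/-- The average of the conjugates at the gradient deviations from the optimum is controlled by the
optimality gap. -/
lemma sum_pconj_gradient_sub_le (h : IsProblem X f ψ w xs G L) {x : E} (hx : x ∈ X) :
    ENNReal.ofReal (1 / n) * ∑ i, pconj G L (gradient (f i) x - gradient (f i) xs)
      ≤ ENNReal.ofReal (objective f ψ x - objective f ψ xs) := by
  calc ENNReal.ofReal (1 / n) * ∑ i, pconj G L (gradient (f i) x - gradient (f i) xs)
      ≤ ENNReal.ofReal (1 / n) * ∑ i, ENNReal.ofReal (bregman (f i) x xs) := by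
        gcongr with i; exact h.pconj_gradient_sub_le i hx h.mem
    _ = ENNReal.ofReal (bregman (avgLoss f) x xs) := by
        rw [← ENNReal.ofReal_sum_of_nonneg fun i _ => (h.bregman_f i x xs h.mem).1,
          ← ENNReal.ofReal_mul (by positivity), h.bregman_avgLoss x h.mem]
    _ ≤ _ := ENNReal.ofReal_le_ofReal (h.bregman_avgLoss_xs_le hx)

/-- The standard fact for Fréchet differentiable convex functions, used for measurability of the
batch gradients. Only the lower half of (B2) and differentiability at `y` enter, so `G` need not be
continuous. -/
lemma continuousOn_gradient (h : IsProblem X f ψ w xs G L) (i : Fin n) :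
    ContinuousOn (gradient (f i)) X := by
  intro y hy
  rw [Metric.continuousWithinAt_iff]
  intro ε hε
  have hg := (h.diff_f i y hy).hasGradientAt
  have ho := hasGradientAt_iff_isLittleO.1 hg
  have h1 := ho.def (show 0 < ε / 8 by positivity)
  obtain ⟨δ, hδ, hb⟩ := Metric.eventually_nhds_iff.1 h1
  refine ⟨δ / 4, by positivity, fun {x} hx hxy => ?_⟩
  rw [dist_eq_norm] at hxy ⊢
  set d := gradient (f i) x - gradient (f i) y with hd
  by_contra hcon
  push Not at hcon
  have hdpos : 0 < ‖d‖ := lt_of_lt_of_le hε hcon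
  -- A test vector of length `δ/2` in the direction of the gradient difference. The tangent at `x`
  -- and the expansions at `y` force `⟨d, v⟩ ≤ (ε/8)(δ + δ/4)`, which is less than `εδ/2 ≤ ⟨d, v⟩`.
  set v := (δ / (2 * ‖d‖)) • d with hv
  have hvn : ‖v‖ = δ / 2 := by
    rw [hv, norm_smul, Real.norm_of_nonneg (by positivity)]; field_simp
  have hdv : inner ℝ d v = δ / 2 * ‖d‖ := by
    rw [hv, real_inner_smul_right, real_inner_self_eq_norm_sq]; field_simp
  have hlow := (h.bregman_f i (x + v) x hx).1
  have hxv : ‖x + v - y‖ < δ := by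
    calc ‖x + v - y‖ = ‖(x - y) + v‖ := by congr 1; abel
      _ ≤ ‖x - y‖ + ‖v‖ := norm_add_le _ _
      _ < δ := by rw [hvn]; linarith
  have hup := hb (y := x + v) (by rwa [dist_eq_norm])
  have hup2 := hb (y := x) (by rw [dist_eq_norm]; linarith)
  rw [Real.norm_eq_abs, abs_le] at hup hup2
  have hε1 : ε / 8 * ‖x + v - y‖ ≤ ε / 8 * δ := by gcongr
  have hε2 : ε / 8 * ‖x - y‖ ≤ ε / 8 * (δ / 4) := by gcongr
  have e1 : x + v - x = v := by abel
  have e2 : x + v - y = (x - y) + v := by abel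
  simp only [bregman, e1] at hlow
  have hin : inner ℝ d v = inner ℝ (gradient (f i) x) v - inner ℝ (gradient (f i) y) v := by
    rw [hd, inner_sub_left]
  have hup' := hup.2
  rw [e2, inner_add_right, ← e2] at hup'
  have : δ / 2 * ε ≤ δ / 2 * ‖d‖ := by gcongr
  have hp : 0 < ε * δ := by positivity
  nlinarith [hup2.1]

/-- The basic inequality for one mirror-proximal step from `x` to `z`. -/
lemma mirrorProx_step_le (h : IsProblem X f ψ w xs G L) {η : ℝ} (hη : 0 < η) {x ν z y : E}
    (hx : x ∈ X) (hz : IsMirrorProxStep X w ψ η x ν z) (hy : y ∈ X) :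
    objective f ψ z - objective f ψ y + (1 / η) * bregman w y z
      ≤ (1 / η) * bregman w y x + inner ℝ (batchGrad f Finset.univ x - ν) (z - y)
        - (1 / η - L) * G (z - x) := by
  obtain ⟨hzX, hzmin⟩ := hz
  have hgrad : HasGradientAt (fun u => inner ℝ ν u + (1 / η) * bregman w u x)
      (ν + (1 / η) • (gradient w z - gradient w x)) z := by
    have h1 : HasFDerivAt (fun u => inner ℝ ν u) (innerSL ℝ ν) z := (innerSL ℝ ν).hasFDerivAt
    have h2 : HasFDerivAt (fun u => inner ℝ (gradient w x) (u - x))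
        (innerSL ℝ (gradient w x)) z :=
      (innerSL ℝ (gradient w x)).hasFDerivAt.comp z ((hasFDerivAt_id z).sub_const x)
    have h3 := ((((h.diff_w z hzX).hasFDerivAt.sub_const (w x)).sub h2).const_mul (1 / η))
    rw [hasGradientAt_iff_hasFDerivAt]
    refine (h1.add h3).congr_fderiv ?_
    ext v
    simp [inner_gradient_left]
  have hopt := inner_add_sub_nonneg_of_isMinOn h.conv_ψ hzX hy hgrad (by
    convert hzmin using 2; ring)
  -- Smoothness transfers the linear model from `z` to `x`, the tangent inequality from `x` to `y`;
  -- the three-point identity for `D_w` is left to the linear arithmetic.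
  have hsm := (h.bregman_avgLoss_le z hx).2
  have hcv := (h.bregman_avgLoss_le y hx).1
  have hB := mul_le_mul_of_nonneg_left (h.le_bregman_w z hzX x hx) (one_div_pos.2 hη).le
  simp only [bregman, h.gradient_avgLoss hx, objective, inner_add_left, inner_sub_left,
    inner_sub_right, real_inner_smul_left] at *
  linarith

end IsProblem

end Problem

end SCSG

namespace SCSG

/-! ### Sampling without replacement: unbiasedness and the Nemirovsky bound. -/

section Sampling

open Finset

/-- Composing with a transposition shows that the sum does not depend on `i`; then average over `i`.
-/
lemma card_smul_sum_perm_apply {α M : Type*} [Fintype α] [DecidableEq α] [AddCommMonoid M]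
    (y : α → M) (i : α) :
    Fintype.card α • ∑ τ : Equiv.Perm α, y (τ i) = (Fintype.card α).factorial • ∑ a, y a := by
  have h1 : ∀ j, ∑ τ : Equiv.Perm α, y (τ j) = ∑ τ : Equiv.Perm α, y (τ i) := fun j =>
    Fintype.sum_equiv (Equiv.mulRight (Equiv.swap i j)) _ _ fun τ => by simp
  calc Fintype.card α • ∑ τ : Equiv.Perm α, y (τ i)
      = ∑ j, ∑ τ : Equiv.Perm α, y (τ j) := by
        rw [Finset.sum_congr rfl fun j _ => h1 j, Finset.sum_const, Finset.card_univ]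
    _ = ∑ τ : Equiv.Perm α, ∑ j, y (τ j) := Finset.sum_comm
    _ = ∑ _τ : Equiv.Perm α, ∑ a, y a :=
        Finset.sum_congr rfl fun τ _ => Equiv.sum_comp τ y
    _ = _ := by rw [Finset.sum_const, Finset.card_univ, Fintype.card_perm]

lemma exists_perm_map_eq {α : Type*} [Fintype α] [DecidableEq α] {s t : Finset α}
    (h : s.card = t.card) : ∃ σ : Equiv.Perm α, s.map σ.toEmbedding = t := by
  let e : {x // x ∈ s} ≃ {x // x ∈ t} := Finset.equivOfCardEq h
  refine ⟨e.extendSubtype, Finset.eq_of_subset_of_card_le ?_ (by rw [card_map, h])⟩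
  intro y hy
  obtain ⟨x, hx, rfl⟩ := Finset.mem_map.1 hy
  exact e.extendSubtype_mem x hx

/-- The symmetric group acts transitively on subsets of a given size, so a uniform subset is a
random permutation of a fixed one. Stated without division so as to serve both vectors and `ℝ≥0∞`.
-/
lemma choose_smul_sum_perm_map {n : ℕ} {M : Type*} [AddCommMonoid M] (H : Finset (Fin n) → M)
    (s₀ : Finset (Fin n)) :
    n.choose s₀.card • ∑ σ : Equiv.Perm (Fin n), H (s₀.map σ.toEmbedding)
      = n.factorial • ∑ s ∈ powersetCard s₀.card univ, H s := by
  have h1 : ∀ s ∈ powersetCard s₀.card univ,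
      ∑ σ : Equiv.Perm (Fin n), H (s.map σ.toEmbedding)
        = ∑ σ : Equiv.Perm (Fin n), H (s₀.map σ.toEmbedding) := by
    intro s hs
    obtain ⟨ρ, rfl⟩ := exists_perm_map_eq (mem_powersetCard.1 hs).2.symm
    refine Fintype.sum_equiv (Equiv.mulRight ρ) _ _ fun σ => ?_
    rw [Finset.map_map]
    rfl
  calc n.choose s₀.card • ∑ σ : Equiv.Perm (Fin n), H (s₀.map σ.toEmbedding)
      = ∑ s ∈ powersetCard s₀.card univ, ∑ σ : Equiv.Perm (Fin n), H (s.map σ.toEmbedding) := by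
        rw [Finset.sum_congr rfl h1, Finset.sum_const, card_powersetCard, card_univ,
          Fintype.card_fin]
    _ = ∑ σ : Equiv.Perm (Fin n), ∑ s ∈ powersetCard s₀.card univ, H (s.map σ.toEmbedding) :=
        Finset.sum_comm
    _ = ∑ _σ : Equiv.Perm (Fin n), ∑ s ∈ powersetCard s₀.card univ, H s := by
        refine Finset.sum_congr rfl fun σ _ => ?_
        refine Finset.sum_bij' (fun s _ => s.map σ.toEmbedding)
          (fun s _ => s.map σ.symm.toEmbedding) ?_ ?_ ?_ ?_ ?_
        · intro s hs; simpa [mem_powersetCard] using hs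
        · intro s hs; simpa [mem_powersetCard] using hs
        · intro s _; ext; simp
        · intro s _; ext; simp
        · intro s _; rfl
    _ = _ := by rw [Finset.sum_const, Finset.card_univ, Fintype.card_perm, Fintype.card_fin]

/-- The mean of a uniformly random subset is unbiased. -/
lemma sum_powersetCard_mean {n : ℕ} {V : Type*} [AddCommGroup V] [Module ℝ V] {b : ℕ}
    (hb : 0 < b) (hbn : b ≤ n) (z : Fin n → V) :
    ((n.choose b : ℕ) : ℝ)⁻¹ • ∑ s ∈ powersetCard b univ, (1 / (b : ℝ)) • ∑ i ∈ s, z i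
      = (1 / (n : ℝ)) • ∑ i, z i := by
  obtain ⟨s₀, -, hs₀⟩ := exists_subset_card_eq (s := (univ : Finset (Fin n))) (n := b) (by simpa)
  have h1 := choose_smul_sum_perm_map (fun s => ∑ i ∈ s, z i) s₀
  have h2 : n • ∑ σ : Equiv.Perm (Fin n), ∑ i ∈ s₀.map σ.toEmbedding, z i
      = (b * n.factorial) • ∑ i, z i := by
    simp only [Finset.sum_map, Equiv.coe_toEmbedding]
    rw [Finset.sum_comm, Finset.smul_sum]
    have := fun i => card_smul_sum_perm_apply z i
    simp only [Fintype.card_fin] at this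
    rw [Finset.sum_congr rfl fun i _ => this i, Finset.sum_const, hs₀, mul_smul]
  rw [hs₀] at h1
  simp only [← Nat.cast_smul_eq_nsmul ℝ] at h1 h2
  have hn' : (n : ℝ) ≠ 0 := by exact_mod_cast (hb.trans_le hbn).ne'
  have hb' : (b : ℝ) ≠ 0 := by exact_mod_cast hb.ne'
  have hc : ((n.choose b : ℕ) : ℝ) ≠ 0 := by exact_mod_cast (Nat.choose_pos hbn).ne'
  have hf : ((n.factorial : ℕ) : ℝ) ≠ 0 := by exact_mod_cast n.factorial_ne_zero
  rw [← Finset.smul_sum]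
  have h3 : ∑ s ∈ powersetCard b univ, ∑ i ∈ s, z i
      = ((n.factorial : ℕ) : ℝ)⁻¹ • ((n.choose b : ℕ) : ℝ) •
        ∑ σ : Equiv.Perm (Fin n), ∑ i ∈ s₀.map σ.toEmbedding, z i := by
    rw [h1, inv_smul_smul₀ hf]
  have h4 : ∑ σ : Equiv.Perm (Fin n), ∑ i ∈ s₀.map σ.toEmbedding, z i
      = (n : ℝ)⁻¹ • ((b * n.factorial : ℕ) : ℝ) • ∑ i, z i := by
    rw [← h2, inv_smul_smul₀ hn']
  rw [h3, h4]
  simp only [smul_smul]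
  congr 1
  push_cast
  field_simp

variable {E : Type*} [NormedAddCommGroup E] [InnerProductSpace ℝ E]

/-- Hoeffding's comparison, along the orbit of a single sample with replacement. -/
lemma sum_perm_pconj_mean_le (G : E → ℝ) (c : ℝ) {n b : ℕ} (hb : 0 < b) (z : Fin n → E)
    (S : Finset (Fin n)) (hS : S.card = b) (r : Fin b → Fin n) (hr : ∀ j, r j ∈ S) :
    ∑ σ : Equiv.Perm (Fin n), pconj G c ((1 / (b : ℝ)) • ∑ i ∈ S, z (σ i))
      ≤ ∑ σ : Equiv.Perm (Fin n), pconj G c ((1 / (b : ℝ)) • ∑ j, z (σ (r j))) := by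
  have hb' : (b : ℝ) ≠ 0 := by exact_mod_cast hb.ne'
  have hf : ((b.factorial : ℕ) : ℝ) ≠ 0 := by exact_mod_cast b.factorial_ne_zero
  have hcardS : Fintype.card S = b := by simpa using hS
  have hcardP : Fintype.card (Equiv.Perm S) = b.factorial := by rw [Fintype.card_perm, hcardS]
  -- The mean over `S` is the average, over permutations `τ` of `S`, of the means along `τ ∘ r`,
  -- because each `τ (r j)` is uniform on `S` even when `r` repeats values. Jensen applies, and `τ`
  -- is then absorbed into `σ`.
  have key : ∀ σ : Equiv.Perm (Fin n), (1 / (b : ℝ)) • ∑ i ∈ S, z (σ i)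
      = ∑ τ : Equiv.Perm S, (1 / (b.factorial : ℝ)) •
        ((1 / (b : ℝ)) • ∑ j, z (σ (τ ⟨r j, hr j⟩))) := by
    intro σ
    have h1 := fun i => card_smul_sum_perm_apply (fun x : S => z (σ x)) i
    simp only [hcardS, ← Nat.cast_smul_eq_nsmul ℝ] at h1
    rw [← Finset.smul_sum, ← Finset.smul_sum, Finset.sum_comm]
    have h2 : ∀ j, ∑ τ : Equiv.Perm S, z (σ (τ ⟨r j, hr j⟩))
        = (b : ℝ)⁻¹ • ((b.factorial : ℕ) : ℝ) • ∑ i : S, z (σ i) := fun j => by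
      rw [← h1 ⟨r j, hr j⟩, inv_smul_smul₀ hb']
    rw [Finset.sum_congr rfl fun j _ => h2 j, Finset.sum_const, card_univ, Fintype.card_fin,
      ← Nat.cast_smul_eq_nsmul ℝ, smul_inv_smul₀ hb', Finset.sum_coe_sort S (fun i => z (σ i))]
    simp only [smul_smul]
    congr 1
    field_simp
  calc ∑ σ : Equiv.Perm (Fin n), pconj G c ((1 / (b : ℝ)) • ∑ i ∈ S, z (σ i))
      ≤ ∑ σ : Equiv.Perm (Fin n), ∑ τ : Equiv.Perm S, ENNReal.ofReal (1 / (b.factorial : ℝ)) *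
          pconj G c ((1 / (b : ℝ)) • ∑ j, z (σ (τ ⟨r j, hr j⟩))) := by
        refine Finset.sum_le_sum fun σ _ => ?_
        rw [key σ]
        refine pconj_sum_le G c _ _ _ (fun _ _ => by positivity) ?_
        rw [Finset.sum_const, card_univ, hcardP, nsmul_eq_mul]
        field_simp
    _ = ∑ τ : Equiv.Perm S, ENNReal.ofReal (1 / (b.factorial : ℝ)) *
          ∑ σ : Equiv.Perm (Fin n), pconj G c ((1 / (b : ℝ)) • ∑ j, z (σ (r j))) := by
        rw [Finset.sum_comm]
        refine Finset.sum_congr rfl fun τ _ => ?_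
        rw [← Finset.mul_sum]
        congr 1
        refine Fintype.sum_equiv (Equiv.mulRight (Equiv.Perm.ofSubtype τ)) _ _ fun σ => ?_
        simp only [Equiv.coe_mulRight, Equiv.Perm.coe_mul, Function.comp_apply]
        congr 3
        ext j
        congr 2
        rw [Equiv.Perm.ofSubtype_apply_of_mem τ (hr j)]
    _ = _ := by
        rw [Finset.sum_const, card_univ, hcardP, nsmul_eq_mul, ← mul_assoc,
          ← ENNReal.ofReal_natCast, ← ENNReal.ofReal_mul (by positivity)]
        rw [mul_one_div_cancel hf, ENNReal.ofReal_one, one_mul]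

/-- Hoeffding's comparison of sampling without and with replacement. -/
lemma sum_powersetCard_pconj_mean_le (G : E → ℝ) (c : ℝ) {n b : ℕ} (hb : 0 < b) (hbn : b ≤ n)
    (z : Fin n → E) :
    ((n.choose b : ℕ) : ℝ≥0∞)⁻¹ *
        ∑ s ∈ powersetCard b univ, pconj G c ((1 / (b : ℝ)) • ∑ i ∈ s, z i)
      ≤ ((n : ℝ≥0∞)⁻¹) ^ b * ∑ r : Fin b → Fin n, pconj G c ((1 / (b : ℝ)) • ∑ j, z (r j)) := by
  set M := ∑ s ∈ powersetCard b (univ : Finset (Fin n)), pconj G c ((1 / (b : ℝ)) • ∑ i ∈ s, z i)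
    with hM
  set N := ∑ r : Fin b → Fin n, pconj G c ((1 / (b : ℝ)) • ∑ j, z (r j)) with hN
  have h1 : ∀ r : Fin b → Fin n, (n.factorial : ℝ≥0∞) * M ≤ (n.choose b : ℝ≥0∞) *
      ∑ σ : Equiv.Perm (Fin n), pconj G c ((1 / (b : ℝ)) • ∑ j, z (σ (r j))) := by
    intro r
    -- A sample with repetitions has fewer than `b` distinct values; its range is filled up to a set
    -- of size exactly `b`.
    obtain ⟨S, hrS, -, hS⟩ := exists_subsuperset_card_eq (n := b)
      (subset_univ (univ.image r)) (card_image_le.trans (by simp)) (by simpa)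
    have h2 := choose_smul_sum_perm_map
      (fun s => pconj G c ((1 / (b : ℝ)) • ∑ i ∈ s, z i)) S
    simp only [hS, nsmul_eq_mul, Finset.sum_map, Equiv.coe_toEmbedding] at h2
    rw [← h2]
    refine mul_le_mul_right ?_ _
    exact sum_perm_pconj_mean_le G c hb z S hS r fun j => hrS (mem_image_of_mem r (mem_univ j))
  have h3 : (n : ℝ≥0∞) ^ b * ((n.factorial : ℝ≥0∞) * M)
      ≤ (n.choose b : ℝ≥0∞) * ((n.factorial : ℝ≥0∞) * N) := by
    calc (n : ℝ≥0∞) ^ b * ((n.factorial : ℝ≥0∞) * M)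
        = ∑ _r : Fin b → Fin n, (n.factorial : ℝ≥0∞) * M := by
          rw [Finset.sum_const, card_univ, nsmul_eq_mul]; simp
      _ ≤ ∑ r : Fin b → Fin n, (n.choose b : ℝ≥0∞) *
            ∑ σ : Equiv.Perm (Fin n), pconj G c ((1 / (b : ℝ)) • ∑ j, z (σ (r j))) :=
          Finset.sum_le_sum fun r _ => h1 r
      _ = (n.choose b : ℝ≥0∞) * ∑ _σ : Equiv.Perm (Fin n), N := by
          rw [← Finset.mul_sum, Finset.sum_comm]
          congr 1
          refine Finset.sum_congr rfl fun σ _ => ?_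
          exact Fintype.sum_equiv (Equiv.arrowCongr (Equiv.refl _) σ) _ _ fun r => by simp
      _ = _ := by
          rw [Finset.sum_const, card_univ, Fintype.card_perm, Fintype.card_fin, nsmul_eq_mul]
  have hf0 : (n.factorial : ℝ≥0∞) ≠ 0 := by exact_mod_cast n.factorial_ne_zero
  have hc0 : (n.choose b : ℝ≥0∞) ≠ 0 := by exact_mod_cast (Nat.choose_pos hbn).ne'
  have hn0 : (n : ℝ≥0∞) ^ b ≠ 0 := pow_ne_zero _ (by exact_mod_cast (hb.trans_le hbn).ne')
  have hnt : (n : ℝ≥0∞) ^ b ≠ ⊤ := ENNReal.pow_ne_top (ENNReal.natCast_ne_top n)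
  rw [mul_left_comm, mul_left_comm (n.choose b : ℝ≥0∞),
    ENNReal.mul_le_mul_iff_right hf0 (ENNReal.natCast_ne_top _)] at h3
  rw [ENNReal.inv_pow.symm, mul_comm, ← div_eq_mul_inv, mul_comm, ← div_eq_mul_inv,
    ENNReal.div_le_iff hc0 (ENNReal.natCast_ne_top _), ENNReal.mul_comm_div,
    ← ENNReal.mul_comm_div, mul_comm, ← mul_div_assoc, ENNReal.le_div_iff_mul_le (Or.inl hn0) (Or.inl hnt)]
  rw [mul_comm]
  exact h3

variable [CompleteSpace E] [MeasurableSpace E]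

/-- The generalized Nemirovsky inequality for sampling with replacement. -/
lemma IsCHEF.sum_pconj_mean_le [BorelSpace E] {G : E → ℝ} {g : ℝ≥0 → ℝ≥0} {C : ℝ}
    (hG : IsCHEF G g C) {c : ℝ} (hc : 0 < c) {n b : ℕ} (hn : 0 < n) (hb : 0 < b) (z : Fin n → E)
    (hz : ∑ i, z i = 0) :
    ((n : ℝ≥0∞)⁻¹) ^ b * ∑ r : Fin b → Fin n, pconj G c ((1 / (b : ℝ)) • ∑ j, z (r j))
      ≤ ENNReal.ofReal C * (ENNReal.ofReal (1 / n) * ∑ i, pconj G (c * b) (z i)) := by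
  have : NeZero n := ⟨hn.ne'⟩
  have hb' : (0 : ℝ) < b := by exact_mod_cast hb
  let μ₀ : Measure (Fin n) := (PMF.uniformOfFintype (Fin n)).toMeasure
  let Q : Measure (Fin b → Fin n) := Measure.pi fun _ => μ₀
  have hμ₀ : ∀ i, μ₀ {i} = (n : ℝ≥0∞)⁻¹ := fun i => by
    simp [μ₀]
  have hQ : ∀ r, Q {r} = ((n : ℝ≥0∞)⁻¹) ^ b := fun r => by
    simp [Q, Measure.pi_singleton, hμ₀]
  let u : Fin n → E := fun i => (1 / (c * b)) • z i
  -- (C3) is stated for weight one, so the vectors are scaled by `1/(c b)`; undoing the scaling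
  -- gives weight `c` for the mean and `c b` for the single terms. The prefactors `c`, `b` and `1/(c
  -- b)` cancel.
  have hnem := hG.nemirovsky (Fin b → Fin n) Q b (fun j r => u (r j))
    (fun _ => Integrable.of_finite)
    (fun j => by
      have h1 : ∫ r, u (r j) ∂Q = ∫ i, u i ∂μ₀ := by
        have := (measurePreserving_eval (fun _ : Fin b => μ₀) j).map_eq
        rw [← this, integral_map (measurable_pi_apply j).aemeasurable
          Integrable.of_finite.aestronglyMeasurable]
      rw [h1, integral_fintype Integrable.of_finite]
      simp only [Measure.real, hμ₀, u, ← Finset.smul_sum, hz, smul_zero])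
    (iIndepFun_pi (X := fun _ => u) fun _ => (measurable_of_finite u).aemeasurable)
  simp only [← pconj_one_eq] at hnem
  rw [lintegral_fintype] at hnem
  have h2 : ∀ j, ∫⁻ r, pconj G 1 (u (r j)) ∂Q = ∑ i, pconj G 1 (u i) * (n : ℝ≥0∞)⁻¹ := by
    intro j
    rw [(measurePreserving_eval (fun _ : Fin b => μ₀) j).lintegral_comp
      (f := fun i => pconj G 1 (u i)) (measurable_of_finite _), lintegral_fintype]
    simp only [hμ₀]
  simp only [h2, hQ, Finset.sum_const, card_univ, Fintype.card_fin, nsmul_eq_mul] at hnem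
  have h3 : ∀ i, pconj G 1 (u i) ≤ ENNReal.ofReal (1 / (c * b)) * pconj G (c * b) (z i) := by
    intro i
    have := pconj_smul_le G (t := 1 / (c * b)) (by positivity) (c * b) (z i)
    rwa [one_div_mul_cancel (by positivity)] at this
  have h4 : ∀ r : Fin b → Fin n, pconj G c ((1 / (b : ℝ)) • ∑ j, z (r j))
      ≤ ENNReal.ofReal c * pconj G 1 (∑ j, u (r j)) := by
    intro r
    have := pconj_smul_le G hc 1 (∑ j, u (r j))
    rw [mul_one, ← Finset.smul_sum, smul_smul] at this
    have e : ∑ j, u (r j) = (1 / (c * (b : ℝ))) • ∑ j, z (r j) := by rw [Finset.smul_sum]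
    rw [e]
    convert this using 3
    field_simp
  calc ((n : ℝ≥0∞)⁻¹) ^ b * ∑ r : Fin b → Fin n, pconj G c ((1 / (b : ℝ)) • ∑ j, z (r j))
      ≤ ((n : ℝ≥0∞)⁻¹) ^ b * ∑ r : Fin b → Fin n, ENNReal.ofReal c * pconj G 1 (∑ j, u (r j)) := by
        gcongr with r; exact h4 r
    _ = ENNReal.ofReal c * ∑ r : Fin b → Fin n, pconj G 1 (∑ j, u (r j)) * ((n : ℝ≥0∞)⁻¹) ^ b := by
        rw [← Finset.mul_sum, ← Finset.sum_mul]; ring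
    _ ≤ ENNReal.ofReal c * (ENNReal.ofReal C * (b * ∑ i, pconj G 1 (u i) * (n : ℝ≥0∞)⁻¹)) := by
        gcongr
    _ ≤ ENNReal.ofReal c * (ENNReal.ofReal C * (b * ∑ i,
          (ENNReal.ofReal (1 / (c * b)) * pconj G (c * b) (z i)) * (n : ℝ≥0∞)⁻¹)) := by
        gcongr with i; exact h3 i
    _ = (ENNReal.ofReal c * b * ENNReal.ofReal (1 / (c * b))) * (ENNReal.ofReal C *
          ((n : ℝ≥0∞)⁻¹ * ∑ i, pconj G (c * b) (z i))) := by
        rw [← Finset.sum_mul, ← Finset.mul_sum]; ring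
    _ = _ := by
        rw [← ENNReal.ofReal_natCast b, ← ENNReal.ofReal_mul hc.le,
          ← ENNReal.ofReal_mul (by positivity), mul_one_div_cancel (by positivity),
          ENNReal.ofReal_one, one_mul, one_div, ENNReal.ofReal_inv_of_pos (by exact_mod_cast hn),
          ENNReal.ofReal_natCast]

/-- The variance bound for the mean of a uniformly random subset. -/
lemma IsCHEF.sum_powersetCard_pconj_le [BorelSpace E] {G : E → ℝ} {g : ℝ≥0 → ℝ≥0} {C : ℝ}
    (hG : IsCHEF G g C) {c : ℝ} (hc : 0 < c) {n b : ℕ} (hb : 0 < b) (hbn : b ≤ n)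
    (z : Fin n → E) (hz : ∑ i, z i = 0) {l : ℝ≥0} (hl : 0 < l) {d : ℝ} (hd : d ≤ c * b * g l) :
    ((n.choose b : ℕ) : ℝ≥0∞)⁻¹ *
        ∑ s ∈ powersetCard b univ, pconj G c ((1 / (b : ℝ)) • ∑ i ∈ s, z i)
      ≤ ENNReal.ofReal (C * l) * (ENNReal.ofReal (1 / n) * ∑ i, pconj G d (z i)) := by
  refine (sum_powersetCard_pconj_mean_le G c hb hbn z).trans
    ((hG.sum_pconj_mean_le hc (hb.trans_le hbn) hb z hz).trans ?_)
  rw [ENNReal.ofReal_mul hG.C_pos.le, mul_assoc, mul_left_comm (ENNReal.ofReal (l : ℝ)),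
    Finset.mul_sum (a := ENNReal.ofReal (l : ℝ))]
  gcongr with i
  calc pconj G (c * b) (z i)
      ≤ ENNReal.ofReal l * pconj G (c * b * g l) (z i) :=
        pconj_le_of_sup_hom (by positivity) (by exact_mod_cast hl)
          (fun v => hG.sup_hom v l hl) (z i)
    _ ≤ _ := by gcongr; exact pconj_anti hG.nonneg hd (z i)

end Sampling

end SCSG

namespace SCSG

/-! ### Measurability of gaps, gradients and Bregman distances along the iterates. -/

section Measurability

variable {Ω : Type*} {E : Type*} [NormedAddCommGroup E]

lemma stronglyMeasurable_subtype_mk {m : MeasurableSpace Ω} {X : Set E} {u : Ω → E}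
    (hu : StronglyMeasurable[m] u) (hX : ∀ ω, u ω ∈ X) :
    StronglyMeasurable[m] (fun ω => (⟨u ω, hX ω⟩ : X)) :=
  (Embedding.comp_stronglyMeasurable_iff (g := ((↑) : X → E))
    Topology.IsEmbedding.subtypeVal).1 hu

lemma stronglyMeasurable_comp_of_continuousOn {F : Type*} [TopologicalSpace F]
    {m : MeasurableSpace Ω} {X : Set E} {φ : E → F} (hφ : ContinuousOn φ X) {u : Ω → E}
    (hu : StronglyMeasurable[m] u) (hX : ∀ ω, u ω ∈ X) :
    StronglyMeasurable[m] (fun ω => φ (u ω)) :=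
  (continuousOn_iff_continuous_domRestrict.1 hφ).comp_stronglyMeasurable
    (stronglyMeasurable_subtype_mk hu hX)

variable [InnerProductSpace ℝ E]

lemma lowerSemicontinuous_pconj (G : E → ℝ) (c : ℝ) : LowerSemicontinuous (pconj G c) := by
  refine lowerSemicontinuous_iSup fun v => Continuous.lowerSemicontinuous ?_
  exact ENNReal.continuous_ofReal.comp (by fun_prop)

lemma measurable_pconj [MeasurableSpace E] [BorelSpace E] (G : E → ℝ) (c : ℝ) :
    Measurable (pconj G c) :=
  (lowerSemicontinuous_pconj G c).measurable

/-- The gradient of `w` need not be measurable on `X`, being influenced by values of `w` off `X`.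
The pairing with `u - v` is however a directional derivative along a segment inside `X`, hence a
limit of measurable difference quotients. -/
lemma measurable_bregman_comp [CompleteSpace E] {m : MeasurableSpace Ω} {X : Set E}
    (hX : Convex ℝ X) {w : E → ℝ} (hw : ∀ x ∈ X, DifferentiableAt ℝ w x) {u v : Ω → E}
    (hu : StronglyMeasurable[m] u) (hv : StronglyMeasurable[m] v) (huX : ∀ ω, u ω ∈ X)
    (hvX : ∀ ω, v ω ∈ X) :
    Measurable[m] (fun ω => bregman w (u ω) (v ω)) := by
  have hwc : ContinuousOn w X := fun x hx => (hw x hx).continuousAt.continuousWithinAt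
  let t : ℕ → ℝ := fun k => 1 / ((k : ℝ) + 1)
  have ht0 : ∀ k, 0 < t k := fun k => by positivity
  have ht1 : ∀ k, t k ≤ 1 := fun k => by
    simp only [t]; rw [div_le_one (by positivity)]; linarith [(Nat.cast_nonneg k : (0 : ℝ) ≤ k)]
  have hmem : ∀ k ω, v ω + t k • (u ω - v ω) ∈ X := fun k ω => by
    have : v ω + t k • (u ω - v ω) = (1 - t k) • v ω + t k • u ω := by module
    rw [this]
    exact hX (hvX ω) (huX ω) (by linarith [ht1 k]) (ht0 k).le (by ring)
  have hsm : ∀ k, StronglyMeasurable[m]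
      (fun ω => (t k)⁻¹ • (w (v ω + t k • (u ω - v ω)) - w (v ω))) := fun k => by
    exact
    ((stronglyMeasurable_comp_of_continuousOn hwc (hv.add ((hu.sub hv).const_smul (t k)))
      (hmem k)).sub (stronglyMeasurable_comp_of_continuousOn hwc hv hvX)).const_smul (t k)⁻¹
  have hlim : ∀ ω, Tendsto (fun k => (t k)⁻¹ • (w (v ω + t k • (u ω - v ω)) - w (v ω))) atTop
      (𝓝 (inner ℝ (gradient w (v ω)) (u ω - v ω))) := by
    intro ω
    have hd : HasDerivAt (fun s : ℝ => w (v ω + s • (u ω - v ω)))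
        (inner ℝ (gradient w (v ω)) (u ω - v ω)) 0 := by
      have h1 : HasDerivAt (fun s : ℝ => v ω + s • (u ω - v ω)) (u ω - v ω) 0 := by
        simpa using ((hasDerivAt_id (0 : ℝ)).smul_const (u ω - v ω)).const_add (v ω)
      have h2 : HasFDerivAt w (InnerProductSpace.toDual ℝ E (gradient w (v ω)))
          (v ω + (0 : ℝ) • (u ω - v ω)) := by
        simpa using (hw _ (hvX ω)).hasGradientAt.hasFDerivAt
      exact h2.comp_hasDerivAt (0 : ℝ) h1
    have ht : Tendsto t atTop (𝓝[>] 0) :=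
      tendsto_nhdsWithin_iff.2 ⟨tendsto_one_div_add_atTop_nhds_zero_nat,
        Eventually.of_forall ht0⟩
    simpa [Function.comp_def] using hd.tendsto_slope_zero_right.comp ht
  have hin : StronglyMeasurable[m] (fun ω => inner ℝ (gradient w (v ω)) (u ω - v ω)) :=
    stronglyMeasurable_of_tendsto atTop hsm (tendsto_pi_nhds.2 hlim)
  exact (((stronglyMeasurable_comp_of_continuousOn hwc hu huX).sub
    (stronglyMeasurable_comp_of_continuousOn hwc hv hvX)).sub hin).measurable

namespace IsProblem

variable [CompleteSpace E] {n : ℕ} {X : Set E} {f : Fin n → E → ℝ} {ψ w : E → ℝ} {xs : E}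
  {G : E → ℝ} {L : ℝ}

lemma stronglyMeasurable_batchGrad (h : IsProblem X f ψ w xs G L) {m : MeasurableSpace Ω}
    (s : Finset (Fin n)) {u : Ω → E} (hu : StronglyMeasurable[m] u) (huX : ∀ ω, u ω ∈ X) :
    StronglyMeasurable[m] (fun ω => batchGrad f s (u ω)) :=
  stronglyMeasurable_comp_of_continuousOn
    (continuousOn_const.smul (continuousOn_finsetSum s fun i _ => h.continuousOn_gradient i))
    hu huX

lemma measurable_objective_comp (h : IsProblem X f ψ w xs G L) [MeasurableSpace E] [BorelSpace E]
    (hψ : Measurable (fun x : X => ψ x)) {m : MeasurableSpace Ω} {u : Ω → E}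
    (hu : StronglyMeasurable[m] u) (huX : ∀ ω, u ω ∈ X) :
    Measurable[m] (fun ω => objective f ψ (u ω)) := by
  have h1 : ContinuousOn (avgLoss f) X := fun x hx =>
    (h.hasGradientAt_avgLoss hx).continuousAt.continuousWithinAt
  exact (stronglyMeasurable_comp_of_continuousOn h1 hu huX).measurable.add
    (hψ.comp (stronglyMeasurable_subtype_mk hu huX).measurable)

end IsProblem

end Measurability

/-! ### Independent discrete randomness and mean-zero terms, in `[0, ∞]`. -/

section Independence

variable {Ω : Type*} {mΩ : MeasurableSpace Ω} {P : Measure Ω} {ι : Type*}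

/-- Integration of a quantity which depends on a discrete random variable that is independent of
everything else. -/
lemma lintegral_indep_discrete [Countable ι] {m : MeasurableSpace Ω} (hm : m ≤ mΩ) {S : Ω → ι}
    (hS : MeasurableSpace.comap S ⊤ ≤ mΩ) (hind : Indep (MeasurableSpace.comap S ⊤) m P)
    {H : ι → Ω → ℝ≥0∞} (hH : ∀ i, Measurable[m] (H i)) :
    ∫⁻ ω, H (S ω) ω ∂P = ∑' i, P {ω | S ω = i} * ∫⁻ ω, H i ω ∂P := by
  have hSi' : ∀ i, MeasurableSet[MeasurableSpace.comap S ⊤] {ω | S ω = i} := fun i =>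
    ⟨{i}, trivial, rfl⟩
  have hSi : ∀ i, MeasurableSet[mΩ] {ω | S ω = i} := fun i => hS _ (hSi' i)
  have h1 : ∀ ω, H (S ω) ω = ∑' i, H i ω * {ω | S ω = i}.indicator (fun _ => 1) ω := by
    intro ω
    rw [tsum_eq_single (S ω)]
    · simp
    · intro i hi; simp [Ne.symm hi]
  calc ∫⁻ ω, H (S ω) ω ∂P
      = ∫⁻ ω, ∑' i, H i ω * {ω | S ω = i}.indicator (fun _ => 1) ω ∂P := by simp only [← h1]
    _ = ∑' i, ∫⁻ ω, H i ω * {ω | S ω = i}.indicator (fun _ => 1) ω ∂P :=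
        lintegral_tsum fun i =>
          (((hH i).mono hm le_rfl).mul (measurable_const.indicator (hSi i))).aemeasurable
    _ = ∑' i, P {ω | S ω = i} * ∫⁻ ω, H i ω ∂P := by
        refine tsum_congr fun i => ?_
        rw [lintegral_mul_indicator_eq_lintegral_mul_lintegral_indicator hm 1 (hSi i) ?_ (hH i),
          lintegral_indicator_const (hSi i), one_mul, mul_comm]
        rw [IndepSets_iff]
        rintro A B hA rfl
        rw [Set.inter_comm, mul_comm]
        exact (Indep_iff _ _ _).1 hind _ _ (hSi' i) hA

lemma measurable_discrete [Countable ι] {S : Ω → ι}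
    (hS : MeasurableSpace.comap S ⊤ ≤ mΩ) {β : Type*} [MeasurableSpace β] {H : ι → Ω → β}
    (hH : ∀ i, Measurable (H i)) :
    Measurable (fun ω => H (S ω) ω) := by
  intro A hA
  have : (fun ω => H (S ω) ω) ⁻¹' A = ⋃ i, {ω | S ω = i} ∩ H i ⁻¹' A := by
    ext ω; simp
  rw [this]
  exact MeasurableSet.iUnion fun i => (hS _ ⟨{i}, trivial, rfl⟩).inter (hH i hA)

/-- A quantity that averages to zero over an independent discrete random variable has mean zero. -/
lemma lintegral_ofReal_eq_of_discrete_mean_zero [Fintype ι] [IsProbabilityMeasure P]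
    {m : MeasurableSpace Ω} (hm : m ≤ mΩ) {S : Ω → ι}
    (hS : MeasurableSpace.comap S ⊤ ≤ mΩ) (hind : Indep (MeasurableSpace.comap S ⊤) m P)
    {H : ι → Ω → ℝ} (hH : ∀ i, Measurable[m] (H i))
    (hint : ∀ i, P {ω | S ω = i} ≠ 0 → Integrable (H i) P)
    (hzero : ∀ ω, ∑ i, (P {ω | S ω = i}).toReal * H i ω = 0) :
    ∫⁻ ω, ENNReal.ofReal (H (S ω) ω) ∂P = ∫⁻ ω, ENNReal.ofReal (-H (S ω) ω) ∂P ∧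
      ∫⁻ ω, ENNReal.ofReal (H (S ω) ω) ∂P ≠ ⊤ := by
  have h1 := lintegral_indep_discrete hm hS hind (H := fun i ω => ENNReal.ofReal (H i ω))
    (fun i => (hH i).ennreal_ofReal)
  have h2 := lintegral_indep_discrete hm hS hind (H := fun i ω => ENNReal.ofReal (-H i ω))
    (fun i => (hH i).neg.ennreal_ofReal)
  rw [tsum_fintype] at h1 h2
  have f1 : ∀ i, P {ω | S ω = i} * ∫⁻ ω, ENNReal.ofReal (H i ω) ∂P ≠ ⊤ := fun i => by
    by_cases hi : P {ω | S ω = i} = 0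
    · simp [hi]
    · exact ENNReal.mul_ne_top (measure_ne_top _ _) (hint i hi).lintegral_lt_top.ne
  have f2 : ∀ i, P {ω | S ω = i} * ∫⁻ ω, ENNReal.ofReal (-H i ω) ∂P ≠ ⊤ := fun i => by
    by_cases hi : P {ω | S ω = i} = 0
    · simp [hi]
    · exact ENNReal.mul_ne_top (measure_ne_top _ _) (hint i hi).neg.lintegral_lt_top.ne
  have s1 : ∑ i, P {ω | S ω = i} * ∫⁻ ω, ENNReal.ofReal (H i ω) ∂P ≠ ⊤ :=
    ENNReal.sum_ne_top.2 fun i _ => f1 i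
  have s2 : ∑ i, P {ω | S ω = i} * ∫⁻ ω, ENNReal.ofReal (-H i ω) ∂P ≠ ⊤ :=
    ENNReal.sum_ne_top.2 fun i _ => f2 i
  -- Both parts are finite sums of finite terms, so their equality may be tested after `toReal`,
  -- where it becomes the vanishing of one real integral.
  refine ⟨?_, by rw [h1]; exact s1⟩
  rw [h1, h2, ← ENNReal.toReal_eq_toReal_iff' s1 s2, ENNReal.toReal_sum fun i _ => f1 i,
    ENNReal.toReal_sum fun i _ => f2 i, ← sub_eq_zero, ← Finset.sum_sub_distrib]
  have hint' : ∀ i, Integrable (fun ω => (P {ω | S ω = i}).toReal * H i ω) P := fun i => by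
    by_cases hi : P {ω | S ω = i} = 0
    · simp [hi]
    · exact (hint i hi).const_mul _
  calc ∑ i, ((P {ω | S ω = i} * ∫⁻ ω, ENNReal.ofReal (H i ω) ∂P).toReal
        - (P {ω | S ω = i} * ∫⁻ ω, ENNReal.ofReal (-H i ω) ∂P).toReal)
      = ∑ i, ∫ ω, (P {ω | S ω = i}).toReal * H i ω ∂P := by
        refine Finset.sum_congr rfl fun i _ => ?_
        rw [integral_const_mul]
        by_cases hi : P {ω | S ω = i} = 0
        · simp [hi]
        · rw [integral_eq_lintegral_pos_part_sub_lintegral_neg_part (hint i hi),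
            ENNReal.toReal_mul, ENNReal.toReal_mul]
          ring
    _ = ∫ ω, ∑ i, (P {ω | S ω = i}).toReal * H i ω ∂P :=
        (integral_finsetSum _ fun i _ => hint' i).symm
    _ = 0 := by simp [hzero]

/-- An inequality between nonnegative functions up to a function of mean zero passes to the
integrals. -/
lemma lintegral_le_of_le_add_mean_zero {U V : Ω → ℝ≥0∞} {Z : Ω → ℝ} (hZ : Measurable Z)
    (hZ0 : ∫⁻ ω, ENNReal.ofReal (Z ω) ∂P = ∫⁻ ω, ENNReal.ofReal (-Z ω) ∂P)
    (hfin : ∫⁻ ω, ENNReal.ofReal (Z ω) ∂P ≠ ⊤)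
    (h : ∀ ω, U ω + ENNReal.ofReal (-Z ω) ≤ V ω + ENNReal.ofReal (Z ω)) :
    ∫⁻ ω, U ω ∂P ≤ ∫⁻ ω, V ω ∂P := by
  have h1 := lintegral_mono (μ := P) h
  rw [lintegral_add_right _ (show Measurable fun ω => ENNReal.ofReal (-Z ω) from hZ.neg.ennreal_ofReal), lintegral_add_right _ hZ.ennreal_ofReal,
    ← hZ0] at h1
  exact (ENNReal.add_le_add_iff_right hfin).1 h1

/-- For `k > n` every subset would have probability zero. -/
lemma IsUniformSubset.card_le [IsProbabilityMeasure P] {n : ℕ} {S : Ω → Finset (Fin n)} {k : ℕ}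
    (h : IsUniformSubset P S k) : k ≤ n := by
  by_contra hk
  have h0 : P Set.univ ≤ ∑ s : Finset (Fin n), P {ω | S ω = s} := by
    rw [← tsum_fintype (L := .unconditional _)]
    refine (measure_mono fun ω _ => Set.mem_iUnion.2 ⟨S ω, rfl⟩).trans (measure_iUnion_le _)
  rw [measure_univ, Finset.sum_eq_zero] at h0
  · simp at h0
  · intro s _
    rw [h s, if_neg]
    have := s.card_le_univ
    simp only [Fintype.card_fin] at this
    omega

lemma IsUniformSubset.sum_mul {n : ℕ} {S : Ω → Finset (Fin n)} {k : ℕ}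
    (h : IsUniformSubset P S k) (H : Finset (Fin n) → ℝ≥0∞) :
    ∑ s, P {ω | S ω = s} * H s
      = ((n.choose k : ℕ) : ℝ≥0∞)⁻¹ * ∑ s ∈ Finset.powersetCard k Finset.univ, H s := by
  simp only [h _]
  rw [Finset.mul_sum, Finset.powersetCard_eq_filter, Finset.powerset_univ, Finset.sum_filter]
  exact Finset.sum_congr rfl fun s _ => by split_ifs <;> simp

lemma IsUniformSubset.sum_toReal_smul {n : ℕ} {V : Type*} [AddCommGroup V] [Module ℝ V]
    {S : Ω → Finset (Fin n)} {k : ℕ} (h : IsUniformSubset P S k) (H : Finset (Fin n) → V) :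
    ∑ s, (P {ω | S ω = s}).toReal • H s
      = ((n.choose k : ℕ) : ℝ)⁻¹ • ∑ s ∈ Finset.powersetCard k Finset.univ, H s := by
  simp only [h _]
  rw [Finset.smul_sum, Finset.powersetCard_eq_filter, Finset.powerset_univ, Finset.sum_filter]
  exact Finset.sum_congr rfl fun s _ => by split_ifs <;> simp

end Independence

end SCSG

namespace SCSG

/-! ### Variance of the stochastic gradients and the pathwise inner step. -/

section Deviations

variable {E : Type*} [NormedAddCommGroup E] [InnerProductSpace ℝ E]

lemma enorm_inner_le_pconj {G : E → ℝ} (hG : ∀ v, 0 ≤ G v) (hs : ∀ v, G (-v) = G v) {c : ℝ}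
    (hc : 0 ≤ c) (z v : E) :
    ‖(inner ℝ z v : ℝ)‖ₑ ≤ pconj G c z + ENNReal.ofReal (c * G v) := by
  by_cases h : pconj G c z = ⊤
  · simp [h]
  have h1 := inner_le_pconj h v
  have h2 := inner_le_pconj h (-v)
  rw [inner_neg_right, hs] at h2
  rw [Real.enorm_eq_ofReal_abs, ← ENNReal.ofReal_toReal h,
    ← ENNReal.ofReal_add ENNReal.toReal_nonneg (mul_nonneg hc (hG v))]
  exact ENNReal.ofReal_le_ofReal (abs_le.2 ⟨by linarith, h1⟩)

variable [CompleteSpace E]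

/-- The optimality gap. -/
noncomputable def gap {n : ℕ} (f : Fin n → E → ℝ) (ψ : E → ℝ) (xs x : E) : ℝ :=
  objective f ψ x - objective f ψ xs

/-- The deviation of the variance-reduced mini-batch gradient. -/
noncomputable def miniDev {n : ℕ} (f : Fin n → E → ℝ) (s : Finset (Fin n)) (x x₀ : E) : E :=
  (batchGrad f s x - batchGrad f s x₀)
    - (batchGrad f Finset.univ x - batchGrad f Finset.univ x₀)

/-- The deviation of the batch gradient. -/
noncomputable def batchDev {n : ℕ} (f : Fin n → E → ℝ) (s : Finset (Fin n)) (x₀ : E) : E :=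
  batchGrad f s x₀ - batchGrad f Finset.univ x₀

namespace IsProblem

variable {n : ℕ} {X : Set E} {f : Fin n → E → ℝ} {ψ w : E → ℝ} {xs : E} {G : E → ℝ} {L : ℝ}

lemma gap_nonneg (h : IsProblem X f ψ w xs G L) {x : E} (hx : x ∈ X) : 0 ≤ gap f ψ xs x :=
  h.objective_sub_nonneg hx

lemma sum_pconj_le (h : IsProblem X f ψ w xs G L) {x : E} (hx : x ∈ X) :
    ∑ i, pconj G L (gradient (f i) x - gradient (f i) xs)
      ≤ n * ENNReal.ofReal (gap f ψ xs x) := by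
  have hn : (n : ℝ≥0∞) ≠ 0 := by exact_mod_cast h.n_pos.ne'
  have h1 := h.sum_pconj_gradient_sub_le hx
  rw [one_div, ENNReal.ofReal_inv_of_pos (by exact_mod_cast h.n_pos), ENNReal.ofReal_natCast] at h1
  calc ∑ i, pconj G L (gradient (f i) x - gradient (f i) xs)
      = n * ((n : ℝ≥0∞)⁻¹ * ∑ i, pconj G L (gradient (f i) x - gradient (f i) xs)) := by
        rw [← mul_assoc, ENNReal.mul_inv_cancel hn (ENNReal.natCast_ne_top n), one_mul]
    _ ≤ _ := by gcongr; exact h1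

lemma pconj_batchGrad_sub_le (h : IsProblem X f ψ w xs G L) (s : Finset (Fin n)) {x : E}
    (hx : x ∈ X) :
    pconj G L (batchGrad f s x - batchGrad f s xs) ≤ n * ENNReal.ofReal (gap f ψ xs x) := by
  rcases s.eq_empty_or_nonempty with rfl | hs
  · simp [batchGrad, pconj_zero h.G_nonneg h.L_pos.le]
  have e : batchGrad f s x - batchGrad f s xs
      = (1 / (s.card : ℝ)) • ∑ i ∈ s, (gradient (f i) x - gradient (f i) xs) := by
    simp only [batchGrad, Finset.sum_sub_distrib, smul_sub]
  have hc : 1 / (s.card : ℝ) ≤ 1 := by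
    rw [div_le_one (by exact_mod_cast hs.card_pos)]; exact_mod_cast hs.card_pos
  calc pconj G L (batchGrad f s x - batchGrad f s xs)
      ≤ ENNReal.ofReal (1 / s.card)
          * ∑ i ∈ s, pconj G L (gradient (f i) x - gradient (f i) xs) := by
        rw [e]; exact pconj_avg_le G L hs _
    _ ≤ 1 * ∑ i, pconj G L (gradient (f i) x - gradient (f i) xs) := by
        gcongr
        · exact ENNReal.ofReal_le_one.2 hc
        · exact s.subset_univ
    _ ≤ _ := by rw [one_mul]; exact h.sum_pconj_le hx

lemma pconj_batchGrad_univ_sub_le (h : IsProblem X f ψ w xs G L) {x : E} (hx : x ∈ X) :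
    pconj G L (batchGrad f Finset.univ x - batchGrad f Finset.univ xs)
      ≤ ENNReal.ofReal (gap f ψ xs x) := by
  have : NeZero n := ⟨h.n_pos.ne'⟩
  have e : batchGrad f Finset.univ x - batchGrad f Finset.univ xs
      = (1 / ((Finset.univ : Finset (Fin n)).card : ℝ)) •
        ∑ i, (gradient (f i) x - gradient (f i) xs) := by
    simp only [batchGrad, Finset.sum_sub_distrib, smul_sub]
  rw [e]
  refine (pconj_avg_le G L Finset.univ_nonempty _).trans ?_
  rw [Finset.card_univ, Fintype.card_fin]
  exact h.sum_pconj_gradient_sub_le hx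

lemma ofReal_avg_const (h : IsProblem X f ψ w xs G L) (a : ℝ≥0∞) :
    ENNReal.ofReal (1 / n) * ∑ _i : Fin n, a = a := by
  have hn : (n : ℝ≥0∞) ≠ 0 := by exact_mod_cast h.n_pos.ne'
  rw [Finset.sum_const, Finset.card_univ, Fintype.card_fin, nsmul_eq_mul, one_div,
    ENNReal.ofReal_inv_of_pos (by exact_mod_cast h.n_pos), ENNReal.ofReal_natCast, ← mul_assoc,
    ENNReal.inv_mul_cancel hn (ENNReal.natCast_ne_top n), one_mul]

lemma sum_gradient_sub_batchGrad (h : IsProblem X f ψ w xs G L) (x : E) :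
    ∑ i, (gradient (f i) x - batchGrad f Finset.univ x) = 0 := by
  have hn : (n : ℝ) ≠ 0 := by exact_mod_cast h.n_pos.ne'
  rw [Finset.sum_sub_distrib, Finset.sum_const, Finset.card_univ, Fintype.card_fin, batchGrad,
    Finset.card_univ, Fintype.card_fin, ← Nat.cast_smul_eq_nsmul ℝ, smul_smul,
    mul_one_div_cancel hn, one_smul, sub_self]

lemma batchGrad_sub_const {s : Finset (Fin n)} (hs : s.card ≠ 0) (x c : E) :
    batchGrad f s x - c = (1 / (s.card : ℝ)) • ∑ i ∈ s, (gradient (f i) x - c) := by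
  have hs' : (s.card : ℝ) ≠ 0 := by exact_mod_cast hs
  rw [Finset.sum_sub_distrib, Finset.sum_const, ← Nat.cast_smul_eq_nsmul ℝ, smul_sub, smul_smul,
    one_div_mul_cancel hs', one_smul, batchGrad]

/-- A crude bound for each fixed `s`. The factor `n + 1` is harmless because only finiteness of the
expectation is used. -/
lemma pconj_miniDev_le (h : IsProblem X f ψ w xs G L) (s : Finset (Fin n)) {x x₀ : E}
    (hx : x ∈ X) (hx₀ : x₀ ∈ X) :
    pconj G (4 * L) (miniDev f s x x₀)
      ≤ (n + 1) * (ENNReal.ofReal (gap f ψ xs x) + ENNReal.ofReal (gap f ψ xs x₀)) := by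
  have e : miniDev f s x x₀ = ((batchGrad f s x - batchGrad f s xs)
      + -(batchGrad f s x₀ - batchGrad f s xs))
      + (-(batchGrad f Finset.univ x - batchGrad f Finset.univ xs)
      + (batchGrad f Finset.univ x₀ - batchGrad f Finset.univ xs)) := by
    rw [miniDev]; abel
  rw [e, show 4 * L = (L + L) + (L + L) by ring]
  calc _ ≤ _ := pconj_add _ _ _ _ _
    _ ≤ _ := add_le_add (pconj_add _ _ _ _ _) (pconj_add _ _ _ _ _)
    _ ≤ (n * ENNReal.ofReal (gap f ψ xs x) + n * ENNReal.ofReal (gap f ψ xs x₀))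
        + (ENNReal.ofReal (gap f ψ xs x) + ENNReal.ofReal (gap f ψ xs x₀)) := by
        rw [pconj_neg h.G_symm, pconj_neg h.G_symm]
        gcongr
        · exact h.pconj_batchGrad_sub_le s hx
        · exact h.pconj_batchGrad_sub_le s hx₀
        · exact h.pconj_batchGrad_univ_sub_le hx
        · exact h.pconj_batchGrad_univ_sub_le hx₀
    _ = _ := by ring

/-- The variance of the variance-reduced mini-batch gradient. -/
lemma sum_pconj_miniDev_le (h : IsProblem X f ψ w xs G L) [MeasurableSpace E] [BorelSpace E]
    {g : ℝ≥0 → ℝ≥0} {C : ℝ} (hG : IsCHEF G g C) {c : ℝ} (hc : 0 < c) {b : ℕ} (hb : 0 < b)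
    (hbn : b ≤ n) {l : ℝ≥0} (hl : 0 < l) (hd : 4 * L ≤ c * b * g l) {x x₀ : E} (hx : x ∈ X)
    (hx₀ : x₀ ∈ X) :
    ((n.choose b : ℕ) : ℝ≥0∞)⁻¹ *
        ∑ s ∈ Finset.powersetCard b Finset.univ, pconj G c (miniDev f s x x₀)
      ≤ ENNReal.ofReal (2 * C * l) *
        (ENNReal.ofReal (gap f ψ xs x) + ENNReal.ofReal (gap f ψ xs x₀)) := by
  let z : Fin n → E := fun i => (gradient (f i) x - batchGrad f Finset.univ x)
    - (gradient (f i) x₀ - batchGrad f Finset.univ x₀)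
  have hz : ∑ i, z i = 0 := by
    simp only [z]
    rw [Finset.sum_sub_distrib, h.sum_gradient_sub_batchGrad, h.sum_gradient_sub_batchGrad,
      sub_zero]
  have h1 : ∀ s ∈ Finset.powersetCard b (Finset.univ : Finset (Fin n)),
      pconj G c (miniDev f s x x₀) = pconj G c ((1 / (b : ℝ)) • ∑ i ∈ s, z i) := by
    intro s hs
    have hsb := (Finset.mem_powersetCard.1 hs).2
    have hs0 : s.card ≠ 0 := by omega
    congr 1
    simp only [z]
    rw [Finset.sum_sub_distrib, smul_sub, ← hsb, ← batchGrad_sub_const hs0,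
      ← batchGrad_sub_const hs0, miniDev]
    abel
  rw [Finset.sum_congr rfl h1]
  refine (hG.sum_powersetCard_pconj_le hc hb hbn z hz hl hd).trans ?_
  rw [show 2 * C * (l : ℝ) = (C * l) * 2 by ring,
    ENNReal.ofReal_mul (p := C * l) (mul_nonneg hG.C_pos.le l.2), mul_assoc]
  refine mul_le_mul_right ?_ _
  calc ENNReal.ofReal (1 / n) * ∑ i, pconj G (4 * L) (z i)
      ≤ ENNReal.ofReal (1 / n) * ∑ i, ((pconj G L (gradient (f i) x - gradient (f i) xs)
          + pconj G L (gradient (f i) x₀ - gradient (f i) xs))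
          + (ENNReal.ofReal (gap f ψ xs x) + ENNReal.ofReal (gap f ψ xs x₀))) := by
        gcongr with i
        have e : z i = ((gradient (f i) x - gradient (f i) xs)
            + -(gradient (f i) x₀ - gradient (f i) xs))
            + (-(batchGrad f Finset.univ x - batchGrad f Finset.univ xs)
            + (batchGrad f Finset.univ x₀ - batchGrad f Finset.univ xs)) := by
          -- Passing through `xs` splits the deviation into four differences, each of weight `L`.
          -- The individual and the full-gradient ones each contribute one gap at `x` and one at
          -- `x₀`, whence the factor 2.
          simp only [z]; abel
        rw [e, show 4 * L = (L + L) + (L + L) by ring]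
        calc _ ≤ _ := pconj_add _ _ _ _ _
          _ ≤ _ := add_le_add (pconj_add _ _ _ _ _) (pconj_add _ _ _ _ _)
          _ ≤ _ := by
            rw [pconj_neg h.G_symm, pconj_neg h.G_symm]
            gcongr
            · exact h.pconj_batchGrad_univ_sub_le hx
            · exact h.pconj_batchGrad_univ_sub_le hx₀
    _ ≤ (ENNReal.ofReal (gap f ψ xs x) + ENNReal.ofReal (gap f ψ xs x₀))
          + (ENNReal.ofReal (gap f ψ xs x) + ENNReal.ofReal (gap f ψ xs x₀)) := by
        rw [Finset.sum_add_distrib, Finset.sum_add_distrib, mul_add, mul_add, h.ofReal_avg_const]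
        gcongr
        · exact h.sum_pconj_gradient_sub_le hx
        · exact h.sum_pconj_gradient_sub_le hx₀
    _ = _ := by rw [ENNReal.ofReal_ofNat]; ring

lemma sum_pconj_gradient_xs_le (h : IsProblem X f ψ w xs G L) :
    ENNReal.ofReal (1 / n) * ∑ i, pconj G L (gradient (f i) xs - batchGrad f Finset.univ xs)
      ≤ DH f G L xs := by
  have hL := h.L_pos
  have h1 : ∀ i, pconj G L (gradient (f i) xs - batchGrad f Finset.univ xs) ≤ ENNReal.ofReal L *
      (convexConj G ((1 / L) • (gradient (f i) xs - gradient (avgLoss f) xs))).toENNReal := by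
    intro i
    have := pconj_smul_le G hL 1 ((1 / L) • (gradient (f i) xs - gradient (avgLoss f) xs))
    rw [smul_smul, mul_one_div_cancel hL.ne', one_smul, mul_one, pconj_one_eq] at this
    rwa [h.gradient_avgLoss h.mem] at this ⊢
  calc _ ≤ ENNReal.ofReal (1 / n) * ∑ i, ENNReal.ofReal L *
      (convexConj G ((1 / L) • (gradient (f i) xs - gradient (avgLoss f) xs))).toENNReal := by
        gcongr with i; exact h1 i
    _ = _ := by
        rw [← Finset.mul_sum, ← mul_assoc, ← ENNReal.ofReal_mul (by positivity), DH]
        congr 2; ring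

/-- The variance of the batch gradient. -/
lemma sum_pconj_batchDev_le (h : IsProblem X f ψ w xs G L) [MeasurableSpace E] [BorelSpace E]
    {g : ℝ≥0 → ℝ≥0} {C : ℝ} (hG : IsCHEF G g C) {c : ℝ} (hc : 0 < c) {B : ℕ}
    (hBn : B ≤ n) {l : ℝ≥0} (hl : 0 < l) {H : ℝ≥0∞}
    (hH : B = n ∨ (3 * L ≤ c * B * g l ∧ H = DH f G L xs)) {x₀ : E} (hx₀ : x₀ ∈ X) :
    ((n.choose B : ℕ) : ℝ≥0∞)⁻¹ *
        ∑ s ∈ Finset.powersetCard B Finset.univ, pconj G c (batchDev f s x₀)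
      ≤ ENNReal.ofReal (C * l) * (2 * ENNReal.ofReal (gap f ψ xs x₀) + H) := by
  rcases hH with rfl | ⟨hd, rfl⟩
  · rw [Finset.sum_eq_zero]
    · simp
    · intro s hs
      have : s = Finset.univ := by
        rw [← Finset.card_eq_iff_eq_univ, (Finset.mem_powersetCard.1 hs).2, Fintype.card_fin]
      rw [this, batchDev, sub_self, pconj_zero h.G_nonneg hc.le]
  have hB : 0 < B := by
    rcases Nat.eq_zero_or_pos B with rfl | hB
    · have := h.L_pos
      simp only [Nat.cast_zero, mul_zero, zero_mul] at hd
      linarith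
    · exact hB
  let z : Fin n → E := fun i => gradient (f i) x₀ - batchGrad f Finset.univ x₀
  have h1 : ∀ s ∈ Finset.powersetCard B (Finset.univ : Finset (Fin n)),
      pconj G c (batchDev f s x₀) = pconj G c ((1 / (B : ℝ)) • ∑ i ∈ s, z i) := by
    intro s hs
    have hsb := (Finset.mem_powersetCard.1 hs).2
    have hs0 : s.card ≠ 0 := by omega
    rw [← hsb, batchDev, batchGrad_sub_const hs0]
  rw [Finset.sum_congr rfl h1]
  refine (hG.sum_powersetCard_pconj_le hc hB hBn z (h.sum_gradient_sub_batchGrad x₀) hl hd).trans ?_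
  gcongr
  calc ENNReal.ofReal (1 / n) * ∑ i, pconj G (3 * L) (z i)
      ≤ ENNReal.ofReal (1 / n) * ∑ i, ((pconj G L (gradient (f i) x₀ - gradient (f i) xs)
          + ENNReal.ofReal (gap f ψ xs x₀))
          + pconj G L (gradient (f i) xs - batchGrad f Finset.univ xs)) := by
        gcongr with i
        have e : z i = ((gradient (f i) x₀ - gradient (f i) xs)
            + -(batchGrad f Finset.univ x₀ - batchGrad f Finset.univ xs))
            + (gradient (f i) xs - batchGrad f Finset.univ xs) := by
          simp only [z]; abel
        rw [e, show 3 * L = (L + L) + L by ring]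
        calc _ ≤ _ := pconj_add _ _ _ _ _
          _ ≤ _ := add_le_add (pconj_add _ _ _ _ _) le_rfl
          _ ≤ _ := by
            rw [pconj_neg h.G_symm]
            gcongr
            exact h.pconj_batchGrad_univ_sub_le hx₀
    _ ≤ (ENNReal.ofReal (gap f ψ xs x₀) + ENNReal.ofReal (gap f ψ xs x₀)) + DH f G L xs := by
        rw [Finset.sum_add_distrib, Finset.sum_add_distrib, mul_add, mul_add, h.ofReal_avg_const]
        gcongr
        · exact h.sum_pconj_gradient_sub_le hx₀
        · exact h.sum_pconj_gradient_xs_le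
    _ = _ := by ring

lemma pconj_batchDev_le (h : IsProblem X f ψ w xs G L) (s : Finset (Fin n)) {x₀ : E}
    (hx₀ : x₀ ∈ X) :
    pconj G (3 * L) (batchDev f s x₀)
      ≤ (n + 1) * ENNReal.ofReal (gap f ψ xs x₀) + pconj G L (batchDev f s xs) := by
  have e : batchDev f s x₀ = ((batchGrad f s x₀ - batchGrad f s xs)
      + -(batchGrad f Finset.univ x₀ - batchGrad f Finset.univ xs)) + batchDev f s xs := by
    simp only [batchDev]; abel
  rw [e, show 3 * L = (L + L) + L by ring]
  calc _ ≤ _ := pconj_add _ _ _ _ _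
    _ ≤ _ := add_le_add (pconj_add _ _ _ _ _) le_rfl
    _ ≤ (n * ENNReal.ofReal (gap f ψ xs x₀) + ENNReal.ofReal (gap f ψ xs x₀))
        + pconj G L (batchDev f s xs) := by
        rw [pconj_neg h.G_symm]
        gcongr
        · exact h.pconj_batchGrad_sub_le s hx₀
        · exact h.pconj_batchGrad_univ_sub_le hx₀
    _ = _ := by ring

/-- A full batch has no deviation, so its conjugate is finite even if `DH` is infinite. -/
lemma pconj_batchDev_xs_ne_top (h : IsProblem X f ψ w xs G L) {s : Finset (Fin n)}
    (hs : s = Finset.univ ∨ (s.card ≠ 0 ∧ DH f G L xs ≠ ⊤)) :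
    pconj G L (batchDev f s xs) ≠ ⊤ := by
  rcases hs with rfl | ⟨hs, hD⟩
  · simp [batchDev, pconj_zero h.G_nonneg h.L_pos.le]
  have h1 := (h.sum_pconj_gradient_xs_le.trans_lt hD.lt_top).ne
  have h2 : ∑ i, pconj G L (gradient (f i) xs - batchGrad f Finset.univ xs) ≠ ⊤ := by
    intro h3
    rw [h3, ENNReal.mul_top] at h1
    · exact h1 rfl
    · have : (0 : ℝ) < n := by exact_mod_cast h.n_pos
      simp only [ne_eq, ENNReal.ofReal_eq_zero, not_le]
      positivity
  rw [batchDev, batchGrad_sub_const hs]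
  refine ((pconj_avg_le G L (Finset.card_ne_zero.1 hs) _).trans_lt
    (ENNReal.mul_lt_top ENNReal.ofReal_lt_top ?_)).ne
  exact (Finset.sum_le_sum_of_subset s.subset_univ).trans_lt h2.lt_top

/-- Positive parts of the signed terms stay on the right and negative parts move to the left, so the
inequality can be integrated in `[0, ∞]` before the next iterate is known to have finite
expectations. -/
lemma ofReal_add_neg_le {u v r s Z₁ Z₂ : ℝ} (hu : 0 ≤ u) (hv : 0 ≤ v) (hr : 0 ≤ r) (hs : 0 ≤ s)
    (huv : u ≤ v + r + s + Z₁ + Z₂) :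
    ENNReal.ofReal u + ENNReal.ofReal (-Z₁) + ENNReal.ofReal (-Z₂)
      ≤ ENNReal.ofReal v + ENNReal.ofReal r + ENNReal.ofReal s + ENNReal.ofReal Z₁
        + ENNReal.ofReal Z₂ := by
  have e : ∀ x : ℝ, ENNReal.ofReal x = ENNReal.ofReal (max x 0) := fun x => by
    rcases le_total x 0 with hx | hx
    · rw [max_eq_right hx, ENNReal.ofReal_of_nonpos hx, ENNReal.ofReal_zero]
    · rw [max_eq_left hx]
  have p : ∀ x : ℝ, 0 ≤ max x 0 := fun x => le_max_right _ _
  have d : ∀ x : ℝ, max x 0 - max (-x) 0 = x := fun x => by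
    rcases le_total x 0 with hx | hx
    · rw [max_eq_right hx, max_eq_left (by linarith)]; ring
    · rw [max_eq_left hx, max_eq_right (by linarith)]; ring
  have d1 := d Z₁
  have d2 := d Z₂
  have p1 := p Z₁
  have p2 := p Z₂
  have p3 := p (-Z₁)
  have p4 := p (-Z₂)
  rw [e Z₁, e Z₂, e (-Z₁), e (-Z₂), ← ENNReal.ofReal_add hu p3,
    ← ENNReal.ofReal_add (by positivity) p4, ← ENNReal.ofReal_add hv hr,
    ← ENNReal.ofReal_add (by positivity) hs, ← ENNReal.ofReal_add (by positivity) p1,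
    ← ENNReal.ofReal_add (by positivity) p2]
  exact ENNReal.ofReal_le_ofReal (by linarith)

/-- The pathwise inequality for one inner step, comparing with a mixture of the optimum and of the
starting point of the epoch. -/
lemma inner_step_le (h : IsProblem X f ψ w xs G L) {η p q γ c₀ c₂ : ℝ} (hη : 0 < η) (hp : 0 ≤ p)
    (hq : 0 ≤ q) (hpq : p + q = 1) (hγ : 0 ≤ γ) (hc₀ : c₀ ≤ 1 / η - L)
    (hc₂ : c₂ = q / η * (1 - γ)) (hc₂0 : 0 ≤ c₂)
    {x x₀ z : E} {s I : Finset (Fin n)} (hx : x ∈ X) (hx₀ : x₀ ∈ X)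
    (hz : IsMirrorProxStep X w ψ η x (batchGrad f s x - batchGrad f s x₀ + batchGrad f I x₀) z) :
    ENNReal.ofReal (gap f ψ xs z + p / η * bregman w xs z + q * γ / η * bregman w x₀ z)
        + ENNReal.ofReal (-(-inner ℝ (miniDev f s x x₀) (x - (p • xs + q • x₀))))
        + ENNReal.ofReal (-(-p * inner ℝ (batchDev f I x₀) (x₀ - xs)))
      ≤ ENNReal.ofReal (q * gap f ψ xs x₀ + p / η * bregman w xs x + q / η * bregman w x₀ x)
        + pconj G c₀ (miniDev f s x x₀) + pconj G c₂ (batchDev f I x₀)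
        + ENNReal.ofReal (-inner ℝ (miniDev f s x x₀) (x - (p • xs + q • x₀)))
        + ENNReal.ofReal (-p * inner ℝ (batchDev f I x₀) (x₀ - xs)) := by
  by_cases ht : pconj G c₀ (miniDev f s x x₀) = ⊤
  · simp [ht]
  by_cases ht' : pconj G c₂ (batchDev f I x₀) = ⊤
  · simp [ht']
  have hzX := hz.1
  rw [← ENNReal.ofReal_toReal ht, ← ENNReal.ofReal_toReal ht']
  have g0 := h.gap_nonneg hx₀
  have gz := h.gap_nonneg hzX
  have b1 := h.bregman_w_nonneg h.mem hzX
  have b2 := h.bregman_w_nonneg hx₀ hzX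
  have b3 := h.bregman_w_nonneg h.mem hx
  have b4 := h.bregman_w_nonneg hx₀ hx
  refine ofReal_add_neg_le (by positivity) (by positivity) ENNReal.toReal_nonneg
    ENNReal.toReal_nonneg ?_
  have e1 : batchGrad f Finset.univ x
      - (batchGrad f s x - batchGrad f s x₀ + batchGrad f I x₀)
      = -(miniDev f s x x₀ + batchDev f I x₀) := by
    simp only [miniDev, batchDev]; abel
  -- The weighted sum of the two comparisons pairs the noise with `z - (p xs + q x₀)`. For `miniDev`
  -- this splits at `x`: the part `x - (p xs + q x₀)` does not see the mini-batch, and `z - x` is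
  -- paid by `c₀ G(z - x)`. For `batchDev` it is `(z - x₀) + p (x₀ - xs)`: the second part does not
  -- see the batch, and the first is paid by `c₂ D_w(x₀, z)`, which leaves `qγ/η` of the available
  -- `q/η`.
  have k1 := mul_le_mul_of_nonneg_left (h.mirrorProx_step_le hη hx hz h.mem) hp
  have k2 := mul_le_mul_of_nonneg_left (h.mirrorProx_step_le hη hx hz hx₀) hq
  rw [e1] at k1 k2
  have y1 := inner_le_pconj ht (x - z)
  have y2 := inner_le_pconj ht' (x₀ - z)
  have hG1 : G (x - z) = G (z - x) := by rw [← h.G_symm, neg_sub]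
  have hG2 : c₂ * G (x₀ - z) ≤ c₂ * bregman w x₀ z :=
    mul_le_mul_of_nonneg_left (h.le_bregman_w x₀ hx₀ z hzX) hc₂0
  have hG3 : c₀ * G (z - x) ≤ (1 / η - L) * G (z - x) :=
    mul_le_mul_of_nonneg_right hc₀ (h.G_nonneg _)
  rw [hG1] at y1
  have hp' : p = 1 - q := by linarith
  subst hp'
  subst hc₂
  simp only [gap, inner_neg_left, inner_add_left, inner_sub_right, inner_add_right,
    real_inner_smul_right] at *
  generalize inner ℝ (miniDev f s x x₀) x = a1 at *
  generalize inner ℝ (miniDev f s x x₀) z = a2 at *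
  generalize inner ℝ (miniDev f s x x₀) xs = a3 at *
  generalize inner ℝ (miniDev f s x x₀) x₀ = a4 at *
  generalize inner ℝ (batchDev f I x₀) z = a5 at *
  generalize inner ℝ (batchDev f I x₀) xs = a6 at *
  generalize inner ℝ (batchDev f I x₀) x₀ = a7 at *
  rw [div_eq_mul_one_div (1 - q) η, div_eq_mul_one_div q η, div_eq_mul_one_div (q * γ) η] at *
  generalize 1 / η = i at *
  linarith

end IsProblem

end Deviations

end SCSG

namespace SCSG

/-! ### One inner step in expectation. -/

section Epoch

variable {Ω : Type*} {mΩ : MeasurableSpace Ω} {P : Measure Ω}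

lemma lintegral_le_of_le_add_mean_zero₂ {U V : Ω → ℝ≥0∞} {Z₁ Z₂ : Ω → ℝ} (hZ₁ : Measurable Z₁)
    (hZ₂ : Measurable Z₂)
    (h₁ : ∫⁻ ω, ENNReal.ofReal (Z₁ ω) ∂P = ∫⁻ ω, ENNReal.ofReal (-Z₁ ω) ∂P ∧
      ∫⁻ ω, ENNReal.ofReal (Z₁ ω) ∂P ≠ ⊤)
    (h₂ : ∫⁻ ω, ENNReal.ofReal (Z₂ ω) ∂P = ∫⁻ ω, ENNReal.ofReal (-Z₂ ω) ∂P ∧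
      ∫⁻ ω, ENNReal.ofReal (Z₂ ω) ∂P ≠ ⊤)
    (h : ∀ ω, U ω + ENNReal.ofReal (-Z₁ ω) + ENNReal.ofReal (-Z₂ ω)
      ≤ V ω + ENNReal.ofReal (Z₁ ω) + ENNReal.ofReal (Z₂ ω)) :
    ∫⁻ ω, U ω ∂P ≤ ∫⁻ ω, V ω ∂P := by
  have h3 := lintegral_le_of_le_add_mean_zero hZ₂ h₂.1 h₂.2 h
  rw [lintegral_add_right _ (show Measurable fun ω => ENNReal.ofReal (-Z₁ ω) from
    hZ₁.neg.ennreal_ofReal), lintegral_add_right _ hZ₁.ennreal_ofReal, ← h₁.1] at h3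
  exact (ENNReal.add_le_add_iff_right h₁.2).1 h3

/-- Freezing: a bound on the average over subsets, valid for each value of the past, integrates to a
bound for the random subset independent of that past. -/
lemma IsUniformSubset.lintegral_le {n k : ℕ} {S : Ω → Finset (Fin n)}
    (hS : IsUniformSubset P S k) {m : MeasurableSpace Ω} (hm : m ≤ mΩ)
    (hSm : MeasurableSpace.comap S ⊤ ≤ mΩ) (hind : Indep (MeasurableSpace.comap S ⊤) m P)
    {H : Finset (Fin n) → Ω → ℝ≥0∞} (hH : ∀ s, Measurable[m] (H s)) {R : Ω → ℝ≥0∞}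
    (hR : ∀ ω, ((n.choose k : ℕ) : ℝ≥0∞)⁻¹ * ∑ s ∈ Finset.powersetCard k Finset.univ, H s ω
      ≤ R ω) :
    ∫⁻ ω, H (S ω) ω ∂P ≤ ∫⁻ ω, R ω ∂P := by
  rw [lintegral_indep_discrete hm hSm hind hH, tsum_fintype]
  calc ∑ s, P {ω | S ω = s} * ∫⁻ ω, H s ω ∂P
      = ∫⁻ ω, ∑ s, P {ω | S ω = s} * H s ω ∂P := by
        rw [lintegral_finsetSum _ fun s _ => ((hH s).mono hm le_rfl).const_mul _]
        exact Finset.sum_congr rfl fun s _ => (lintegral_const_mul _ ((hH s).mono hm le_rfl)).symm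
    _ ≤ ∫⁻ ω, R ω ∂P := lintegral_mono fun ω => by
        simpa only [hS.sum_mul fun s => H s ω] using hR ω

variable {E : Type*} [NormedAddCommGroup E] [InnerProductSpace ℝ E]

/-- Young's inequality replaces Cauchy–Schwarz here; no moments of the norms are available. -/
lemma integrable_inner_of_pconj [MeasurableSpace E] [BorelSpace E] {G : E → ℝ}
    (hG : ∀ v, 0 ≤ G v) (hs : ∀ v, G (-v) = G v) {c : ℝ}
    (hc : 0 ≤ c) {a v : Ω → E} (ha : StronglyMeasurable a) (hv : StronglyMeasurable v)
    (h1 : ∫⁻ ω, pconj G c (a ω) ∂P ≠ ⊤) {D : Ω → ℝ} (hD : ∀ ω, G (v ω) ≤ D ω)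
    (h2 : ∫⁻ ω, ENNReal.ofReal (D ω) ∂P ≠ ⊤) :
    Integrable (fun ω => (inner ℝ (a ω) (v ω) : ℝ)) P := by
  refine ⟨(ha.inner hv).aestronglyMeasurable, ?_⟩
  calc ∫⁻ ω, ‖(inner ℝ (a ω) (v ω) : ℝ)‖ₑ ∂P
      ≤ ∫⁻ ω, (pconj G c (a ω) + ENNReal.ofReal c * ENNReal.ofReal (D ω)) ∂P := by
        refine lintegral_mono fun ω => (enorm_inner_le_pconj hG hs hc (a ω) (v ω)).trans ?_
        rw [ENNReal.ofReal_mul hc]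
        gcongr
        exact hD ω
    _ = ∫⁻ ω, pconj G c (a ω) ∂P + ENNReal.ofReal c * ∫⁻ ω, ENNReal.ofReal (D ω) ∂P := by
        rw [lintegral_add_left (show Measurable fun ω => pconj G c (a ω) from
            (measurable_pconj G c).comp ha.measurable),
          lintegral_const_mul' _ _ ENNReal.ofReal_ne_top]
    _ < ⊤ := ENNReal.add_lt_top.2 ⟨h1.lt_top, ENNReal.mul_lt_top ENNReal.ofReal_lt_top h2.lt_top⟩

variable [CompleteSpace E]

lemma IsUniformSubset.sum_toReal_smul_batchGrad {n k : ℕ} {S : Ω → Finset (Fin n)}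
    (hS : IsUniformSubset P S k) (hk : 0 < k) (hkn : k ≤ n) (f : Fin n → E → ℝ) (x : E) :
    ∑ s, (P {ω | S ω = s}).toReal • batchGrad f s x = batchGrad f Finset.univ x := by
  rw [hS.sum_toReal_smul, batchGrad, Finset.card_univ, Fintype.card_fin,
    ← sum_powersetCard_mean hk hkn]
  congr 1
  refine Finset.sum_congr rfl fun s hs => ?_
  rw [batchGrad, (Finset.mem_powersetCard.1 hs).2]

lemma IsUniformSubset.sum_toReal {n k : ℕ} {S : Ω → Finset (Fin n)}
    (hS : IsUniformSubset P S k) (hkn : k ≤ n) : ∑ s, (P {ω | S ω = s}).toReal = 1 := by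
  have h1 := hS.sum_toReal_smul (fun _ => (1 : ℝ))
  simp only [smul_eq_mul, mul_one, Finset.sum_const, Finset.card_powersetCard, Finset.card_univ,
    Fintype.card_fin, nsmul_eq_mul] at h1
  rw [h1, inv_mul_cancel₀ (by exact_mod_cast (Nat.choose_pos hkn).ne')]

lemma IsUniformSubset.sum_toReal_smul_miniDev {n k : ℕ} {S : Ω → Finset (Fin n)}
    (hS : IsUniformSubset P S k) (hk : 0 < k) (hkn : k ≤ n) (f : Fin n → E → ℝ) (x x₀ : E) :
    ∑ s, (P {ω | S ω = s}).toReal • miniDev f s x x₀ = 0 := by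
  simp only [miniDev, smul_sub, Finset.sum_sub_distrib, ← Finset.sum_smul,
    hS.sum_toReal_smul_batchGrad hk hkn, hS.sum_toReal hkn, one_smul, sub_self]

lemma IsUniformSubset.sum_toReal_smul_batchDev {n k : ℕ} {S : Ω → Finset (Fin n)}
    (hS : IsUniformSubset P S k) (hk : 0 < k) (hkn : k ≤ n) (f : Fin n → E → ℝ) (x₀ : E) :
    ∑ s, (P {ω | S ω = s}).toReal • batchDev f s x₀ = 0 := by
  simp only [batchDev, smul_sub, Finset.sum_sub_distrib, ← Finset.sum_smul,
    hS.sum_toReal_smul_batchGrad hk hkn, hS.sum_toReal hkn, one_smul, sub_self]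

/-- One epoch of the algorithm: the iterates `x k`, the batch `I`, and the mini-batches `S k`, where
`m (k + 1)` is the information available when `x k` has been computed and `m 0` is the information
available before `I` is drawn. -/
structure IsEpoch {n : ℕ} (P : Measure Ω) (X : Set E) (f : Fin n → E → ℝ) (ψ w : E → ℝ) (η : ℝ)
    (B b : ℕ) (I : Ω → Finset (Fin n)) (S : ℕ → Ω → Finset (Fin n)) (x : ℕ → Ω → E)
    (m : ℕ → MeasurableSpace Ω) : Prop where
  le : ∀ k, m k ≤ mΩ
  zero_le : ∀ k, m 0 ≤ m k
  I_le : MeasurableSpace.comap I ⊤ ≤ mΩ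
  S_le : ∀ k, MeasurableSpace.comap (S k) ⊤ ≤ mΩ
  indep_I : Indep (MeasurableSpace.comap I ⊤) (m 0) P
  indep_S : ∀ k, Indep (MeasurableSpace.comap (S k) ⊤) (m (k + 1)) P
  x_zero : StronglyMeasurable[m 0] (x 0)
  x_meas : ∀ k, StronglyMeasurable[m (k + 1)] (x k)
  mem : ∀ k ω, x k ω ∈ X
  unif_I : IsUniformSubset P I B
  unif_S : ∀ k, IsUniformSubset P (S k) b
  step : ∀ k ω, IsMirrorProxStep X w ψ η (x k ω)
    (batchGrad f (S k ω) (x k ω) - batchGrad f (S k ω) (x 0 ω) + batchGrad f (I ω) (x 0 ω))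
    (x (k + 1) ω)

/-- The one-step inequality in expectation. -/
lemma IsEpoch.expected_step_le [MeasurableSpace E] [BorelSpace E] [IsProbabilityMeasure P]
    {n : ℕ} {X : Set E} {f : Fin n → E → ℝ} {ψ w : E → ℝ} {xs : E} {G : E → ℝ} {L : ℝ}
    (h : IsProblem X f ψ w xs G L) (hψ : Measurable (fun x : X => ψ x))
    {g : ℝ≥0 → ℝ≥0} {C : ℝ} (hG : IsCHEF G g C) {η p q γ c₀ c₂ : ℝ} {B b : ℕ}
    {I : Ω → Finset (Fin n)} {S : ℕ → Ω → Finset (Fin n)} {x : ℕ → Ω → E}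
    {m : ℕ → MeasurableSpace Ω}
    (hE : IsEpoch P X f ψ w η B b I S x m) (hη : 0 < η) (hp : 0 ≤ p)
    (hq : 0 ≤ q) (hpq : p + q = 1) (hγ : 0 ≤ γ) (hc₀0 : 0 < c₀) (hc₀ : c₀ ≤ 1 / η - L)
    (hc₂ : c₂ = q / η * (1 - γ)) (hc₂0 : 0 < c₂) (hb : 0 < b) (hB : 0 < B)
    {l₁ l₂ : ℝ≥0} (hl₁ : 0 < l₁) (hd₁ : 4 * L ≤ c₀ * b * g l₁) (hl₂ : 0 < l₂) {H : ℝ≥0∞}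
    (hHt : H ≠ ⊤) (hH : B = n ∨ (3 * L ≤ c₂ * B * g l₂ ∧ H = DH f G L xs)) {k : ℕ}
    (hφ0 : ∫⁻ ω, ENNReal.ofReal (gap f ψ xs (x 0 ω)) ∂P ≠ ⊤)
    (hd0 : ∫⁻ ω, ENNReal.ofReal (bregman w xs (x 0 ω)) ∂P ≠ ⊤)
    (hφk : ∫⁻ ω, ENNReal.ofReal (gap f ψ xs (x k ω)) ∂P ≠ ⊤)
    (hdk : ∫⁻ ω, ENNReal.ofReal (bregman w xs (x k ω)) ∂P ≠ ⊤)
    (hwk : ∫⁻ ω, ENNReal.ofReal (bregman w (x 0 ω) (x k ω)) ∂P ≠ ⊤) :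
    ∫⁻ ω, ENNReal.ofReal (gap f ψ xs (x (k + 1) ω)) ∂P
        + ENNReal.ofReal (p / η) * ∫⁻ ω, ENNReal.ofReal (bregman w xs (x (k + 1) ω)) ∂P
        + ENNReal.ofReal (q * γ / η) * ∫⁻ ω, ENNReal.ofReal (bregman w (x 0 ω) (x (k + 1) ω)) ∂P
      ≤ ENNReal.ofReal q * ∫⁻ ω, ENNReal.ofReal (gap f ψ xs (x 0 ω)) ∂P
        + ENNReal.ofReal (p / η) * ∫⁻ ω, ENNReal.ofReal (bregman w xs (x k ω)) ∂P
        + ENNReal.ofReal (q / η) * ∫⁻ ω, ENNReal.ofReal (bregman w (x 0 ω) (x k ω)) ∂P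
        + ENNReal.ofReal (2 * C * l₁) * (∫⁻ ω, ENNReal.ofReal (gap f ψ xs (x k ω)) ∂P
          + ∫⁻ ω, ENNReal.ofReal (gap f ψ xs (x 0 ω)) ∂P)
        + ENNReal.ofReal (C * l₂)
          * (2 * ∫⁻ ω, ENNReal.ofReal (gap f ψ xs (x 0 ω)) ∂P + H) := by
  have hbn := (hE.unif_S k).card_le
  have hBn := hE.unif_I.card_le
  have hL := h.L_pos
  have xm : ∀ j, StronglyMeasurable (x j) := fun j => (hE.x_meas j).mono (hE.le (j + 1))
  have x0m : ∀ j, StronglyMeasurable[m (j + 1)] (x 0) := fun j => hE.x_zero.mono (hE.zero_le (j + 1))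
  have cm : ∀ j, Measurable (fun ω => ENNReal.ofReal (gap f ψ xs (x j ω))) := fun j =>
    ((h.measurable_objective_comp hψ (xm j) (hE.mem j)).sub_const _).ennreal_ofReal
  have dm : ∀ j, Measurable (fun ω => ENNReal.ofReal (bregman w xs (x j ω))) := fun j =>
    (measurable_bregman_comp h.conv_ψ.1 h.diff_w stronglyMeasurable_const (xm j)
      (fun _ => h.mem) (hE.mem j)).ennreal_ofReal
  have wm : ∀ j, Measurable (fun ω => ENNReal.ofReal (bregman w (x 0 ω) (x j ω))) := fun j =>
    (measurable_bregman_comp h.conv_ψ.1 h.diff_w (xm 0) (xm j) (hE.mem 0)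
      (hE.mem j)).ennreal_ofReal
  have am : ∀ s, StronglyMeasurable[m (k + 1)] (fun ω => miniDev f s (x k ω) (x 0 ω)) := fun s =>
    ((h.stronglyMeasurable_batchGrad s (hE.x_meas k) (hE.mem k)).sub
      (h.stronglyMeasurable_batchGrad s (x0m k) (hE.mem 0))).sub
      ((h.stronglyMeasurable_batchGrad Finset.univ (hE.x_meas k) (hE.mem k)).sub
      (h.stronglyMeasurable_batchGrad Finset.univ (x0m k) (hE.mem 0)))
  have em : ∀ s, StronglyMeasurable[m 0] (fun ω => batchDev f s (x 0 ω)) := fun s =>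
    (h.stronglyMeasurable_batchGrad s hE.x_zero (hE.mem 0)).sub
      (h.stronglyMeasurable_batchGrad Finset.univ hE.x_zero (hE.mem 0))
  let v : Ω → E := fun ω => x k ω - (p • xs + q • x 0 ω)
  have vm : StronglyMeasurable[m (k + 1)] v :=
    (hE.x_meas k).sub (stronglyMeasurable_const.add ((x0m k).const_smul q))
  let v₀ : Ω → E := fun ω => x 0 ω - xs
  have vm₀ : StronglyMeasurable[m 0] v₀ := hE.x_zero.sub stronglyMeasurable_const
  -- the two terms of mean zero
  have hZ₁m : ∀ s, Measurable[m (k + 1)] (fun ω => -inner ℝ (miniDev f s (x k ω) (x 0 ω)) (v ω)) :=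
    fun s => ((am s).inner vm).measurable.neg
  have hZ₂m : ∀ s, Measurable[m 0] (fun ω => -p * inner ℝ (batchDev f s (x 0 ω)) (v₀ ω)) :=
    fun s => ((em s).inner vm₀).measurable.const_mul _
  have hZ₁ := lintegral_ofReal_eq_of_discrete_mean_zero (P := P) (hE.le (k + 1)) (hE.S_le k)
    (hE.indep_S k) hZ₁m
    (fun s _ => by
      have hp1 : ∫⁻ ω, pconj G (4 * L) (miniDev f s (x k ω) (x 0 ω)) ∂P ≠ ⊤ := by
        refine ((lintegral_mono fun ω =>
          h.pconj_miniDev_le s (hE.mem k ω) (hE.mem 0 ω)).trans_lt ?_).ne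
        rw [lintegral_const_mul' _ _ (by finiteness), lintegral_add_left (cm k)]
        exact ENNReal.mul_lt_top (by finiteness) (ENNReal.add_lt_top.2 ⟨hφk.lt_top, hφ0.lt_top⟩)
      have hi1 := integrable_inner_of_pconj h.G_nonneg h.G_symm (c := 4 * L) (by positivity)
        ((am s).mono (hE.le (k + 1))) ((xm k).sub stronglyMeasurable_const) hp1
        (D := fun ω => bregman w xs (x k ω)) (fun ω => by
          have := h.le_bregman_w xs h.mem _ (hE.mem k ω)
          rwa [← h.G_symm, neg_sub] at this) hdk
      have hi2 := integrable_inner_of_pconj h.G_nonneg h.G_symm (c := 4 * L) (by positivity)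
        ((am s).mono (hE.le (k + 1))) ((xm k).sub (xm 0)) hp1
        (D := fun ω => bregman w (x 0 ω) (x k ω)) (fun ω => by
          have := h.le_bregman_w _ (hE.mem 0 ω) _ (hE.mem k ω)
          rwa [← h.G_symm, neg_sub] at this) hwk
      refine ((hi1.const_mul p).add (hi2.const_mul q)).neg.congr (Eventually.of_forall fun ω => ?_)
      -- This splitting reduces integrability to the two distances already known to have finite
      -- expectation.
      have e : v ω = p • (x k ω - xs) + q • (x k ω - x 0 ω) := by
        have : x k ω = (p + q) • x k ω := by rw [hpq, one_smul]
        simp only [v]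
        nth_rewrite 1 [this]
        module
      simp only [e, inner_add_right, real_inner_smul_right, Pi.neg_apply, Pi.add_apply,
        Pi.sub_apply])
    (fun ω => by
      have := congrArg (fun u => -inner ℝ u (v ω))
        ((hE.unif_S k).sum_toReal_smul_miniDev hb hbn f (x k ω) (x 0 ω))
      simp only [sum_inner, real_inner_smul_left, inner_zero_left, neg_zero,
        ← Finset.sum_neg_distrib, ← mul_neg] at this
      exact this)
  -- Batches of probability zero must be excluded: for a full batch size nothing is assumed about
  -- the other subsets when `DH` is infinite.
  have hfin : ∀ s, P {ω | I ω = s} ≠ 0 → pconj G L (batchDev f s xs) ≠ ⊤ := by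
    intro s hs
    have hsB : s.card = B := by
      by_contra hne
      exact hs (by rw [hE.unif_I s, if_neg hne])
    refine h.pconj_batchDev_xs_ne_top ?_
    rcases hH with hBn | ⟨-, rfl⟩
    · left
      rw [← Finset.card_eq_iff_eq_univ, hsB, Fintype.card_fin, hBn]
    · exact Or.inr ⟨by omega, hHt⟩
  have hZ₂ := lintegral_ofReal_eq_of_discrete_mean_zero (P := P) (hE.le 0) hE.I_le
    hE.indep_I hZ₂m
    (fun s hs => by
      have hp1 : ∫⁻ ω, pconj G (3 * L) (batchDev f s (x 0 ω)) ∂P ≠ ⊤ := by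
        refine ((lintegral_mono fun ω => h.pconj_batchDev_le s (hE.mem 0 ω)).trans_lt ?_).ne
        rw [lintegral_add_right _ measurable_const, lintegral_const_mul _ (cm 0), lintegral_const,
          measure_univ, mul_one]
        exact ENNReal.add_lt_top.2
          ⟨ENNReal.mul_lt_top (by finiteness) hφ0.lt_top, (hfin s hs).lt_top⟩
      exact (integrable_inner_of_pconj h.G_nonneg h.G_symm (c := 3 * L) (by positivity)
        ((em s).mono (hE.le 0)) (vm₀.mono (hE.le 0)) hp1
        (D := fun ω => bregman w xs (x 0 ω)) (fun ω => by
          have := h.le_bregman_w xs h.mem _ (hE.mem 0 ω)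
          rwa [← h.G_symm, neg_sub] at this) hd0).const_mul _)
    (fun ω => by
      have := congrArg (fun u => -p * inner ℝ u (v₀ ω))
        (hE.unif_I.sum_toReal_smul_batchDev hB hBn f (x 0 ω))
      simp only [sum_inner, real_inner_smul_left, inner_zero_left, mul_zero,
        Finset.mul_sum] at this
      rw [← this]
      exact Finset.sum_congr rfl fun s _ => by ring)
  have hmain := lintegral_le_of_le_add_mean_zero₂
    (measurable_discrete (hE.S_le k) fun s => (hZ₁m s).mono (hE.le (k + 1)) le_rfl)
    (measurable_discrete hE.I_le fun s => (hZ₂m s).mono (hE.le 0) le_rfl) hZ₁ hZ₂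
    (fun ω => h.inner_step_le hη hp hq hpq hγ hc₀ hc₂ hc₂0.le (hE.mem k ω) (hE.mem 0 ω)
      (hE.step k ω))
  -- the variance terms
  have hV₁ := (hE.unif_S k).lintegral_le (hE.le (k + 1)) (hE.S_le k) (hE.indep_S k)
    (H := fun s ω => pconj G c₀ (miniDev f s (x k ω) (x 0 ω)))
    (fun s => (measurable_pconj G c₀).comp (am s).measurable)
    (fun ω => h.sum_pconj_miniDev_le hG hc₀0 hb hbn hl₁ hd₁ (hE.mem k ω) (hE.mem 0 ω))
  have hV₂ := hE.unif_I.lintegral_le (hE.le 0) hE.I_le hE.indep_I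
    (H := fun s ω => pconj G c₂ (batchDev f s (x 0 ω)))
    (fun s => (measurable_pconj G c₂).comp (em s).measurable)
    (fun ω => h.sum_pconj_batchDev_le hG hc₂0 hBn hl₂ hH (hE.mem 0 ω))
  rw [lintegral_const_mul' _ _ ENNReal.ofReal_ne_top, lintegral_add_left (cm k)] at hV₁
  rw [lintegral_const_mul' _ _ ENNReal.ofReal_ne_top,
    lintegral_add_right _ measurable_const, lintegral_const_mul _ (cm 0), lintegral_const,
    measure_univ, mul_one] at hV₂
  have hm₁ : Measurable (fun ω => pconj G c₀ (miniDev f (S k ω) (x k ω) (x 0 ω))) :=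
    measurable_discrete (hE.S_le k) (H := fun s ω => pconj G c₀ (miniDev f s (x k ω) (x 0 ω)))
      fun s => (measurable_pconj G c₀).comp ((am s).mono (hE.le (k + 1))).measurable
  have hm₂ : Measurable (fun ω => pconj G c₂ (batchDev f (I ω) (x 0 ω))) :=
    measurable_discrete hE.I_le (H := fun s ω => pconj G c₂ (batchDev f s (x 0 ω)))
      fun s => (measurable_pconj G c₂).comp ((em s).mono (hE.le 0)).measurable
  rw [lintegral_add_right _ hm₂, lintegral_add_right _ hm₁] at hmain
  have b1 : ∀ j ω, 0 ≤ bregman w xs (x j ω) := fun j ω => h.bregman_w_nonneg h.mem (hE.mem j ω)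
  have b2 : ∀ j ω, 0 ≤ bregman w (x 0 ω) (x j ω) := fun j ω =>
    h.bregman_w_nonneg (hE.mem 0 ω) (hE.mem j ω)
  have g1 : ∀ j ω, 0 ≤ gap f ψ xs (x j ω) := fun j ω => h.gap_nonneg (hE.mem j ω)
  have hpη : 0 ≤ p / η := by positivity
  have hqη : 0 ≤ q / η := by positivity
  have hqγ : 0 ≤ q * γ / η := by positivity
  have hU : ∀ ω, ENNReal.ofReal (gap f ψ xs (x (k + 1) ω) + p / η * bregman w xs (x (k + 1) ω)
        + q * γ / η * bregman w (x 0 ω) (x (k + 1) ω))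
      = ENNReal.ofReal (gap f ψ xs (x (k + 1) ω))
        + ENNReal.ofReal (p / η) * ENNReal.ofReal (bregman w xs (x (k + 1) ω))
        + ENNReal.ofReal (q * γ / η) * ENNReal.ofReal (bregman w (x 0 ω) (x (k + 1) ω)) := by
    intro ω
    rw [ENNReal.ofReal_add (add_nonneg (g1 _ _) (mul_nonneg hpη (b1 _ _)))
      (mul_nonneg hqγ (b2 _ _)), ENNReal.ofReal_add (g1 _ _) (mul_nonneg hpη (b1 _ _)),
      ENNReal.ofReal_mul hpη, ENNReal.ofReal_mul hqγ]
  have hV : ∀ ω, ENNReal.ofReal (q * gap f ψ xs (x 0 ω) + p / η * bregman w xs (x k ω)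
        + q / η * bregman w (x 0 ω) (x k ω))
      = ENNReal.ofReal q * ENNReal.ofReal (gap f ψ xs (x 0 ω))
        + ENNReal.ofReal (p / η) * ENNReal.ofReal (bregman w xs (x k ω))
        + ENNReal.ofReal (q / η) * ENNReal.ofReal (bregman w (x 0 ω) (x k ω)) := by
    intro ω
    rw [ENNReal.ofReal_add (add_nonneg (mul_nonneg hq (g1 _ _)) (mul_nonneg hpη (b1 _ _)))
      (mul_nonneg hqη (b2 _ _)), ENNReal.ofReal_add (mul_nonneg hq (g1 _ _))
      (mul_nonneg hpη (b1 _ _)),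
      ENNReal.ofReal_mul hpη, ENNReal.ofReal_mul hqη, ENNReal.ofReal_mul hq]
  simp only [hU, hV] at hmain
  rw [lintegral_add_right _ ((wm _).const_mul _), lintegral_add_right _ ((dm _).const_mul _),
    lintegral_const_mul _ (dm _), lintegral_const_mul _ (wm _),
    lintegral_add_right _ ((wm _).const_mul _), lintegral_add_right _ ((dm _).const_mul _),
    lintegral_const_mul _ (dm _), lintegral_const_mul _ (wm _), lintegral_const_mul _ (cm _)]
    at hmain
  exact hmain.trans (add_le_add (add_le_add le_rfl hV₁) hV₂)

end Epoch

end SCSG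

namespace SCSG

/-! ### Telescoping under geometric weights. -/

section Geometric

/-- Averaging a one-step recursion over a geometric time, for partial sums. -/
lemma geometric_average_le {φ d w : ℕ → ℝ} (hφ : ∀ k, 0 ≤ φ k) (hd : ∀ k, 0 ≤ d k)
    (hw : ∀ k, 0 ≤ w k) (hw0 : w 0 = 0) {s r γ τ K : ℝ} (hs : 0 ≤ s) (hr : 0 ≤ r) (hγ : 0 < γ)
    (hγ1 : γ < 1) (hK : 0 ≤ K)
    (hrec : ∀ k, φ (k + 1) + s * d (k + 1) + r * γ * w (k + 1)
      ≤ s * d k + r * w k + τ * φ k + K) (N : ℕ) :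
    (1 - τ) * ∑ k ∈ Finset.range N, (1 - γ) * γ ^ k * φ k
        + s * ((1 - γ) / γ) * ∑ k ∈ Finset.range N, (1 - γ) * γ ^ k * d k
      ≤ (1 - γ) / γ * (φ 0 + s * d 0) + K := by
  set A : ℕ → ℝ := fun N => ∑ k ∈ Finset.range N, γ ^ k * φ k with hA
  set D : ℕ → ℝ := fun N => ∑ k ∈ Finset.range N, γ ^ k * d k with hD
  set Γ : ℕ → ℝ := fun N => ∑ k ∈ Finset.range N, γ ^ k with hΓ
  have sA : ∀ N, A (N + 1) = A N + γ ^ N * φ N := fun N => Finset.sum_range_succ _ _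
  have sD : ∀ N, D (N + 1) = D N + γ ^ N * d N := fun N => Finset.sum_range_succ _ _
  have sΓ : ∀ N, Γ (N + 1) = Γ N + γ ^ N := fun N => Finset.sum_range_succ _ _
  -- The recursion at `k` is multiplied by `γ ^ (k + 1)`; the terms in `w` then telescope, starting
  -- from `w 0 = 0`. Working with partial sums makes convergence of the series a conclusion.
  have h1 : ∀ N, A (N + 1) - φ 0 + s * (D (N + 1) - d 0) + r * γ ^ (N + 1) * w N
      ≤ γ * (s * D N + τ * A N) + γ * K * Γ N := by
    intro N
    induction N with
    | zero => simp [hA, hD, hΓ, hw0]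
    | succ N ih =>
      have h2 := mul_le_mul_of_nonneg_left (hrec N) (pow_nonneg hγ.le (N + 1))
      rw [sA (N + 1), sD (N + 1), sA N, sD N, sΓ N]
      rw [sA N, sD N] at ih
      have e1 : γ ^ (N + 1 + 1) = γ ^ (N + 1) * γ := pow_succ _ _
      have e2 : γ * γ ^ N = γ ^ (N + 1) := (pow_succ' _ _).symm
      rw [e1]
      have e3 : γ * (s * (D N + γ ^ N * d N) + τ * (A N + γ ^ N * φ N)) + γ * K * (Γ N + γ ^ N)
          = γ * (s * D N + τ * A N) + γ * K * Γ N
            + (γ * γ ^ N) * (s * d N + τ * φ N + K) := by ring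
      rw [e3, e2]
      linarith
  have hAnn : 0 ≤ A N := Finset.sum_nonneg fun k _ => mul_nonneg (pow_nonneg hγ.le _) (hφ k)
  have hDnn : 0 ≤ D N := Finset.sum_nonneg fun k _ => mul_nonneg (pow_nonneg hγ.le _) (hd k)
  have hΓle : (1 - γ) * Γ N ≤ 1 := by
    have := mul_neg_geom_sum γ N
    rw [hΓ]
    simp only
    rw [this]
    linarith [pow_nonneg hγ.le N]
  have h2 := h1 N
  have h3 : 0 ≤ r * γ ^ (N + 1) * w N :=
    mul_nonneg (mul_nonneg hr (pow_nonneg hγ.le _)) (hw N)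
  have h4 : 0 ≤ γ ^ N * φ N := mul_nonneg (pow_nonneg hγ.le _) (hφ N)
  have h5 : 0 ≤ s * (γ ^ N * d N) := mul_nonneg hs (mul_nonneg (pow_nonneg hγ.le _) (hd N))
  rw [sA, sD] at h2
  -- The coefficient of `A N` is really `1 - γτ`; it is lowered to `γ(1 - τ)`.
  have h6 : γ * (1 - τ) * A N + s * (1 - γ) * D N ≤ φ 0 + s * d 0 + γ * K * Γ N := by
    have : 0 ≤ (1 - γ) * A N := mul_nonneg (by linarith) hAnn
    linarith
  have eA : ∑ k ∈ Finset.range N, (1 - γ) * γ ^ k * φ k = (1 - γ) * A N := by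
    rw [hA, Finset.mul_sum]; exact Finset.sum_congr rfl fun _ _ => by ring
  have eD : ∑ k ∈ Finset.range N, (1 - γ) * γ ^ k * d k = (1 - γ) * D N := by
    rw [hD, Finset.mul_sum]; exact Finset.sum_congr rfl fun _ _ => by ring
  have hδ : 0 ≤ (1 - γ) / γ := div_nonneg (by linarith) hγ.le
  have h7 := mul_le_mul_of_nonneg_left h6 hδ
  have h8 := mul_le_mul_of_nonneg_left hΓle hK
  rw [eA, eD]
  have e1 : (1 - γ) / γ * (γ * (1 - τ) * A N + s * (1 - γ) * D N)
      = (1 - τ) * ((1 - γ) * A N) + s * ((1 - γ) / γ) * ((1 - γ) * D N) := by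
    field_simp
  have e2 : (1 - γ) / γ * (φ 0 + s * d 0 + γ * K * Γ N)
      = (1 - γ) / γ * (φ 0 + s * d 0) + K * ((1 - γ) * Γ N) := by
    field_simp
  linarith

end Geometric

/-! ### A whole epoch in expectation, stopped at a geometric time. -/

section Epoch

variable {Ω : Type*} {mΩ : MeasurableSpace Ω} {P : Measure Ω}
variable {E : Type*} [NormedAddCommGroup E] [InnerProductSpace ℝ E] [CompleteSpace E]

lemma ne_top_of_mul_le {a x R : ℝ≥0∞} (ha : a ≠ 0) (hR : R ≠ ⊤) (h : a * x ≤ R) : x ≠ ⊤ := by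
  rintro rfl
  rw [ENNReal.mul_top ha, top_le_iff] at h
  exact hR h

/-- The inequality for a whole epoch in expectation. -/
lemma IsEpoch.expected_epoch_le [MeasurableSpace E] [BorelSpace E] [IsProbabilityMeasure P]
    {n : ℕ} {X : Set E} {f : Fin n → E → ℝ} {ψ w : E → ℝ} {xs : E} {G : E → ℝ} {L : ℝ}
    (h : IsProblem X f ψ w xs G L) (hψ : Measurable (fun x : X => ψ x))
    {g : ℝ≥0 → ℝ≥0} {C : ℝ} (hG : IsCHEF G g C) {η p q γ c₀ c₂ : ℝ} {B b : ℕ}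
    {I : Ω → Finset (Fin n)} {S : ℕ → Ω → Finset (Fin n)} {x : ℕ → Ω → E}
    {m : ℕ → MeasurableSpace Ω}
    (hE : IsEpoch P X f ψ w η B b I S x m) (hη : 0 < η) (hp : 0 < p)
    (hq : 0 < q) (hpq : p + q = 1) (hγ : 0 < γ) (hγ1 : γ < 1) (hc₀0 : 0 < c₀)
    (hc₀ : c₀ ≤ 1 / η - L)
    (hc₂ : c₂ = q / η * (1 - γ)) (hb : 0 < b) (hB : 0 < B)
    {l₁ l₂ : ℝ≥0} (hl₁ : 0 < l₁) (hd₁ : 4 * L ≤ c₀ * b * g l₁) (hl₂ : 0 < l₂) {H : ℝ≥0∞}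
    (hHt : H ≠ ⊤) (hH : B = n ∨ (3 * L ≤ c₂ * B * g l₂ ∧ H = DH f G L xs))
    (hτ : 2 * C * l₁ < 1) {N : Ω → ℕ} (hN : IsGeom P N γ)
    (hNle : MeasurableSpace.comap N ⊤ ≤ mΩ)
    (hNind : ∃ M ≤ mΩ, (∀ k, m k ≤ M) ∧ Indep (MeasurableSpace.comap N ⊤) M P)
    (hφ0 : ∫⁻ ω, ENNReal.ofReal (gap f ψ xs (x 0 ω)) ∂P ≠ ⊤)
    (hd0 : ∫⁻ ω, ENNReal.ofReal (bregman w xs (x 0 ω)) ∂P ≠ ⊤) :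
    ∫⁻ ω, ENNReal.ofReal (gap f ψ xs (x (N ω) ω)) ∂P ≠ ⊤ ∧
    ∫⁻ ω, ENNReal.ofReal (bregman w xs (x (N ω) ω)) ∂P ≠ ⊤ ∧
    (1 - 2 * C * l₁) * (∫⁻ ω, ENNReal.ofReal (gap f ψ xs (x (N ω) ω)) ∂P).toReal
        + p / η * ((1 - γ) / γ) * (∫⁻ ω, ENNReal.ofReal (bregman w xs (x (N ω) ω)) ∂P).toReal
      ≤ ((1 - γ) / γ + q + 2 * C * l₁ + 2 * (C * l₂))
          * (∫⁻ ω, ENNReal.ofReal (gap f ψ xs (x 0 ω)) ∂P).toReal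
        + p / η * ((1 - γ) / γ) * (∫⁻ ω, ENNReal.ofReal (bregman w xs (x 0 ω)) ∂P).toReal
        + C * l₂ * H.toReal := by
  have hc₂0 : 0 < c₂ := by rw [hc₂]; exact mul_pos (by positivity) (by linarith)
  have hC := hG.C_pos
  set φ : ℕ → ℝ≥0∞ := fun k => ∫⁻ ω, ENNReal.ofReal (gap f ψ xs (x k ω)) ∂P with hφdef
  set d : ℕ → ℝ≥0∞ := fun k => ∫⁻ ω, ENNReal.ofReal (bregman w xs (x k ω)) ∂P with hddef
  set v : ℕ → ℝ≥0∞ := fun k => ∫⁻ ω, ENNReal.ofReal (bregman w (x 0 ω) (x k ω)) ∂P with hvdef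
  have hv0 : v 0 = 0 := by simp [hvdef, bregman_self]
  have hstep : ∀ k, φ k ≠ ⊤ → d k ≠ ⊤ → v k ≠ ⊤ →
      φ (k + 1) + ENNReal.ofReal (p / η) * d (k + 1) + ENNReal.ofReal (q * γ / η) * v (k + 1)
      ≤ ENNReal.ofReal q * φ 0 + ENNReal.ofReal (p / η) * d k + ENNReal.ofReal (q / η) * v k
        + ENNReal.ofReal (2 * C * l₁) * (φ k + φ 0) + ENNReal.ofReal (C * l₂) * (2 * φ 0 + H) :=
    fun k h1 h2 h3 => hE.expected_step_le h hψ hG hη hp.le hq.le hpq hγ.le hc₀0 hc₀ hc₂ hc₂0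
      hb hB hl₁ hd₁ hl₂ hHt hH hφ0 hd0 h1 h2 h3
  have hRfin : ∀ k, φ k ≠ ⊤ → d k ≠ ⊤ → v k ≠ ⊤ →
      ENNReal.ofReal q * φ 0 + ENNReal.ofReal (p / η) * d k + ENNReal.ofReal (q / η) * v k
        + ENNReal.ofReal (2 * C * l₁) * (φ k + φ 0) + ENNReal.ofReal (C * l₂) * (2 * φ 0 + H)
      ≠ ⊤ := fun k h1 h2 h3 => by
    have h0 : φ 0 ≠ ⊤ := hφ0
    finiteness
  -- The step inequality needs finite expectations at `k` and returns them at `k + 1`, since all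
  -- three coefficients on its left are positive.
  have hfin : ∀ k, φ k ≠ ⊤ ∧ d k ≠ ⊤ ∧ v k ≠ ⊤ := by
    intro k
    induction k with
    | zero => exact ⟨hφ0, hd0, by rw [hv0]; exact ENNReal.zero_ne_top⟩
    | succ k ih =>
      obtain ⟨h1, h2, h3⟩ := ih
      have h4 := hstep k h1 h2 h3
      have h5 := hRfin k h1 h2 h3
      refine ⟨ne_top_of_le_ne_top h5 ((le_add_right le_self_add).trans h4),
        ne_top_of_mul_le (a := ENNReal.ofReal (p / η)) ?_ h5
          ((le_add_right le_add_self).trans h4),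
        ne_top_of_mul_le (a := ENNReal.ofReal (q * γ / η)) ?_ h5 (le_add_self.trans h4)⟩
      · simp only [ne_eq, ENNReal.ofReal_eq_zero, not_le]; positivity
      · simp only [ne_eq, ENNReal.ofReal_eq_zero, not_le]; positivity
  have hl₁' : (0 : ℝ) ≤ 2 * C * l₁ := by positivity
  have hl₂' : (0 : ℝ) ≤ C * l₂ := by positivity
  set K : ℝ := (q + 2 * C * l₁ + 2 * (C * l₂)) * (φ 0).toReal + C * l₂ * H.toReal with hK
  have hK0 : 0 ≤ K := by positivity
  have hreal : ∀ k, (φ (k + 1)).toReal + p / η * (d (k + 1)).toReal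
        + q / η * γ * (v (k + 1)).toReal
      ≤ p / η * (d k).toReal + q / η * (v k).toReal + 2 * C * l₁ * (φ k).toReal + K := by
    intro k
    obtain ⟨h1, h2, h3⟩ := hfin k
    obtain ⟨k1, k2, k3⟩ := hfin (k + 1)
    have h0 : φ 0 ≠ ⊤ := hφ0
    have h4 := ENNReal.toReal_mono (hRfin k h1 h2 h3) (hstep k h1 h2 h3)
    rw [ENNReal.toReal_add (by finiteness) (by finiteness),
      ENNReal.toReal_add (by finiteness) (by finiteness),
      ENNReal.toReal_add (by finiteness) (by finiteness),
      ENNReal.toReal_add (by finiteness) (by finiteness),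
      ENNReal.toReal_add (by finiteness) (by finiteness),
      ENNReal.toReal_add (by finiteness) (by finiteness)] at h4
    simp only [ENNReal.toReal_mul] at h4
    rw [ENNReal.toReal_add (by finiteness) (by finiteness),
      ENNReal.toReal_add (by finiteness) (by finiteness)] at h4
    simp only [ENNReal.toReal_mul, ENNReal.toReal_ofNat] at h4
    rw [ENNReal.toReal_ofReal hq.le, ENNReal.toReal_ofReal (by positivity),
      ENNReal.toReal_ofReal (by positivity), ENNReal.toReal_ofReal (by positivity),
      ENNReal.toReal_ofReal hl₁', ENNReal.toReal_ofReal hl₂'] at h4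
    have e : q / η * γ = q * γ / η := by ring
    rw [e, hK]
    linarith
  have hgeo := geometric_average_le (φ := fun k => (φ k).toReal) (d := fun k => (d k).toReal)
    (w := fun k => (v k).toReal) (fun _ => ENNReal.toReal_nonneg) (fun _ => ENNReal.toReal_nonneg)
    (fun _ => ENNReal.toReal_nonneg) (by simp [hv0]) (s := p / η) (r := q / η) (by positivity)
    (by positivity) hγ hγ1 hK0 hreal
  -- the law of the number of inner steps
  obtain ⟨M, hM, hmM, hind⟩ := hNind
  have xM : ∀ k, StronglyMeasurable[M] (x k) := fun k => (hE.x_meas k).mono (hmM (k + 1))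
  have wt : ∀ k, 0 ≤ (1 - γ) * γ ^ k := fun k =>
    mul_nonneg (by linarith) (pow_nonneg hγ.le k)
  have hφN : ∫⁻ ω, ENNReal.ofReal (gap f ψ xs (x (N ω) ω)) ∂P
      = ∑' k, ENNReal.ofReal ((1 - γ) * γ ^ k * (φ k).toReal) := by
    rw [lintegral_indep_discrete hM hNle hind
      (H := fun k ω => ENNReal.ofReal (gap f ψ xs (x k ω))) (fun k =>
        ((h.measurable_objective_comp hψ (xM k) (hE.mem k)).sub_const _).ennreal_ofReal)]
    refine tsum_congr fun k => ?_
    rw [hN k, ENNReal.ofReal_mul (wt k), ENNReal.ofReal_toReal (hfin k).1]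
  have hdN : ∫⁻ ω, ENNReal.ofReal (bregman w xs (x (N ω) ω)) ∂P
      = ∑' k, ENNReal.ofReal ((1 - γ) * γ ^ k * (d k).toReal) := by
    rw [lintegral_indep_discrete hM hNle hind
      (H := fun k ω => ENNReal.ofReal (bregman w xs (x k ω))) (fun k =>
        (measurable_bregman_comp h.conv_ψ.1 h.diff_w (@stronglyMeasurable_const _ _ M _ _) (xM k)
          (fun _ => h.mem) (hE.mem k)).ennreal_ofReal)]
    refine tsum_congr fun k => ?_
    rw [hN k, ENNReal.ofReal_mul (wt k), ENNReal.ofReal_toReal (hfin k).2.1]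
  have hδ : 0 < (1 - γ) / γ := div_pos (by linarith) hγ
  have hs : 0 < p / η * ((1 - γ) / γ) := by positivity
  have hτ' : 0 < 1 - 2 * C * l₁ := by linarith
  set R : ℝ := (1 - γ) / γ * ((φ 0).toReal + p / η * (d 0).toReal) + K with hR
  have hR0 : 0 ≤ R := by positivity
  have htot : ENNReal.ofReal (1 - 2 * C * l₁) * ∫⁻ ω, ENNReal.ofReal (gap f ψ xs (x (N ω) ω)) ∂P
      + ENNReal.ofReal (p / η * ((1 - γ) / γ))
        * ∫⁻ ω, ENNReal.ofReal (bregman w xs (x (N ω) ω)) ∂P ≤ ENNReal.ofReal R := by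
    rw [hφN, hdN, ← ENNReal.tsum_mul_left, ← ENNReal.tsum_mul_left, ← ENNReal.tsum_add]
    refine ENNReal.tsum_le_of_sum_range_le fun j => ?_
    have n1 : ∀ k, 0 ≤ (1 - γ) * γ ^ k * (φ k).toReal := fun k =>
      mul_nonneg (wt k) ENNReal.toReal_nonneg
    have n2 : ∀ k, 0 ≤ (1 - γ) * γ ^ k * (d k).toReal := fun k =>
      mul_nonneg (wt k) ENNReal.toReal_nonneg
    rw [Finset.sum_add_distrib, ← Finset.mul_sum, ← Finset.mul_sum,
      ← ENNReal.ofReal_sum_of_nonneg (fun k _ => n1 k),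
      ← ENNReal.ofReal_sum_of_nonneg (fun k _ => n2 k), ← ENNReal.ofReal_mul hτ'.le,
      ← ENNReal.ofReal_mul hs.le,
      ← ENNReal.ofReal_add (mul_nonneg hτ'.le (Finset.sum_nonneg fun k _ => n1 k))
        (mul_nonneg hs.le (Finset.sum_nonneg fun k _ => n2 k))]
    exact ENNReal.ofReal_le_ofReal (hgeo j)
  have t1 : ∫⁻ ω, ENNReal.ofReal (gap f ψ xs (x (N ω) ω)) ∂P ≠ ⊤ :=
    ne_top_of_mul_le (by simpa using hτ') ENNReal.ofReal_ne_top (le_self_add.trans htot)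
  have t2 : ∫⁻ ω, ENNReal.ofReal (bregman w xs (x (N ω) ω)) ∂P ≠ ⊤ :=
    ne_top_of_mul_le (a := ENNReal.ofReal (p / η * ((1 - γ) / γ)))
      (by simpa only [ne_eq, ENNReal.ofReal_eq_zero, not_le] using hs) ENNReal.ofReal_ne_top
      (le_add_self.trans htot)
  refine ⟨t1, t2, ?_⟩
  have h6 := ENNReal.toReal_mono ENNReal.ofReal_ne_top htot
  rw [ENNReal.toReal_add (by finiteness) (by finiteness), ENNReal.toReal_mul, ENNReal.toReal_mul,
    ENNReal.toReal_ofReal hτ'.le, ENNReal.toReal_ofReal hs.le, ENNReal.toReal_ofReal hR0] at h6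
  refine h6.trans (le_of_eq ?_)
  rw [hR, hK]
  ring

end Epoch

end SCSG

namespace SCSG

/-! ### Splitting a run into epochs: adaptedness and independence. -/

section Run

lemma Trajectory.sigma_le_biSup {Ω E : Type*} [MeasurableSpace E] {n : ℕ} (R : Trajectory Ω E n) {S : Set Source} {s : Source} (hs : s ∈ S) :
    R.sigma s ≤ ⨆ s ∈ S, R.sigma s :=
  le_biSup R.sigma hs

variable {Ω : Type*} {mΩ : MeasurableSpace Ω} {P : Measure Ω}
variable {E : Type*} [NormedAddCommGroup E] [InnerProductSpace ℝ E] [CompleteSpace E]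
  [MeasurableSpace E]
variable {n : ℕ} {X : Set E} {f : Fin n → E → ℝ} {ψ w : E → ℝ} {T : ℕ} {η : ℕ → ℝ} {B b : ℕ → ℕ}
  {ms : ℕ → ℝ} {R : Trajectory Ω E n}

/-- The sources that have been used before epoch `j`. -/
def usedBeforeEpoch (j : ℕ) : Source → Prop
  | .init => True
  | .outer i => i < j
  | .len i => i < j
  | .inner i _ => i < j

/-- The information available in epoch `j`: before the batch is drawn for the index `0`, and when
`x_k` has been computed for the index `k + 1`. -/
@[reducible] def Trajectory.info (R : Trajectory Ω E n) (j : ℕ) : ℕ → MeasurableSpace Ω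
  | 0 => ⨆ s ∈ {s | usedBeforeEpoch j s}, R.sigma s
  | k + 1 => R.past j k

lemma IsRun.x_mem (hR : IsRun P X f ψ w T η B ms b R) {j : ℕ} (hj : j ≤ T) :
    (∀ ω, R.xt j ω ∈ X) ∧ (1 ≤ j → ∀ k ω, R.x j k ω ∈ X) := by
  induction j with
  | zero => exact ⟨hR.init_mem, fun h => absurd h (by norm_num)⟩
  | succ j ih =>
    have h1 : ∀ k ω, R.x (j + 1) k ω ∈ X := by
      intro k ω
      cases k with
      | zero =>
        rw [hR.start (j + 1) ω (by omega) hj]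
        exact (ih (by omega)).1 ω
      | succ k => exact (hR.step (j + 1) k ω (by omega) hj).1
    exact ⟨fun ω => by rw [hR.final (j + 1) ω (by omega) hj]; exact h1 _ ω, fun _ => h1⟩

lemma IsRun.indep_sigma (hR : IsRun P X f ψ w T η B ms b R) {s : Source} {S : Set Source}
    (hs : s ∉ S) : Indep (R.sigma s) (⨆ s ∈ S, R.sigma s) P := by
  have := indep_iSup_of_disjoint hR.measurable hR.indep
    (Set.disjoint_singleton_left.2 hs)
  rwa [iSup_singleton] at this

lemma IsRun.xt_stronglyMeasurable [BorelSpace E] (hR : IsRun P X f ψ w T η B ms b R) {j : ℕ}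
    (hj : j ≤ T) : StronglyMeasurable[R.info (j + 1) 0] (R.xt j) := by
  rcases Nat.eq_zero_or_pos j with rfl | hj0
  · refine stronglyMeasurable_iff_measurable_separable.2 ⟨?_, hR.init_meas.isSeparable_range⟩
    exact (comap_measurable (R.xt 0)).mono
      (R.sigma_le_biSup (S := {s | usedBeforeEpoch (0 + 1) s}) (s := .init) trivial) le_rfl
  · have hle : ∀ k, R.past j k ≤ R.info (j + 1) 0 := fun k =>
      biSup_mono fun s hs => by
        cases s <;> simp only [Set.mem_ofPred_eq, usedBefore, usedBeforeEpoch] at hs ⊢ <;> omega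
    have hx : ∀ k, StronglyMeasurable[R.info (j + 1) 0] (R.x j k) := fun k =>
      (hR.adapted j k hj0 hj).mono (hle k)
    have e : R.xt j = fun ω => R.x j (R.len j ω) ω := funext fun ω => hR.final j ω hj0 hj
    rw [e]
    refine stronglyMeasurable_iff_measurable_separable.2 ⟨?_, ?_⟩
    · refine measurable_discrete (mΩ := R.info (j + 1) 0) ?_ fun k => (hx k).measurable
      exact R.sigma_le_biSup (S := {s | usedBeforeEpoch (j + 1) s}) (s := .len j)
        (Nat.lt_succ_self j)
    -- The space may be nonseparable. The range of the stopped iterate lies in the countable union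
    -- of the separable ranges of the inner iterates.
    · refine (TopologicalSpace.IsSeparable.iUnion fun k => (hx k).isSeparable_range).mono ?_
      rintro _ ⟨ω, rfl⟩
      exact Set.mem_iUnion.2 ⟨R.len j ω, ω, rfl⟩

/-- Each epoch of a run is an epoch. -/
lemma IsRun.isEpoch [BorelSpace E] (hR : IsRun P X f ψ w T η B ms b R) {j : ℕ} (hj : j + 1 ≤ T) :
    IsEpoch P X f ψ w (η (j + 1)) (B (j + 1)) (b (j + 1)) (R.outer (j + 1)) (R.inner (j + 1))
      (R.x (j + 1)) (R.info (j + 1)) := by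
  have h1 : 1 ≤ j + 1 := by omega
  have hstart : R.x (j + 1) 0 = R.xt j := funext fun ω => hR.start (j + 1) ω h1 hj
  refine
    { le := fun k => ?_
      zero_le := fun k => ?_
      I_le := hR.measurable (.outer (j + 1))
      S_le := fun k => hR.measurable (.inner (j + 1) k)
      indep_I := hR.indep_sigma (s := .outer (j + 1)) (S := {s | usedBeforeEpoch (j + 1) s})
        (lt_irrefl (j + 1))
      indep_S := fun k => hR.indep_sigma (s := .inner (j + 1) k)
        (S := {s | usedBefore (j + 1) k s}) ?_
      x_zero := ?_
      x_meas := fun k => hR.adapted (j + 1) k h1 hj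
      mem := (hR.x_mem hj).2 h1
      unif_I := hR.outer_law (j + 1) h1 hj
      unif_S := fun k => hR.inner_law (j + 1) k h1 hj
      step := fun k ω => ?_ }
  · cases k with
    | zero => exact iSup₂_le fun s _ => hR.measurable s
    | succ k => exact iSup₂_le fun s _ => hR.measurable s
  · cases k with
    | zero => exact le_rfl
    | succ k =>
      refine biSup_mono fun s hs => ?_
      cases s <;> simp only [Set.mem_ofPred_eq, usedBefore, usedBeforeEpoch] at hs ⊢ <;> omega
  · simp [usedBefore]
  · rw [hstart]; exact hR.xt_stronglyMeasurable (by omega)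
  · have := hR.step (j + 1) k ω h1 hj
    rwa [Nat.add_sub_cancel, ← hstart] at this

/-- The σ-algebra generated by every source except the length of epoch `j` contains all the inner
iterates of that epoch at once, as needed to stop them at `N_j`. -/
lemma IsRun.len_indep (hR : IsRun P X f ψ w T η B ms b R) (j : ℕ) :
    ∃ M ≤ mΩ, (∀ k, R.info j k ≤ M) ∧
      Indep (MeasurableSpace.comap (R.len j) ⊤) M P := by
  refine ⟨⨆ s ∈ {s | s ≠ Source.len j}, R.sigma s, iSup₂_le fun s _ => hR.measurable s,
    fun k => ?_, hR.indep_sigma (s := .len j) fun h => h rfl⟩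
  cases k with
  | zero =>
    refine biSup_mono fun s hs => ?_
    rintro rfl
    exact lt_irrefl j hs
  | succ k =>
    refine biSup_mono fun s hs => ?_
    rintro rfl
    exact lt_irrefl j hs

end Run

/-! ### Elementary inequalities behind the two contraction rates. -/

section Numerics

/-- With `t = 1/A` the left side is at most `(119/120) t - t²/5` and the right side is `t - t²/6`.
It is applied with `u = b/m` and `v = C/m`; the second summand is the mixture weight `q`, and the
last one is slack reserved for the fast regime. -/
lemma mixture_coefficient_le {A u v : ℝ} (hA : 1 ≤ A) (hu : 4 * A * u ≤ 1) (hv : 16 * A * v ≤ 1) :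
    u + (4 * A + 1) / (20 * A ^ 2) + 1 / (6 * A) + 2 * v + (1 / (4 * A)) * (1 - 1 / A)
      ≤ (1 / A) * (1 - 1 / (6 * A)) := by
  have hA0 : 0 < A := by linarith
  have hu' : u ≤ 1 / (4 * A) := by rw [le_div_iff₀ (by positivity)]; linarith
  have hv' : v ≤ 1 / (16 * A) := by rw [le_div_iff₀ (by positivity)]; linarith
  set t := 1 / A with ht
  have ht1 : t ≤ 1 := by rw [ht, div_le_one hA0]; exact hA
  have ht0 : 0 < t := by positivity
  have e1 : 1 / (4 * A) = t / 4 := by rw [ht]; field_simp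
  have e2 : 1 / (16 * A) = t / 16 := by rw [ht]; field_simp
  have e3 : 1 / (6 * A) = t / 6 := by rw [ht]; field_simp
  have e4 : (4 * A + 1) / (20 * A ^ 2) = t / 5 + t ^ 2 / 20 := by rw [ht]; field_simp; ring
  rw [e1] at hu' ⊢
  rw [e2] at hv'
  rw [e3, e4]
  nlinarith [mul_nonneg ht0.le (sub_nonneg.2 ht1)]

/-- The contraction of the Lyapunov function over an epoch, with an abstract rate `r`. -/
lemma contraction_le {A α a v s Φ D Φ' D' H σ r : ℝ} (hA : 1 ≤ A) (ha : 0 < a)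
    (hv : 16 * A * v * a ≤ 1) (hH : 0 ≤ H)
    (h : (1 - 1 / (6 * A)) * Φ' + s * D' ≤ σ * Φ + s * D + v * H)
    (hr : σ * Φ + s * D ≤ r * ((1 - 1 / (6 * A)) * Φ + α * s * D)) :
    Φ' + s / (1 - 1 / (6 * A)) * D'
      ≤ r * (Φ + α * (s / (1 - 1 / (6 * A))) * D) + a⁻¹ * (H / 6) := by
  have hA0 : 0 < A := by linarith
  have h56 : 5 / 6 ≤ 1 - 1 / (6 * A) := by
    have : 1 / (6 * A) ≤ 1 / 6 := one_div_le_one_div_of_le (by norm_num) (by linarith)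
    linarith
  set c := 1 - 1 / (6 * A)
  have hc : 0 < c := by linarith
  have hva : 16 * v ≤ a⁻¹ := by
    rw [← one_div, le_div_iff₀ ha]
    by_cases hv0 : 0 ≤ v
    · have := mul_le_mul_of_nonneg_right hA (mul_nonneg hv0 ha.le)
      linarith
    · have := mul_nonneg (neg_nonneg.2 (not_le.1 hv0).le) ha.le
      linarith
  have hai : 0 < a⁻¹ := inv_pos.2 ha
  have hvc : v ≤ c * (a⁻¹ / 6) := by
    have : 5 / 6 * (a⁻¹ / 6) ≤ c * (a⁻¹ / 6) := by gcongr
    linarith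
  have hvH : v * H ≤ c * (a⁻¹ / 6) * H := by gcongr
  have e1 : Φ' + s / c * D' = (c * Φ' + s * D') / c := by field_simp
  have e2 : r * (Φ + α * (s / c) * D) + a⁻¹ * (H / 6)
      = (r * (c * Φ + α * s * D) + c * (a⁻¹ / 6) * H) / c := by field_simp
  rw [e1, e2]
  exact div_le_div_of_nonneg_right (by linarith) hc.le

/-- The distance term is reproduced exactly, since its coefficient was enlarged by `α`; only the gap
needs to contract, and the slack is dropped. -/
lemma slow_rate_le {A α σ s Φ D : ℝ} (hα : 1 < α) (hαA : α ≤ A) (hΦ : 0 ≤ Φ)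
    (hσ : σ + (1 / (4 * A)) * (1 - 1 / A) ≤ (1 / A) * (1 - 1 / (6 * A))) :
    σ * Φ + s * D ≤ α⁻¹ * ((1 - 1 / (6 * A)) * Φ + α * s * D) := by
  have hα0 : 0 < α := by linarith
  have hA0 : 0 < A := by linarith
  have h1 : 1 / A ≤ α⁻¹ := by rw [one_div]; exact inv_anti₀ hα0 hαA
  have h2 : 1 / A ≤ 1 := by rw [div_le_one hA0]; linarith
  have h3 : 1 / (6 * A) ≤ 1 := by rw [div_le_one (by positivity)]; linarith
  have h4 : 0 ≤ (1 / (4 * A)) * (1 - 1 / A) := mul_nonneg (by positivity) (by linarith)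
  have h5 : (1 / A) * (1 - 1 / (6 * A)) ≤ α⁻¹ * (1 - 1 / (6 * A)) := by
    gcongr
  have h6 : σ * Φ ≤ α⁻¹ * (1 - 1 / (6 * A)) * Φ := by gcongr; linarith
  have e : α⁻¹ * (α * s * D) = s * D := by field_simp
  rw [mul_add, e, ← mul_assoc]
  linarith

/-- At rate `1/A` only the fraction `α/A` of the distance term is reproduced. The remaining fraction
is converted into gap by `hD`, at a cost of at most `(1/(4A))(1 - 1/A)`, which is the reserved
slack. -/
lemma fast_rate_le {A α σ s Φ D : ℝ} (hα : 1 < α) (hαA : α ≤ A) (hΦ : 0 ≤ Φ)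
    (hσ : σ + (1 / (4 * A)) * (1 - 1 / A) ≤ (1 / A) * (1 - 1 / (6 * A)))
    (hD : s * D ≤ 1 / (4 * A) * Φ) :
    σ * Φ + s * D ≤ A⁻¹ * ((1 - 1 / (6 * A)) * Φ + α * s * D) := by
  have hA0 : 0 < A := by linarith
  have h1 : α * A⁻¹ ≤ 1 := by rw [← div_eq_mul_inv, div_le_one hA0]; exact hαA
  have h2 : A⁻¹ ≤ α * A⁻¹ := le_mul_of_one_le_left (by positivity) hα.le
  have h3 := mul_le_mul_of_nonneg_left hD (sub_nonneg.2 h1)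
  have h4 : (1 - α * A⁻¹) * (1 / (4 * A) * Φ) ≤ (1 - A⁻¹) * (1 / (4 * A) * Φ) := by
    gcongr
  have h5 := mul_le_mul_of_nonneg_right hσ hΦ
  rw [one_div A] at h5
  linarith

end Numerics

/-! ### Batch sizes, the time at which batches become full, and rate products. -/

section Parameters

variable {E : Type*} [NormedAddCommGroup E] [InnerProductSpace ℝ E]
  [MeasurableSpace E]

/-- Because the generalized inverse tends to zero, some positive level `l` is already reached by `g`
before `t`. -/
lemma IsCHEF.g_pos {G : E → ℝ} {g : ℝ≥0 → ℝ≥0} {C : ℝ} (hG : IsCHEF G g C) {t : ℝ≥0}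
    (ht : 0 < t) : 0 < g t := by
  have h1 : ∀ᶠ l in 𝓝[>] (0 : ℝ≥0), genInv g l < t :=
    (hG.g_inv.eventually (gt_mem_nhds (by exact_mod_cast ht))).filter_mono nhdsWithin_le_nhds
  obtain ⟨l, hl, hl0⟩ := (h1.and self_mem_nhdsWithin).exists
  simp only [genInv, iInf_lt_iff] at hl
  obtain ⟨s, hs, hst⟩ := hl
  exact (lt_of_lt_of_le hl0 hs).trans_le (hG.g_mono (by exact_mod_cast hst.le))

variable {G : E → ℝ} {g : ℝ≥0 → ℝ≥0} {C α m₀ ξ : ℝ} {n : ℕ}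

lemma innerSize_pos (hα : 1 < α) (hm₀ : 0 < m₀) (t : ℝ) : 0 < innerSize m₀ α t :=
  mul_pos hm₀ (Real.rpow_pos_of_pos (by linarith) t)

lemma IsCHEF.g_toNNReal_pos (hG : IsCHEF G g C) {t : ℝ} (ht : 0 < t) :
    (0 : ℝ) < g (Real.toNNReal t) := by
  exact_mod_cast hG.g_pos (Real.toNNReal_pos.2 ht)

lemma IsCHEF.batchReal_pos (hG : IsCHEF G g C) (hα : 1 < α) (hm₀ : 0 < m₀) (t : ℝ) :
    0 < batchReal g C α m₀ ξ t := by
  have hm := innerSize_pos hα hm₀ t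
  have hA : 0 < α ^ (1 / ξ) := Real.rpow_pos_of_pos (by linarith) _
  have hC := hG.C_pos
  have h1 := hG.g_toNNReal_pos (t := 1 / (12 * C * α ^ (1 / ξ))) (by positivity)
  have h2 := hG.g_toNNReal_pos (t := 1 / innerSize m₀ α t) (by positivity)
  unfold batchReal
  positivity

lemma IsCHEF.batchReal_mono (hG : IsCHEF G g C) (hα : 1 < α) (hm₀ : 0 < m₀) :
    Monotone (batchReal g C α m₀ ξ) := by
  intro s t hst
  have hA : 0 < α ^ (1 / ξ) := Real.rpow_pos_of_pos (by linarith) _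
  have hms := innerSize_pos hα hm₀ s
  have hmt := innerSize_pos hα hm₀ t
  have hm : innerSize m₀ α s ≤ innerSize m₀ α t :=
    mul_le_mul_of_nonneg_left (Real.rpow_le_rpow_of_exponent_le hα.le hst) hm₀.le
  have h2 := hG.g_toNNReal_pos (t := 1 / innerSize m₀ α t)
    (one_div_pos.2 (innerSize_pos hα hm₀ t))
  have h3 : (g (Real.toNNReal (1 / innerSize m₀ α t)) : ℝ)
      ≤ g (Real.toNNReal (1 / innerSize m₀ α s)) := by
    exact_mod_cast hG.g_mono (Real.toNNReal_le_toNNReal (one_div_le_one_div_of_le hms hm))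
  unfold batchReal
  gcongr

/-- Monotonicity of `g` gives growth by at least `α ^ k`. Without this the infimum defining `Tn`
could be over the empty set and take the default value `0`. -/
lemma IsCHEF.exists_le_batchReal (hG : IsCHEF G g C) (hα : 1 < α) (hm₀ : 0 < m₀) (N : ℝ) :
    ∃ t : ℝ, 0 ≤ t ∧ N ≤ batchReal g C α m₀ ξ t := by
  have hα0 : 0 < α := by linarith
  have hb0 := hG.batchReal_pos (ξ := ξ) hα hm₀ 0
  obtain ⟨k, hk⟩ := pow_unbounded_of_one_lt (N / batchReal g C α m₀ ξ 0) hα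
  refine ⟨k, k.cast_nonneg, ?_⟩
  have hA : 0 < α ^ (1 / ξ) := Real.rpow_pos_of_pos (by linarith) _
  have hm0 := innerSize_pos hα hm₀ 0
  have hm : innerSize m₀ α 0 ≤ innerSize m₀ α k :=
    mul_le_mul_of_nonneg_left (Real.rpow_le_rpow_of_exponent_le hα.le k.cast_nonneg) hm₀.le
  have h2 := hG.g_toNNReal_pos (t := 1 / innerSize m₀ α k)
    (one_div_pos.2 (innerSize_pos hα hm₀ k))
  have h3 : (g (Real.toNNReal (1 / innerSize m₀ α k)) : ℝ)
      ≤ g (Real.toNNReal (1 / innerSize m₀ α 0)) := by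
    exact_mod_cast hG.g_mono (Real.toNNReal_le_toNNReal (one_div_le_one_div_of_le hm0 hm))
  have h4 : innerSize m₀ α k = α ^ k * innerSize m₀ α 0 := by
    simp only [innerSize, Real.rpow_natCast, Real.rpow_zero]; ring
  have hmk := innerSize_pos hα hm₀ k
  calc N ≤ α ^ k * batchReal g C α m₀ ξ 0 := by
        rw [div_lt_iff₀ hb0] at hk; exact hk.le
    _ = 5 * α ^ (1 / ξ) / 2 * (g (Real.toNNReal (1 / (12 * C * α ^ (1 / ξ)))) : ℝ) *
        (innerSize m₀ α k / (g (Real.toNNReal (1 / innerSize m₀ α 0)) : ℝ)) := by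
        rw [h4, batchReal]; ring
    _ ≤ batchReal g C α m₀ ξ k := by
        unfold batchReal
        gcongr

lemma IsCHEF.le_Tn (hG : IsCHEF G g C) (hα : 1 < α) (hm₀ : 0 < m₀) {t : ℝ}
    (ht : batchReal g C α m₀ ξ t < n) : t ≤ Tn g n C α m₀ ξ := by
  refine le_csInf ?_ fun s hs => ?_
  · exact hG.exists_le_batchReal hα hm₀ n
  · by_contra hst
    exact absurd (hs.2.trans (hG.batchReal_mono hα hm₀ (not_le.1 hst).le)) (not_le.2 ht)

lemma Tn_nonneg : 0 ≤ Tn g n C α m₀ ξ := Real.sInf_nonneg fun _ h => h.1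

lemma batchReal_lt_of_batchSize_ne {j : ℕ} (h : batchSize g n C α m₀ ξ j ≠ n) :
    batchReal g C α m₀ ξ j < n := by
  by_contra hle
  exact h (by rw [batchSize, min_eq_right (not_lt.1 hle), Nat.ceil_natCast])

lemma batchReal_le_batchSize_of_ne {j : ℕ} (h : batchSize g n C α m₀ ξ j ≠ n) :
    batchReal g C α m₀ ξ j ≤ batchSize g n C α m₀ ξ j := by
  have h1 : batchReal g C α m₀ ξ j = min (batchReal g C α m₀ ξ j) n :=
    (min_eq_left (batchReal_lt_of_batchSize_ne h).le).symm
  calc batchReal g C α m₀ ξ j = min (batchReal g C α m₀ ξ j) n := h1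
    _ ≤ _ := Nat.le_ceil _

lemma IsCHEF.batchSize_pos (hG : IsCHEF G g C) (hα : 1 < α) (hm₀ : 0 < m₀) (hn : 0 < n) (j : ℕ) :
    0 < batchSize g n C α m₀ ξ j :=
  Nat.ceil_pos.2 (lt_min (hG.batchReal_pos hα hm₀ j) (by exact_mod_cast hn))

open Classical in
lemma rateProd_succ (α ξ : ℝ) (S : EReal) (T : ℕ) :
    rateProd α ξ S (T + 1)
      = rateProd α ξ S T * if ((((T + 1 : ℕ) : ℝ)) : EReal) ≤ S then α else α ^ (1 / ξ) := by
  simp only [rateProd]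
  rw [Finset.prod_Icc_succ_top (by omega)]

lemma rateProd_pos (hα : 1 < α) (S : EReal) (T : ℕ) : 0 < rateProd α ξ S T := by
  refine Finset.prod_pos fun j _ => ?_
  split_ifs
  · linarith
  · exact Real.rpow_pos_of_pos (by linarith) _

lemma rateProd_eq_pow {S : EReal} {T : ℕ} (h : (((T : ℝ)) : EReal) ≤ S) :
    rateProd α ξ S T = α ^ T := by
  rw [rateProd, Finset.prod_congr rfl fun j hj => if_pos (le_trans ?_ h), Finset.prod_const,
    Nat.card_Icc, Nat.add_sub_cancel]
  have := (Finset.mem_Icc.1 ‹_›).2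
  exact_mod_cast this

end Parameters

end SCSG

namespace SCSG

/-! ### Accuracy of the chosen batches and iteration of the contraction. -/

section Parameters

variable {E : Type*} [NormedAddCommGroup E] [InnerProductSpace ℝ E] [MeasurableSpace E]
variable {G : E → ℝ} {L : ℝ} {n : ℕ} {g : ℝ≥0 → ℝ≥0} {C α m₀ ξ η : ℝ} {b : ℕ}

/-- The choice of the batch sizes makes the batch gradient accurate enough. -/
lemma three_mul_le_of_batchSize_ne (hG : IsCHEF G g C) (hα : 1 < α) (hm₀ : 0 < m₀) (hL : 0 < L)
    {A κ m q : ℝ} {j : ℕ} (hA : A = α ^ (1 / ξ)) (hA1 : 1 ≤ A)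
    (hκ : κ = g (Real.toNNReal (1 / (12 * C * A)))) (hm : m = innerSize m₀ α j)
    (hmb : 4 * A * b ≤ m) (hη : 0 < η) (hηL : 6 * η * L ≤ κ * b)
    (hq : q = (4 * A + 1) / (20 * A ^ 2)) (hB : batchSize g n C α m₀ ξ j ≠ n) :
    3 * L ≤ q / η * (b / (m + b)) * (batchSize g n C α m₀ ξ j)
      * g (Real.toNNReal (1 / m)) := by
  have hm0 : 0 < m := hm ▸ innerSize_pos hα hm₀ j
  have hgm := hG.g_toNNReal_pos (t := 1 / m) (by positivity)
  have hq0 : 0 < q := by rw [hq]; positivity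
  have h1 : 5 * A / 2 * κ * m
      ≤ (batchSize g n C α m₀ ξ j) * g (Real.toNNReal (1 / m)) := by
    have h2 := batchReal_le_batchSize_of_ne hB
    rw [batchReal, ← hA, ← hκ, ← hm] at h2
    calc 5 * A / 2 * κ * m = 5 * A / 2 * κ * (m / g (Real.toNNReal (1 / m)))
          * g (Real.toNNReal (1 / m)) := by field_simp
      _ ≤ _ := by gcongr
  -- The value of `q` comes from here: `15 A q = 3 (1 + 1/(4A))`, exactly what `b ≤ m/(4A)`
  -- requires.
  have h3 : 3 * L * (m + b) ≤ 15 * A * q * L * m := by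
    rw [hq]
    have e : 15 * A * ((4 * A + 1) / (20 * A ^ 2)) * L * m = 3 * L * (m * (4 * A + 1) / (4 * A)) := by
      field_simp; ring
    rw [e]
    refine mul_le_mul_of_nonneg_left ?_ (by positivity)
    rw [le_div_iff₀ (by positivity)]
    linarith
  calc 3 * L ≤ 15 * A * q * L * m / (m + b) := by rw [le_div_iff₀ (by positivity)]; exact h3
    _ = q / η * (1 / (m + b)) * (5 * A / 2 * (6 * η * L) * m) := by field_simp; ring
    _ ≤ q / η * (1 / (m + b)) * (5 * A / 2 * (κ * b) * m) := by gcongr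
    _ = q / η * (b / (m + b)) * (5 * A / 2 * κ * m) := by ring
    _ ≤ q / η * (b / (m + b)) * ((batchSize g n C α m₀ ξ j) * g (Real.toNNReal (1 / m))) := by
        gcongr
    _ = _ := by ring

/-- The convergence of the Lyapunov function, from the contraction over the epochs. -/
lemma lyapunov_le (hG : IsCHEF G g C) (hα : 1 < α) (hm₀ : 0 < m₀) (hξ₀ : 0 < ξ) (hξ₁ : ξ < 1)
    {S : EReal} {V : ℕ → ℝ} {K : ℝ} (hK : 0 ≤ K) (T : ℕ)
    (hV : ∀ j, j + 1 ≤ T → V (j + 1)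
      ≤ (if ((((j + 1 : ℕ) : ℝ)) : EReal) ≤ S then α else α ^ (1 / ξ))⁻¹ * V j
        + if batchSize g n C α m₀ ξ (j + 1) = n then 0 else (α ^ (j + 1))⁻¹ * K) :
    V T ≤ (rateProd α ξ S T)⁻¹ * V 0
      + (rateProd α ξ (max ((Tn g n C α m₀ ξ : ℝ) : EReal) S) T)⁻¹ * K
        * min (T : ℝ) (Tn g n C α m₀ ξ) := by
  set τ := Tn g n C α m₀ ξ with hτ
  have hτ0 : 0 ≤ τ := Tn_nonneg
  induction T with
  | zero => simp [rateProd, min_eq_left hτ0]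
  | succ T ih =>
    have h1 := hV T le_rfl
    have h2 := ih fun j hj => hV j (by omega)
    have hα0 : 0 < α := by linarith
    have hA0 : 0 < α ^ (1 / ξ) := Real.rpow_pos_of_pos hα0 _
    have hαA : α ≤ α ^ (1 / ξ) := by
      conv_lhs => rw [← Real.rpow_one α]
      exact Real.rpow_le_rpow_of_exponent_le hα.le (by rw [le_div_iff₀ hξ₀]; linarith)
    have hp1 := rateProd_pos (ξ := ξ) hα (max (τ : EReal) S) T
    rw [rateProd_succ α ξ S]
    set l : ℝ := if ((((T + 1 : ℕ) : ℝ)) : EReal) ≤ S then α else α ^ (1 / ξ) with hl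
    have hl0 : 0 < l := by rw [hl]; split_ifs <;> assumption
    -- The noise product switches to the larger factor no earlier than the main one, so old noise
    -- decays at least as fast as claimed.
    have hll : (rateProd α ξ (max (τ : EReal) S) (T + 1)) ≤ rateProd α ξ (max (τ : EReal) S) T * l := by
      rw [rateProd_succ]
      gcongr
      rw [hl]
      split_ifs with c1 c2 c2
      · exact le_rfl
      · exact hαA
      · exact absurd (le_max_of_le_right c2) c1
      · exact le_rfl
    have hp2 := rateProd_pos (ξ := ξ) hα (max (τ : EReal) S) (T + 1)
    have hinv : l⁻¹ * (rateProd α ξ (max (τ : EReal) S) T)⁻¹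
        ≤ (rateProd α ξ (max (τ : EReal) S) (T + 1))⁻¹ := by
      rw [← mul_inv, mul_comm]
      exact inv_anti₀ hp2 hll
    have hmin0 : 0 ≤ min (T : ℝ) τ := le_min T.cast_nonneg hτ0
    have h3 := mul_le_mul_of_nonneg_left h2 (inv_nonneg.2 hl0.le)
    have h4 : l⁻¹ * ((rateProd α ξ (max (τ : EReal) S) T)⁻¹ * K * min (T : ℝ) τ)
        ≤ (rateProd α ξ (max (τ : EReal) S) (T + 1))⁻¹ * K * min (T : ℝ) τ := by
      rw [mul_assoc (rateProd α ξ (max (τ : EReal) S) T)⁻¹, ← mul_assoc l⁻¹,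
        mul_assoc (rateProd α ξ (max (τ : EReal) S) (T + 1))⁻¹]
      exact mul_le_mul_of_nonneg_right hinv (mul_nonneg hK hmin0)
    -- Fresh noise appears only if `T + 1 ≤ τ`. Then every factor so far equals `α`, so the noise is
    -- exactly one more unit of the product, and the minimum increases by one.
    have h5 : (if batchSize g n C α m₀ ξ (T + 1) = n then 0 else (α ^ (T + 1))⁻¹ * K)
        + (rateProd α ξ (max (τ : EReal) S) (T + 1))⁻¹ * K * min (T : ℝ) τ
        ≤ (rateProd α ξ (max (τ : EReal) S) (T + 1))⁻¹ * K * min ((T + 1 : ℕ) : ℝ) τ := by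
      have hc : 0 ≤ (rateProd α ξ (max (τ : EReal) S) (T + 1))⁻¹ * K :=
        mul_nonneg (inv_nonneg.2 hp2.le) hK
      split_ifs with hB
      · rw [zero_add]
        refine mul_le_mul_of_nonneg_left (min_le_min_right _ ?_) hc
        push_cast; linarith
      · have hTτ : ((T + 1 : ℕ) : ℝ) ≤ τ := hG.le_Tn hα hm₀ (batchReal_lt_of_batchSize_ne hB)
        have hTτ' : (T : ℝ) ≤ τ := by push_cast at hTτ; linarith
        have he : rateProd α ξ (max (τ : EReal) S) (T + 1) = α ^ (T + 1) :=
          rateProd_eq_pow (le_max_of_le_left (by exact_mod_cast hTτ))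
        rw [min_eq_left hTτ, min_eq_left hTτ', he]
        push_cast
        linarith
    have e : (rateProd α ξ S T * l)⁻¹ * V 0 = l⁻¹ * ((rateProd α ξ S T)⁻¹ * V 0) := by
      rw [mul_inv]; ring
    rw [e]
    linarith

end Parameters

/-! ### One epoch with the parameters of the theorem, and the conclusion. -/

section Final

variable {Ω : Type*} {mΩ : MeasurableSpace Ω} {P : Measure Ω} [IsProbabilityMeasure P]
variable {E : Type*} [NormedAddCommGroup E] [InnerProductSpace ℝ E] [CompleteSpace E]
  [MeasurableSpace E] [BorelSpace E]
variable {n : ℕ} {X : Set E} {f : Fin n → E → ℝ} {ψ w : E → ℝ} {xs : E} {G : E → ℝ} {L : ℝ}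
  {g : ℝ≥0 → ℝ≥0} {C α m₀ ξ η : ℝ} {b T : ℕ} {R : Trajectory Ω E n}

/-- The expected inequality for an epoch of the run, with the parameters of the theorem. -/
lemma IsRun.epoch_le (h : IsProblem X f ψ w xs G L) (hψ : Measurable (fun x : X => ψ x))
    (hG : IsCHEF G g C) (hα : 1 < α) (hm₀ : 0 < m₀) (hη : 0 < η) {A κ m q : ℝ}
    (hA : A = α ^ (1 / ξ)) (hA1 : 1 ≤ A)
    (hκ : κ = g (Real.toNNReal (1 / (12 * C * A)))) {j : ℕ} (hm : m = innerSize m₀ α (j + 1 : ℕ))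
    (hmb : 4 * A * b ≤ m) (hηL : 6 * η * L ≤ 1) (hηκ : 6 * η * L ≤ κ * b)
    (hq : q = (4 * A + 1) / (20 * A ^ 2))
    (hR : IsRun P X f ψ w T (fun _ => η) (batchSize g n C α m₀ ξ)
      (fun j => innerSize m₀ α j) (fun _ => b) R) (hj : j + 1 ≤ T) {H : ℝ≥0∞} (hH : H ≠ ⊤)
    (hHB : batchSize g n C α m₀ ξ (j + 1) = n ∨ H = DH f G L xs)
    (hφ : ∫⁻ ω, ENNReal.ofReal (gap f ψ xs (R.xt j ω)) ∂P ≠ ⊤)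
    (hd : ∫⁻ ω, ENNReal.ofReal (bregman w xs (R.xt j ω)) ∂P ≠ ⊤) :
    ∫⁻ ω, ENNReal.ofReal (gap f ψ xs (R.xt (j + 1) ω)) ∂P ≠ ⊤ ∧
    ∫⁻ ω, ENNReal.ofReal (bregman w xs (R.xt (j + 1) ω)) ∂P ≠ ⊤ ∧
    (1 - 1 / (6 * A)) * (∫⁻ ω, ENNReal.ofReal (gap f ψ xs (R.xt (j + 1) ω)) ∂P).toReal
        + (1 - q) / η * (b / m)
          * (∫⁻ ω, ENNReal.ofReal (bregman w xs (R.xt (j + 1) ω)) ∂P).toReal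
      ≤ (b / m + q + 1 / (6 * A) + 2 * (C / m))
          * (∫⁻ ω, ENNReal.ofReal (gap f ψ xs (R.xt j ω)) ∂P).toReal
        + (1 - q) / η * (b / m) * (∫⁻ ω, ENNReal.ofReal (bregman w xs (R.xt j ω)) ∂P).toReal
        + C / m * H.toReal := by
  have hL := h.L_pos
  have hC := hG.C_pos
  have hm0 : 0 < m := hm ▸ innerSize_pos hα hm₀ _
  have hκ0 : 0 < κ := hκ ▸ hG.g_toNNReal_pos (by positivity)
  -- The stepsize condition rules out an empty mini-batch.
  have hb : (0 : ℝ) < b := by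
    by_contra hb
    have : κ * b ≤ 0 := mul_nonpos_of_nonneg_of_nonpos hκ0.le (not_lt.1 hb)
    have : 0 < 6 * η * L := by positivity
    linarith
  have hq0 : 0 < q := by rw [hq]; positivity
  have hq1 : q < 1 := by
    rw [hq, div_lt_one (by positivity)]
    nlinarith
  have hE := hR.isEpoch hj
  have e1 : 1 - m / (m + b) = b / (m + b) := by field_simp; ring
  have e2 : (1 - m / (m + b)) / (m / (m + b)) = b / m := by rw [e1]; field_simp
  have hl₁ : ((Real.toNNReal (1 / (12 * C * A)) : ℝ≥0) : ℝ) = 1 / (12 * C * A) :=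
    Real.coe_toNNReal _ (by positivity)
  have hl₂ : ((Real.toNNReal (1 / m) : ℝ≥0) : ℝ) = 1 / m := Real.coe_toNNReal _ (by positivity)
  have e3 : 2 * C * (1 / (12 * C * A)) = 1 / (6 * A) := by field_simp; norm_num
  have e4 : C * (1 / m) = C / m := by ring
  have hstart : R.x (j + 1) 0 = R.xt j := funext fun ω => hR.start (j + 1) ω (by omega) hj
  have hfinal : ∀ ω, R.x (j + 1) (R.len (j + 1) ω) ω = R.xt (j + 1) ω := fun ω =>
    (hR.final (j + 1) ω (by omega) hj).symm
  have hc₀ : 5 / (6 * η) ≤ 1 / η - L := by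
    have : L ≤ 1 / (6 * η) := by rw [le_div_iff₀ (by positivity)]; linarith
    have e : 1 / η = 5 / (6 * η) + 1 / (6 * η) := by field_simp; norm_num
    linarith
  have hd₁ : 4 * L ≤ 5 / (6 * η) * b * g (Real.toNNReal (1 / (12 * C * A))) := by
    rw [← hκ]
    calc 4 * L ≤ 5 / (6 * η) * (6 * η * L) := by
          have : 5 / (6 * η) * (6 * η * L) = 5 * L := by field_simp
          linarith
      _ ≤ 5 / (6 * η) * (κ * b) := by gcongr
      _ = _ := by ring
  -- The choice `l₁ = 1/(12 C A)` makes `2 C l₁ = 1/(6A)`, `l₂ = 1/m` makes the batch noise of order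
  -- `C/m`, and `c₀ = 5/(6η)` is what `6ηL ≤ 1` leaves of `1/η - L`.
  have key := hE.expected_epoch_le h hψ hG hη (p := 1 - q) (q := q) (γ := m / (m + b))
    (c₀ := 5 / (6 * η)) (by linarith) hq0 (by ring) (by positivity)
    ((div_lt_one (by positivity)).2 (by linarith)) (by positivity) hc₀ rfl (by exact_mod_cast hb)
    (hG.batchSize_pos hα hm₀ h.n_pos (j + 1))
    (l₁ := Real.toNNReal (1 / (12 * C * A))) (l₂ := Real.toNNReal (1 / m))
    (Real.toNNReal_pos.2 (by positivity)) hd₁ (Real.toNNReal_pos.2 (by positivity)) hH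
    (by
      by_cases hB : batchSize g n C α m₀ ξ (j + 1) = n
      · exact Or.inl hB
      · refine Or.inr ⟨?_, hHB.resolve_left hB⟩
        rw [e1]
        exact three_mul_le_of_batchSize_ne hG hα hm₀ hL hA hA1 hκ hm hmb hη hηκ hq hB)
    (by
      rw [hl₁, e3, div_lt_one (by positivity)]
      linarith)
    (N := R.len (j + 1)) (by simpa only [hm] using hR.len_law (j + 1) (by omega) hj)
    (hR.measurable (.len (j + 1)))
    (hR.len_indep (j + 1)) (by rwa [hstart]) (by rwa [hstart])
  simp only [hfinal, hstart] at key
  rw [e2, hl₁, hl₂, e3, e4] at key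
  exact key

end Final

end SCSG

open SCSG in
theorem mainTheorem5
    {E : Type*} [NormedAddCommGroup E] [InnerProductSpace ℝ E] [CompleteSpace E]
    [MeasurableSpace E] [BorelSpace E]
    {Ω : Type*} [MeasurableSpace Ω] (P : Measure Ω) [IsProbabilityMeasure P]
    -- the composite problem on the convex set `X`, with minimizer `xs`
    (n : ℕ) (hn : 0 < n) (X : Set E) (f : Fin n → E → ℝ) (ψ w : E → ℝ)
    (hf : ∀ i, ∀ x ∈ X, DifferentiableAt ℝ (f i) x)
    (hψ : ConvexOn ℝ X ψ) (hψm : Measurable (fun x : X => ψ x))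
    (hw : ∀ x ∈ X, DifferentiableAt ℝ w x) (hwc : ConvexOn ℝ X w)
    (xs : E) (hxs : xs ∈ X) (hmin : IsMinOn (objective f ψ) X xs)
    -- B1
    (G : E → ℝ) (g : ℝ≥0 → ℝ≥0) (C : ℝ) (hG : IsCHEF G g C)
    (hB1 : ∀ x ∈ X, ∀ y ∈ X, G (x - y) ≤ bregman w x y)
    -- B2
    (L : ℝ) (hL : 0 < L)
    (hB2 : ∀ i, ∀ x, ∀ y ∈ X, 0 ≤ bregman (f i) x y ∧ bregman (f i) x y ≤ L * G (x - y))
    -- B3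
    (μ : ℝ) (hμ : 0 ≤ μ)
    (hB3 : ∀ x ∈ X, μ * bregman w xs x ≤ objective f ψ x - objective f ψ xs)
    -- the parameters
    (α m₀ ξ η : ℝ) (b : ℕ) (hα : 1 < α) (hm₀ : 0 < m₀) (hξ₀ : 0 < ξ) (hξ₁ : ξ < 1) (hη : 0 < η)
    (hm₀b : 4 * α ^ (1 / ξ) * max (b : ℝ) (4 * C) ≤ m₀)
    (hηL : 6 * η * L ≤ min 1 ((g (Real.toNNReal (1 / (12 * C * α ^ (1 / ξ)))) : ℝ) * b))
    -- the run
    (T : ℕ) (R : Trajectory Ω E n)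
    (hR : IsRun P X f ψ w T (fun _ => η) (batchSize g n C α m₀ ξ)
      (fun j => innerSize m₀ α j) (fun _ => b) R) :
    ∫⁻ ω, ENNReal.ofReal (objective f ψ (R.xt T ω) - objective f ψ xs) ∂P ≤
      ENNReal.ofReal (rateProd α ξ (Tκ α η μ) T)⁻¹ *
          (DF P f ψ xs (R.xt 0) + Dx P w L xs (R.xt 0) / ENNReal.ofReal (3 * η * L)) +
        ENNReal.ofReal (rateProd α ξ (max ((Tn g n C α m₀ ξ : ℝ) : EReal) (Tκ α η μ)) T)⁻¹ *
          (DH f G L xs / 6) * ENNReal.ofReal (min (T : ℝ) (Tn g n C α m₀ ξ)) := by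
  have h : IsProblem X f ψ w xs G L :=
    { n_pos := hn, diff_f := hf, conv_ψ := hψ, diff_w := hw, mem := hxs, min := hmin
      G_nonneg := hG.nonneg, G_symm := hG.symm, le_bregman_w := hB1, L_pos := hL
      bregman_f := hB2 }
  have hα0 : 0 < α := by linarith
  have hC := hG.C_pos
  set A := α ^ (1 / ξ) with hA
  have hαA : α ≤ A := by
    conv_lhs => rw [← Real.rpow_one α]
    exact Real.rpow_le_rpow_of_exponent_le hα.le (by rw [le_div_iff₀ hξ₀]; linarith)
  have hA1 : 1 ≤ A := by linarith
  have hA0 : 0 < A := by linarith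
  have hηL1 : 6 * η * L ≤ 1 := hηL.trans (min_le_left _ _)
  have hηκ := hηL.trans (min_le_right _ _)
  set τ := Tn g n C α m₀ ξ with hτ
  have hτ0 : 0 ≤ τ := Tn_nonneg
  set Λ := rateProd α ξ (Tκ α η μ) T with hΛ
  set Λ' := rateProd α ξ (max (τ : EReal) (Tκ α η μ)) T with hΛ'
  have hΛ0 : 0 < Λ := rateProd_pos hα _ _
  have hΛ'0 : 0 < Λ' := rateProd_pos hα _ _
  have hΛi : ENNReal.ofReal Λ⁻¹ ≠ 0 := by
    rw [ne_eq, ENNReal.ofReal_eq_zero, not_le]; positivity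
  have hΛ'i : ENNReal.ofReal Λ'⁻¹ ≠ 0 := by
    rw [ne_eq, ENNReal.ofReal_eq_zero, not_le]; positivity
  set φ : ℕ → ℝ≥0∞ := fun j => ∫⁻ ω, ENNReal.ofReal (gap f ψ xs (R.xt j ω)) ∂P with hφ
  set d : ℕ → ℝ≥0∞ := fun j => ∫⁻ ω, ENNReal.ofReal (bregman w xs (R.xt j ω)) ∂P with hd
  have hDF : DF P f ψ xs (R.xt 0) = φ 0 := rfl
  have hDx : Dx P w L xs (R.xt 0) / ENNReal.ofReal (3 * η * L)
      = ENNReal.ofReal (1 / (3 * η)) * d 0 := by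
    have : Dx P w L xs (R.xt 0) = ENNReal.ofReal L * d 0 := rfl
    rw [this, div_eq_mul_inv, ← ENNReal.ofReal_inv_of_pos (by positivity), mul_right_comm,
      ← ENNReal.ofReal_mul hL.le]
    congr 2
    field_simp
  rw [hDF, hDx]
  change φ T ≤ _
  by_cases hφ0 : φ 0 = ⊤
  · rw [hφ0, top_add, ENNReal.mul_top hΛi, top_add]; exact le_top
  by_cases hd0 : d 0 = ⊤
  · rw [hd0, ENNReal.mul_top (by rw [ne_eq, ENNReal.ofReal_eq_zero, not_le]; positivity), add_top,
      ENNReal.mul_top hΛi, top_add]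
    exact le_top
  -- If `DH` is infinite but the minimum vanishes, the convention `0 · ∞ = 0` makes the bound
  -- meaningful; in that case every batch up to epoch `T` is full.
  by_cases hHt : DH f G L xs = ⊤ ∧ 0 < min (T : ℝ) τ
  · rw [hHt.1, ENNReal.top_div_of_ne_top (by norm_num), ENNReal.mul_top hΛ'i,
      ENNReal.top_mul (by rw [ne_eq, ENNReal.ofReal_eq_zero, not_le]; exact hHt.2), add_top]
    exact le_top
  have hHB : ∀ j, j + 1 ≤ T → batchSize g n C α m₀ ξ (j + 1) ≠ n → DH f G L xs ≠ ⊤ := by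
    intro j hj hB hH
    refine hHt ⟨hH, lt_min (by exact_mod_cast (by omega : 0 < T)) ?_⟩
    have h1 : ((j + 1 : ℕ) : ℝ) ≤ τ := hG.le_Tn hα hm₀ (batchReal_lt_of_batchSize_ne hB)
    have h2 : (0 : ℝ) < ((j + 1 : ℕ) : ℝ) := by positivity
    linarith
  set K := (DH f G L xs).toReal with hK
  have hK0 : 0 ≤ K := ENNReal.toReal_nonneg
  -- A full batch carries no noise, so its noise level is set to zero, which keeps it finite in
  -- every epoch.
  let Hs : ℕ → ℝ≥0∞ := fun j => if batchSize g n C α m₀ ξ j = n then 0 else DH f G L xs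
  have hHs : ∀ j, j + 1 ≤ T → Hs (j + 1) ≠ ⊤ := fun j hj => by
    by_cases hB : batchSize g n C α m₀ ξ (j + 1) = n
    · simp [Hs, hB]
    · simpa [Hs, hB] using hHB j hj hB
  -- the parameters of the epochs
  set q := (4 * A + 1) / (20 * A ^ 2) with hq
  have hq0 : 0 < q := by positivity
  have hq1 : q < 1 := by
    rw [hq, div_lt_one (by positivity)]
    nlinarith
  let m : ℕ → ℝ := fun j => m₀ * α ^ j
  have hmj : ∀ j : ℕ, m j = innerSize m₀ α j := fun j => by
    simp only [m, innerSize, Real.rpow_natCast]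
  have hm0 : ∀ j, 0 < m j := fun j => by positivity
  have hb1 : 4 * A * b ≤ m₀ := (mul_le_mul_of_nonneg_left (le_max_left _ _)
    (by positivity)).trans hm₀b
  have hC1 : 4 * A * (4 * C) ≤ m₀ := (mul_le_mul_of_nonneg_left (le_max_right _ _)
    (by positivity)).trans hm₀b
  have hu : ∀ j, 4 * A * (b / m j) * α ^ j ≤ 1 := fun j => by
    have e : 4 * A * (b / m j) * α ^ j = 4 * A * b / m₀ := by simp only [m]; field_simp
    rw [e, div_le_one hm₀]; exact hb1
  have hv : ∀ j, 16 * A * (C / m j) * α ^ j ≤ 1 := fun j => by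
    have e : 16 * A * (C / m j) * α ^ j = 4 * A * (4 * C) / m₀ := by
      simp only [m]; field_simp; norm_num
    rw [e, div_le_one hm₀]; exact hC1
  have hpow : ∀ j : ℕ, 1 ≤ α ^ j := fun j => one_le_pow₀ hα.le
  have hu' : ∀ j, 4 * A * (b / m j) ≤ 1 := fun j =>
    (le_mul_of_one_le_right (by have := hm0 j; positivity) (hpow j)).trans (hu j)
  have hv' : ∀ j, 16 * A * (C / m j) ≤ 1 := fun j =>
    (le_mul_of_one_le_right (by have := hm0 j; positivity) (hpow j)).trans (hv j)
  have hc56 : 5 / 6 ≤ 1 - 1 / (6 * A) := by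
    have : 1 / (6 * A) ≤ 1 / 6 := one_div_le_one_div_of_le (by norm_num) (by linarith)
    linarith
  let s : ℕ → ℝ := fun j => (1 - q) / η * (b / m j)
  have hs0 : ∀ j, 0 ≤ s j := fun j =>
    mul_nonneg (div_nonneg (by linarith) hη.le) (div_nonneg b.cast_nonneg (hm0 j).le)
  let V : ℕ → ℝ := fun j => (φ j).toReal + s j / (1 - 1 / (6 * A)) * (d j).toReal
  -- finiteness and the inequality for each epoch
  have hep : ∀ j, j + 1 ≤ T → φ j ≠ ⊤ → d j ≠ ⊤ → φ (j + 1) ≠ ⊤ ∧ d (j + 1) ≠ ⊤ ∧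
      (1 - 1 / (6 * A)) * (φ (j + 1)).toReal + s (j + 1) * (d (j + 1)).toReal
        ≤ (b / m (j + 1) + q + 1 / (6 * A) + 2 * (C / m (j + 1))) * (φ j).toReal
          + s (j + 1) * (d j).toReal + C / m (j + 1) * (Hs (j + 1)).toReal := by
    intro j hj h1 h2
    refine hR.epoch_le h hψm hG hα hm₀ hη hA hA1 rfl (hmj (j + 1)) ?_ hηL1 hηκ hq hj
      (hHs j hj) ?_ h1 h2
    · exact hb1.trans (le_mul_of_one_le_right hm₀.le (hpow _))
    · by_cases hB : batchSize g n C α m₀ ξ (j + 1) = n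
      · exact Or.inl hB
      · exact Or.inr (if_neg hB)
  have hfin : ∀ j, j ≤ T → φ j ≠ ⊤ ∧ d j ≠ ⊤ := by
    intro j
    induction j with
    | zero => exact fun _ => ⟨hφ0, hd0⟩
    | succ j ih =>
      intro hj
      obtain ⟨h1, h2⟩ := ih (by omega)
      exact ⟨(hep j hj h1 h2).1, (hep j hj h1 h2).2.1⟩
  have hstrong : ∀ j, j ≤ T → μ * (d j).toReal ≤ (φ j).toReal := by
    intro j hj
    have h1 : ENNReal.ofReal μ * d j ≤ φ j := by
      simp only [hφ, hd]
      rw [← lintegral_const_mul' _ _ ENNReal.ofReal_ne_top]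
      refine lintegral_mono fun ω => ?_
      rw [← ENNReal.ofReal_mul hμ]
      exact ENNReal.ofReal_le_ofReal (hB3 _ ((hR.x_mem hj).1 ω))
    have h2 := ENNReal.toReal_mono (hfin j hj).1 h1
    rwa [ENNReal.toReal_mul, ENNReal.toReal_ofReal hμ] at h2
  have hVrec : ∀ j, j + 1 ≤ T → V (j + 1)
      ≤ (if ((((j + 1 : ℕ) : ℝ)) : EReal) ≤ Tκ α η μ then α else α ^ (1 / ξ))⁻¹ * V j
        + if batchSize g n C α m₀ ξ (j + 1) = n then 0 else (α ^ (j + 1))⁻¹ * (K / 6) := by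
    intro j hj
    obtain ⟨hφj, hdj⟩ := hfin j (by omega)
    obtain ⟨-, -, hineq⟩ := hep j hj hφj hdj
    -- The distance weight is inversely proportional to `m j`, hence shrinks by exactly `α` per
    -- epoch.
    have hss : α * (s (j + 1) / (1 - 1 / (6 * A))) = s j / (1 - 1 / (6 * A)) := by
      simp only [s, m, pow_succ]
      field_simp
    have hσ := mixture_coefficient_le hA1 (hu' (j + 1)) (hv' (j + 1))
    have hHr : (if batchSize g n C α m₀ ξ (j + 1) = n then 0 else (α ^ (j + 1))⁻¹ * (K / 6))
        = (α ^ (j + 1))⁻¹ * ((Hs (j + 1)).toReal / 6) := by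
      by_cases hB : batchSize g n C α m₀ ξ (j + 1) = n
      · simp [Hs, hB]
      · simp [Hs, hB, hK]
    have hφnn : 0 ≤ (φ j).toReal := ENNReal.toReal_nonneg
    have hdnn : 0 ≤ (d j).toReal := ENNReal.toReal_nonneg
    rw [hHr]
    simp only [V]
    rw [← hss]
    refine contraction_le hA1 (by positivity) (hv (j + 1)) ENNReal.toReal_nonneg hineq ?_
    split_ifs with hc
    · exact slow_rate_le hα hαA hφnn hσ
    · refine fast_rate_le hα hαA hφnn hσ ?_
      have hμ0 : μ ≠ 0 := by
        rintro rfl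
        exact hc (by simp [Tκ])
      have hμp : 0 < μ := lt_of_le_of_ne hμ (Ne.symm hμ0)
      rw [Tκ, if_neg hμ0, not_le, EReal.coe_lt_coe_iff,
        Real.logb_lt_iff_lt_rpow hα (by positivity), Real.rpow_natCast,
        div_lt_iff₀ (by positivity)] at hc
      -- Being past `T_κ*` means `α^{j+1} η μ > 1`, so (B3) converts distance into gap. The factor
      -- `α^{j+1}` is cancelled by `m (j + 1)` in the distance weight.
      have h1 : (d j).toReal / η ≤ α ^ (j + 1) * (φ j).toReal := by
        rw [div_le_iff₀ hη]
        calc (d j).toReal ≤ α ^ (j + 1) * (η * μ) * (d j).toReal :=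
              le_mul_of_one_le_left hdnn hc.le
          _ = α ^ (j + 1) * η * (μ * (d j).toReal) := by ring
          _ ≤ α ^ (j + 1) * η * (φ j).toReal := by gcongr; exact hstrong j (by omega)
          _ = _ := by ring
      have hbm : 0 ≤ b / m (j + 1) := div_nonneg b.cast_nonneg (hm0 _).le
      calc s (j + 1) * (d j).toReal = (1 - q) * (b / m (j + 1) * ((d j).toReal / η)) := by
            simp only [s]; ring
        _ ≤ 1 * (b / m (j + 1) * (α ^ (j + 1) * (φ j).toReal)) := by
            gcongr
            linarith
        _ = b / m (j + 1) * α ^ (j + 1) * (φ j).toReal := by ring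
        _ ≤ 1 / (4 * A) * (φ j).toReal := by
            gcongr
            rw [le_div_iff₀ (by positivity)]
            linarith [hu (j + 1)]
  have hfinal := lyapunov_le hG hα hm₀ hξ₀ hξ₁ (by positivity : 0 ≤ K / 6) T hVrec
  have hVT : (φ T).toReal ≤ V T := le_add_of_nonneg_right
    (mul_nonneg (div_nonneg (hs0 T) (by linarith)) ENNReal.toReal_nonneg)
  -- Here `b / m₀ ≤ 1/4` and the denominator is at least `5/6`, giving `3/(10η)`; this yields the
  -- constant 3 in the bound.
  have hs03 : s 0 / (1 - 1 / (6 * A)) ≤ 1 / (3 * η) := by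
    rw [div_le_iff₀ (by linarith)]
    have h1 : (b : ℝ) / m 0 ≤ 1 / 4 := by
      have := hu' 0
      have h2 : 0 ≤ (b : ℝ) / m 0 := div_nonneg b.cast_nonneg (hm0 0).le
      have := mul_le_mul_of_nonneg_right hA1 h2
      linarith
    calc s 0 ≤ 1 / η * (1 / 4) := by
          simp only [s]
          gcongr
          linarith
      _ ≤ 1 / (3 * η) * (5 / 6) := by
          rw [show 1 / (3 * η) * (5 / 6) = 1 / η * (5 / 18) by field_simp; norm_num]
          exact mul_le_mul_of_nonneg_left (by norm_num) (by positivity)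
      _ ≤ _ := by gcongr
  have hV0' : V 0 ≤ (φ 0).toReal + 1 / (3 * η) * (d 0).toReal := by
    simp only [V]
    gcongr
  have hmin0 : 0 ≤ min (T : ℝ) τ := le_min T.cast_nonneg hτ0
  have hK6 : ENNReal.ofReal (K / 6) ≤ DH f G L xs / 6 := by
    rw [ENNReal.ofReal_div_of_pos (by norm_num), ENNReal.ofReal_ofNat]
    gcongr
    exact ENNReal.ofReal_toReal_le
  calc φ T = ENNReal.ofReal (φ T).toReal := (ENNReal.ofReal_toReal (hfin T le_rfl).1).symm
    _ ≤ ENNReal.ofReal (Λ⁻¹ * ((φ 0).toReal + 1 / (3 * η) * (d 0).toReal)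
          + Λ'⁻¹ * (K / 6) * min (T : ℝ) τ) := by
        refine ENNReal.ofReal_le_ofReal (hVT.trans (hfinal.trans ?_))
        gcongr
    _ = ENNReal.ofReal Λ⁻¹ * (φ 0 + ENNReal.ofReal (1 / (3 * η)) * d 0)
          + ENNReal.ofReal Λ'⁻¹ * ENNReal.ofReal (K / 6) * ENNReal.ofReal (min (T : ℝ) τ) := by
        rw [ENNReal.ofReal_add (by positivity) (by positivity), ENNReal.ofReal_mul (by positivity),
          ENNReal.ofReal_add (by positivity) (by positivity), ENNReal.ofReal_toReal hφ0,
          ENNReal.ofReal_mul (by positivity), ENNReal.ofReal_toReal hd0,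
          ENNReal.ofReal_mul (by positivity), ENNReal.ofReal_mul (by positivity)]
    _ ≤ _ := by gcongr
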